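/- Let $\mathbb{H}$ be the quaternions, $\mathbb{S}=\{I\in\mathbb{H}: I^2=-1\}$ and $L_I=\mathbb{R}+I\mathbb{R}$ for $I\in\mathbb{S}$; write $\Omega_I=\Omega\cap L_I$ for $\Omega\subseteq\mathbb{H}$. A domain $\Omega\subseteq\mathbb{H}$ is a *symmetric slice domain* if $\Omega\cap\mathbb{R}\ne\emptyset$, every $\Omega_I$ is connected, and $\Omega$ is axially symmetric about $\mathbb{R}$ (if $x+yI\in\Omega$ with $x,y\in\mathbb{R}$, $I\in\mathbb{S}$, then $x+yJ\in\Omega$ for all $J\in\mathbb{S}$). A function $f:\Omega\to\mathbb{H}$ is *(slice) regular* if for every $I\in\mathbb{S}$ the restriction $f_I=f|_{\Omega_I}$ is of class $C^1$ and $\frac12\left(\frac{\partial}{\partial x}+I\frac{\partial}{\partial y}\right)f_I(x+yI)\equiv 0$; it is *slice preserving* if $f(\Omega_I)\subseteq L_I$ for all $I\in\mathbb{S}$. For a domain $\Omega\subseteq\mathbb{H}$ consider upper semicontinuous $u:\Omega\to[-\infty,+\infty)$ with $u\not\equiv-\infty$. Such a $u$ is *weakly subharmonic* ($u\in\mathsf{wsh}(\Omega)$)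 if for every $I\in\mathbb{S}$ its restriction to $\Omega_I$ is subharmonic after identifying $L_I$ with $\mathbb{C}$, and *strongly subharmonic* ($u\in\mathsf{ssh}(\Omega)$) if for every $I\in\mathbb{S}$ it is plurisubharmonic with respect to the constant complex structure $v\mapsto Iv$, i.e. $\lambda\mapsto u(a+\lambda b)$ is subharmonic on $\{\lambda\in L_I: a+\lambda b\in\Omega\}$ for all $a\in\mathbb{H}$, $b\in\mathbb{H}\setminus\{0\}$. (Here the constant $-\infty$ counts as subharmonic in one complex variable.) For $q_0\in\Omega$ let $$\mathsf{wsh}_{q_0}(\Omega)=\Big\{u\in\mathsf{wsh}(\Omega): u<0,\ \limsup_{q\to q_0}\big|u(q)-\log|q-q_0|\big|<\infty\Big\},\qquad \mathsf{ssh}_{q_0}(\Omega)=\mathsf{wsh}_{q_0}(\Omega)\cap\mathsf{ssh}(\Omega).$$ Let $w$ and $s$ be the pointwise suprema over $\mathsf{wsh}_{q_0}(\Omega)$ and $\mathsf{ssh}_{q_0}(\Omega)$ respectively (equal to $-\infty$ if the family is empty). The *Green function* $g^\Omega_{q_0}$ and the *strongly subharmonic Green function* $G^\Omega_{q_0}$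 are the upper semicontinuous regularizations $w^*$ and $s^*$ on $\Omega$. **Lemma.** Let $\Omega\subseteq\mathbb{H}$ be a symmetric slice domain, let $q_0\in\Omega$, and let $f:\Omega\to\mathbb{H}$ be a nonconstant regular function (so that $f(\Omega)$ is a domain). Then $$G^{f(\Omega)}_{f(q_0)}(f(q))\le g^{\Omega}_{q_0}(q)\qquad\text{for all }q\in\Omega.$$ If, moreover, $f$ is slice preserving, then $$g^{f(\Omega)}_{f(q_0)}(f(q))\le g^{\Omega}_{q_0}(q)\qquad\text{for all }q\in\Omega.$$ If, additionally, $f$ admits a regular inverse $f^{-1}:f(\Omega)\to\Omega$, then the last inequality is an equality at all $q\in\Omega$. -/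

import Mathlib

open Filter Topology MeasureTheory
open scoped Quaternion ENNReal

noncomputable section

namespace SliceGreen

/-- The sphere `𝕊` of quaternionic imaginary units. -/
def imagUnits : Set ℍ[ℝ] := {I | I * I = -1}

/-- The map `x + iy ↦ x + yI` from `ℂ` to the quaternions; for `I ∈ 𝕊` it identifies `ℂ` with
the complex plane `L_I = ℝ + Iℝ`. -/
def slice (I : ℍ[ℝ]) (z : ℂ) : ℍ[ℝ] := (z.re : ℍ[ℝ]) + (z.im : ℍ[ℝ]) * I

/-- The plane `L_I = ℝ + Iℝ`. -/
def slicePlane (I : ℍ[ℝ]) : Set ℍ[ℝ] := Set.range (slice I)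

/-- Symmetric slice domains: domains (nonempty connected open sets) that meet the real axis, have
connected intersection with every `L_I`, and are axially symmetric about the real axis. -/
structure IsSymmetricSliceDomain (Ω : Set ℍ[ℝ]) : Prop where
  isOpen : IsOpen Ω
  isConnected : IsConnected Ω
  meets_real : ∃ x : ℝ, (x : ℍ[ℝ]) ∈ Ω
  slice_connected : ∀ I ∈ imagUnits, IsConnected (Ω ∩ slicePlane I)
  symmetric : ∀ (x y : ℝ), ∀ I ∈ imagUnits, ∀ J ∈ imagUnits,
    (x : ℍ[ℝ]) + (y : ℍ[ℝ]) * I ∈ Ω → (x : ℍ[ℝ]) + (y : ℍ[ℝ]) * J ∈ Ω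

/-- Slice regularity of `f` on an open set `Ω`: for every `I ∈ 𝕊` the restriction
`(x, y) ↦ f (x + yI)` is of class `C¹` and satisfies `(1/2) (∂/∂x + I ∂/∂y) f (x + yI) = 0`. -/
def IsSliceRegularOn (f : ℍ[ℝ] → ℍ[ℝ]) (Ω : Set ℍ[ℝ]) : Prop :=
  ∀ I ∈ imagUnits,
    ContDiffOn ℝ 1 (f ∘ slice I) (slice I ⁻¹' Ω) ∧
    ∀ z ∈ slice I ⁻¹' Ω,
      (1 / 2 : ℍ[ℝ]) *
        (fderiv ℝ (f ∘ slice I) z 1 + I * fderiv ℝ (f ∘ slice I) z Complex.I) = 0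

/-- `f` is slice preserving on `Ω`: `f (Ω ∩ L_I) ⊆ L_I` for all `I ∈ 𝕊`. -/
def IsSlicePreservingOn (f : ℍ[ℝ] → ℍ[ℝ]) (Ω : Set ℍ[ℝ]) : Prop :=
  ∀ I ∈ imagUnits, Set.MapsTo f (Ω ∩ slicePlane I) (slicePlane I)

/-- The mean `(1/2π) ∫₀^{2π} u (a + r e^{iθ}) dθ` of an extended-real function, as the difference
of the means of its positive and negative parts. It is used for functions that are bounded above
on the circle, where no `∞ - ∞` arises and the value lies in `[-∞, ∞)`. -/
def circleMean (u : ℂ → EReal) (a : ℂ) (r : ℝ) : EReal :=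
  (((∫⁻ θ in Set.Ioc 0 (2 * Real.pi), (u (circleMap a r θ)).toENNReal) /
      ENNReal.ofReal (2 * Real.pi) : ℝ≥0∞) : EReal) -
  (((∫⁻ θ in Set.Ioc 0 (2 * Real.pi), (-u (circleMap a r θ)).toENNReal) /
      ENNReal.ofReal (2 * Real.pi) : ℝ≥0∞) : EReal)

/-- Subharmonic functions `U → [-∞, ∞)` on an open set `U ⊆ ℂ`: upper semicontinuous, with the
submean inequality on every closed disc contained in `U`. The function `-∞` is allowed. -/
structure IsSubharmonicOn (u : ℂ → EReal) (U : Set ℂ) : Prop where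
  usc : UpperSemicontinuousOn u U
  ne_top : ∀ z ∈ U, u z ≠ ⊤
  submean : ∀ (a : ℂ) (r : ℝ), 0 < r → Metric.closedBall a r ⊆ U → u a ≤ circleMean u a r

/-- The class `us(Ω)`: upper semicontinuous functions `u : Ω → [-∞, ∞)` with `u ≢ -∞`.
Here and below only the values of `u` on `Ω` matter. -/
def us (Ω : Set ℍ[ℝ]) : Set (ℍ[ℝ] → EReal) :=
  {u | UpperSemicontinuousOn u Ω ∧ (∀ q ∈ Ω, u q ≠ ⊤) ∧ ∃ q ∈ Ω, u q ≠ ⊥}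

/-- Weakly subharmonic functions: every restriction to `Ω ∩ L_I` is subharmonic. -/
def wsh (Ω : Set ℍ[ℝ]) : Set (ℍ[ℝ] → EReal) :=
  {u | u ∈ us Ω ∧ ∀ I ∈ imagUnits, IsSubharmonicOn (u ∘ slice I) (slice I ⁻¹' Ω)}

/-- Plurisubharmonicity on `Ω` with respect to the constant orthogonal complex structure
`v ↦ I v`: the restriction to each complex line `{a + λ b : λ ∈ L_I}`, `b ≠ 0`, is subharmonic
(possibly `-∞`). -/
def IsPlurisubharmonicOn (I : ℍ[ℝ]) (u : ℍ[ℝ] → EReal) (Ω : Set ℍ[ℝ]) : Prop :=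
  ∀ a b : ℍ[ℝ], b ≠ 0 →
    IsSubharmonicOn (fun z : ℂ => u (a + slice I z * b)) {z : ℂ | a + slice I z * b ∈ Ω}

/-- Strongly subharmonic functions: plurisubharmonic with respect to every constant orthogonal
complex structure `v ↦ I v`, `I ∈ 𝕊`. -/
def ssh (Ω : Set ℍ[ℝ]) : Set (ℍ[ℝ] → EReal) :=
  {u | u ∈ us Ω ∧ ∀ I ∈ imagUnits, IsPlurisubharmonicOn I u Ω}

/-- Negative weakly subharmonic functions with
`limsup_{q → q₀} |u q - log |q - q₀|| < ∞`. -/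
def wshPole (Ω : Set ℍ[ℝ]) (q₀ : ℍ[ℝ]) : Set (ℍ[ℝ] → EReal) :=
  {u | u ∈ wsh Ω ∧ (∀ q ∈ Ω, u q < 0) ∧
    limsup (fun q => (u q - ((Real.log ‖q - q₀‖ : ℝ) : EReal)).abs) (𝓝[Ω \ {q₀}] q₀) < ⊤}

/-- The strongly subharmonic functions in `wshPole Ω q₀`. -/
def sshPole (Ω : Set ℍ[ℝ]) (q₀ : ℍ[ℝ]) : Set (ℍ[ℝ] → EReal) :=
  wshPole Ω q₀ ∩ ssh Ω

/-- Pointwise supremum of a family of functions (`-∞` for the empty family). -/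
def supFamily (S : Set (ℍ[ℝ] → EReal)) (q : ℍ[ℝ]) : EReal := ⨆ u ∈ S, u q

/-- Upper semicontinuous regularization on `Ω`: `w*(q) = limsup_{p → q, p ∈ Ω} w p`, where
`p = q` is allowed. -/
def uscReg (Ω : Set ℍ[ℝ]) (w : ℍ[ℝ] → EReal) (q : ℍ[ℝ]) : EReal := limsup w (𝓝[Ω] q)

/-- The Green function `g^Ω_{q₀}` of `Ω` with logarithmic pole at `q₀`. -/
def greenFn (Ω : Set ℍ[ℝ]) (q₀ : ℍ[ℝ]) : ℍ[ℝ] → EReal :=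
  uscReg Ω (supFamily (wshPole Ω q₀))

/-- The strongly subharmonic Green function `G^Ω_{q₀}` of `Ω` with logarithmic pole at `q₀`. -/
def strongGreenFn (Ω : Set ℍ[ℝ]) (q₀ : ℍ[ℝ]) : ℍ[ℝ] → EReal :=
  uscReg Ω (supFamily (sshPole Ω q₀))

end SliceGreen

end

noncomputable section

namespace SliceGreen

/-! ### Circle means and harmonic majorants in the plane. -/

section

/-! ### Circle means of extended-real functions -/

/-! A competitor `v` on f(Ω) with pole at f(q₀) is pulled back to v ∘ f, and the pullback is
compared with the competitors on Ω. Three points need an argument.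

Subharmonicity. On L_I a regular f is a holomorphic curve in ℍ, where ℍ carries the complex
structure of left multiplication by I. A strongly subharmonic `v` is plurisubharmonic for that
structure, hence subharmonic along the curve (`isSubharmonicOn_comp`). If f preserves slices, the
curve is a one-variable holomorphic function into L_I, and weak subharmonicity of `v` is enough.

The pole. From f(q) - f(q₀) = O(|q - q₀|) one gets v ∘ f ≤ log|q - q₀| + C near q₀. The matching
lower bound can fail, since f may attain f(q₀) with multiplicity at q₀, or on the whole sphere
through q₀. So v ∘ f is enlarged (`exists_wshPole_ge`). Let h be v ∘ f on the slice L_I through q₀.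
Copy h to every slice, oriented towards I, and inside a small disc take the maximum with log(c|q -
q₀|). On an annulus around q₀ in L_I, h is bounded below, so a small c makes the logarithm lie below
h there, and the gluing is subharmonic on each slice. Copying h is needed because on the other
slices v ∘ f may have no lower bound on the annulus.

Regularization. The pointwise inequality between suprema must survive upper semicontinuous
regularization, but f need not be open at q. It is open on axially symmetric sets
(`IsSliceRegularOn.eventually_exists_eq`): the sphere through x + yJ meets the fibre over w exactly
when the holomorphic function N_w = `stemNorm` of (a - w, b) vanishes at x + iy, where f(x + yJ) = a
+ J b, and zeros persist when w moves. This suffices because the supremum over `wshPole` is almost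
axially symmetric (`supFamily_slice_le`): slices meet only in ℝ, so a competitor may be raised on a
single slice to its values on another one, provided this does not destroy the pole. Hence all values
near the sphere through q are controlled by one slice chosen near q (`uscReg_supFamily_le`).

For a slice preserving f with regular inverse, f(Ω) is again a symmetric slice domain and the
inverse is slice preserving, so the inequality applies to both maps. -/

theorem circleMean_mono {u v : ℂ → EReal} {a : ℂ} {r : ℝ} (hr : 0 ≤ r)
    (h : ∀ z ∈ Metric.sphere a r, u z ≤ v z) : circleMean u a r ≤ circleMean v a r := by
  have h' : ∀ θ, u (circleMap a r θ) ≤ v (circleMap a r θ) :=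
    fun θ => h _ (circleMap_mem_sphere a hr θ)
  unfold circleMean
  refine EReal.sub_le_sub ?_ ?_
  · rw [EReal.coe_ennreal_le_coe_ennreal_iff]
    gcongr
    exact EReal.toENNReal_le_toENNReal (h' _)
  · rw [EReal.coe_ennreal_le_coe_ennreal_iff]
    gcongr
    exact EReal.toENNReal_le_toENNReal (EReal.neg_le_neg_iff.2 (h' _))

theorem circleMean_coe {g : ℂ → ℝ} {a : ℂ} {r : ℝ} (hg : CircleIntegrable g a r) :
    circleMean (fun z => (g z : EReal)) a r = (Real.circleAverage g a r : ℝ) := by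
  have hpi : (0 : ℝ) < 2 * Real.pi := Real.two_pi_pos
  have hi : Integrable (fun θ => g (circleMap a r θ))
      (volume.restrict (Set.Ioc 0 (2 * Real.pi))) :=
    (intervalIntegrable_iff_integrableOn_Ioc_of_le hpi.le).1 hg
  have e1 : ∀ x : ℝ, (x : EReal).toENNReal = ENNReal.ofReal x := fun x => by
    rw [EReal.toENNReal_of_ne_top (EReal.coe_ne_top x), EReal.toReal_coe]
  have e2 : ∀ x : ℝ, (-(x : EReal)).toENNReal = ENNReal.ofReal (-x) := fun x => by
    rw [← EReal.coe_neg, e1]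
  have f1 : ∫⁻ θ in Set.Ioc 0 (2 * Real.pi), ENNReal.ofReal (g (circleMap a r θ)) ≠ ⊤ :=
    (hi.lintegral_lt_top).ne
  have f2 : ∫⁻ θ in Set.Ioc 0 (2 * Real.pi), ENNReal.ofReal (-g (circleMap a r θ)) ≠ ⊤ :=
    (hi.neg.lintegral_lt_top).ne
  rw [Real.circleAverage_def, intervalIntegral.integral_of_le hpi.le,
    integral_eq_lintegral_pos_part_sub_lintegral_neg_part hi]
  unfold circleMean
  simp only [e1, e2]
  have key : ∀ A : ℝ≥0∞, A ≠ ⊤ → ((A / ENNReal.ofReal (2 * Real.pi) : ℝ≥0∞) : EReal)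
      = (((2 * Real.pi)⁻¹ * A.toReal : ℝ) : EReal) := by
    intro A hA
    have h1 : A / ENNReal.ofReal (2 * Real.pi) ≠ ⊤ :=
      ENNReal.div_ne_top hA (ENNReal.ofReal_pos.2 hpi).ne'
    rw [← EReal.coe_ennreal_toReal h1, ENNReal.toReal_div, ENNReal.toReal_ofReal hpi.le,
      div_eq_inv_mul]
  rw [key _ f1, key _ f2, ← EReal.coe_sub, smul_eq_mul, mul_sub]

theorem le_circleMean_const {c : EReal} (hc : c ≠ ⊤) (a : ℂ) (r : ℝ) :
    c ≤ circleMean (fun _ => c) a r := by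
  induction c with
  | bot => exact bot_le
  | top => exact absurd rfl hc
  | coe x =>
    rw [circleMean_coe (g := fun _ => x) (circleIntegrable_const x a r), Real.circleAverage_const]

theorem setLIntegral_Ioc_comp_add {F : ℝ → ℝ≥0∞} (hF : Function.Periodic F (2 * Real.pi))
    (η : ℝ) : ∫⁻ θ in Set.Ioc 0 (2 * Real.pi), F (θ + η) = ∫⁻ θ in Set.Ioc 0 (2 * Real.pi), F θ := by
  have hpi : (0 : ℝ) < 2 * Real.pi := Real.two_pi_pos
  have e : MeasurePreserving (fun θ : ℝ => θ + η) volume volume := measurePreserving_add_right _ η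
  have h1 := e.setLIntegral_comp_preimage_emb (measurableEmbedding_addRight η) F
    (Set.Ioc η (η + 2 * Real.pi))
  have h2 : (fun θ : ℝ => θ + η) ⁻¹' (Set.Ioc η (η + 2 * Real.pi)) = Set.Ioc 0 (2 * Real.pi) := by
    ext θ; simp only [Set.mem_preimage, Set.mem_Ioc]; constructor <;> rintro ⟨h, h'⟩ <;>
      constructor <;> linarith
  rw [h2] at h1
  rw [h1]
  have h3 := IsAddFundamentalDomain.setLIntegral_eq (isAddFundamentalDomain_Ioc hpi η)
    (isAddFundamentalDomain_Ioc hpi 0) F (by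
      rintro ⟨g, hg⟩ x
      obtain ⟨n, rfl⟩ := AddSubgroup.mem_zmultiples_iff.1 hg
      have := hF.zsmul n x
      rw [add_comm] at this
      exact this)
  rw [h3, zero_add]

/-- Multiplying by `b` scales the radius by ‖b‖ and shifts the angle by `b.arg`; the shift is
harmless by periodicity. No measurability of `u` is required. -/
theorem circleMean_comp_mul (u : ℂ → EReal) (a b : ℂ) (r : ℝ) :
    circleMean (fun z => u (a + z * b)) 0 r = circleMean u a (r * ‖b‖) := by
  have hm : ∀ θ, a + circleMap 0 r θ * b = circleMap a (r * ‖b‖) (θ + b.arg) := by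
    intro θ
    conv_lhs => rw [← Complex.norm_mul_exp_arg_mul_I b]
    simp only [circleMap, zero_add, Complex.ofReal_mul, Complex.ofReal_add, add_mul, Complex.exp_add]
    ring
  unfold circleMean
  simp only [hm]
  rw [setLIntegral_Ioc_comp_add (F := fun θ => (u (circleMap a (r * ‖b‖) θ)).toENNReal)
      ((periodic_circleMap _ _).comp fun z => (u z).toENNReal),
    setLIntegral_Ioc_comp_add (F := fun θ => (-u (circleMap a (r * ‖b‖) θ)).toENNReal)
      ((periodic_circleMap _ _).comp (fun z => (-u z).toENNReal))]

/-! ### Approximation of upper semicontinuous functions from above -/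

/-- Sup-convolution of truncations: g_n(x) is the supremum over y in K of max(F y, -n) - n·d(x, y).
It is n-Lipschitz, and it decreases in n because the truncation drops while the penalty grows. -/
theorem exists_antitone_continuous_tendsto {X : Type*} [MetricSpace X] {K : Set X}
    (hK : IsCompact K) (hne : K.Nonempty) {F : X → EReal} (hF : UpperSemicontinuousOn F K)
    (htop : ∀ x ∈ K, F x ≠ ⊤) :
    ∃ g : ℕ → X → ℝ, (∀ n, Continuous (g n)) ∧ (∀ x, Antitone fun n => g n x) ∧
      (∀ n, ∀ x ∈ K, F x ≤ g n x) ∧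
      ∀ x ∈ K, Tendsto (fun n => (g n x : EReal)) atTop (𝓝 (F x)) := by
  obtain ⟨x₀, hx₀, hmax⟩ := hF.exists_isMaxOn hne hK
  obtain ⟨M, hM0, hM⟩ : ∃ M : ℝ, 0 ≤ M ∧ ∀ y ∈ K, F y ≤ M := by
    refine ⟨max (F x₀).toReal 0, le_max_right _ _, fun y hy => (hmax hy).trans ?_⟩
    exact (EReal.le_coe_toReal (htop _ hx₀)).trans (EReal.coe_le_coe_iff.2 (le_max_left _ _))
  have : Nonempty K := hne.to_subtype
  set φ : ℕ → K → ℝ := fun n y => (max (F y) ((-(n : ℝ) : ℝ) : EReal)).toReal with hφ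
  have hbot : ∀ n (y : K), max (F y) ((-(n : ℝ) : ℝ) : EReal) ≠ ⊥ := fun n y =>
    (lt_of_lt_of_le (EReal.bot_lt_coe _) (le_max_right _ _)).ne'
  have htop' : ∀ n (y : K), max (F y) ((-(n : ℝ) : ℝ) : EReal) ≠ ⊤ := fun n y =>
    (max_lt (htop _ y.2).lt_top (EReal.coe_lt_top _)).ne
  have hφc : ∀ n y, (φ n y : EReal) = max (F y) ((-(n : ℝ) : ℝ) : EReal) := fun n y =>
    EReal.coe_toReal (htop' n y) (hbot n y)
  have hφM : ∀ n y, φ n y ≤ M := fun n y => by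
    rw [← EReal.coe_le_coe_iff, hφc]
    exact max_le (hM _ y.2) (EReal.coe_le_coe_iff.2 (by
      have : (0 : ℝ) ≤ n := n.cast_nonneg
      linarith))
  have hbdd : ∀ (n : ℕ) (x : X), BddAbove (Set.range fun y : K => φ n y - n * dist x (y : X)) := fun n x =>
    ⟨M, by
      rintro _ ⟨y, rfl⟩
      have : (0 : ℝ) ≤ n * dist x (y : X) := by positivity
      have := hφM n y
      simp only; linarith⟩
  set g : ℕ → X → ℝ := fun n x => ⨆ y : K, (φ n y - n * dist x (y : X)) with hg
  have hge : ∀ n, ∀ x ∈ K, F x ≤ g n x := by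
    intro n x hx
    have h1 : φ n ⟨x, hx⟩ ≤ g n x := by
      have := le_ciSup (hbdd n x) ⟨x, hx⟩
      simpa using this
    refine le_trans ?_ (EReal.coe_le_coe_iff.2 h1)
    rw [hφc]; exact le_max_left _ _
  refine ⟨g, ?_, ?_, hge, ?_⟩
  · intro n
    refine (LipschitzWith.of_le_add_mul (n : NNReal) fun x x' => ?_).continuous
    refine ciSup_le fun y => ?_
    have h1 := le_ciSup (hbdd n x') y
    have h2 : dist x' (y : X) ≤ dist x y + dist x x' := by
      rw [add_comm, dist_comm x x']; exact dist_triangle _ _ _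
    have h3 : (n : ℝ) * dist x' (y : X) ≤ n * (dist x y + dist x x') := by gcongr
    simp only [hg, NNReal.coe_natCast] at h1 ⊢
    linarith
  · intro x m n hmn
    refine ciSup_le fun y => ?_
    refine le_trans ?_ (le_ciSup (hbdd m x) y)
    have hmn' : (m : ℝ) ≤ n := by exact_mod_cast hmn
    have h1 : φ n y ≤ φ m y := by
      rw [← EReal.coe_le_coe_iff, hφc, hφc]
      exact max_le_max le_rfl (EReal.coe_le_coe_iff.2 (by linarith))
    have h2 : (m : ℝ) * dist x (y : X) ≤ n * dist x y := by gcongr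
    linarith
  · intro x hx
    rw [tendsto_order]
    refine ⟨fun c hc => Eventually.of_forall fun n => hc.trans_le (hge n x hx), fun c hc => ?_⟩
    obtain ⟨c', hc1, hc2⟩ := EReal.lt_iff_exists_real_btwn.1 hc
    obtain ⟨δ, hδ, hball⟩ := Metric.mem_nhdsWithin_iff.1 (hF x hx _ hc1)
    -- The first bound puts the truncation level -n below c'; the second makes the penalty nδ for
    -- points at distance at least δ outweigh the global bound M.
    obtain ⟨N, hN⟩ := exists_nat_ge (max (-c') ((M - c') / δ))
    filter_upwards [eventually_ge_atTop N] with n hn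
    refine lt_of_le_of_lt ?_ hc2
    rw [EReal.coe_le_coe_iff]
    have hnN : (N : ℝ) ≤ n := by exact_mod_cast hn
    have h1 : -c' ≤ n := (le_max_left _ _).trans (hN.trans hnN)
    have h2 : M - c' ≤ n * δ := by
      rw [← div_le_iff₀ hδ]; exact (le_max_right _ _).trans (hN.trans hnN)
    refine ciSup_le fun y => ?_
    by_cases hy : dist x (y : X) < δ
    · have h3 : φ n y ≤ c' := by
        rw [← EReal.coe_le_coe_iff, hφc]
        refine max_le (le_of_lt ?_) (EReal.coe_le_coe_iff.2 (by linarith))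
        exact hball ⟨by rwa [Metric.mem_ball, dist_comm], y.2⟩
      have : (0 : ℝ) ≤ n * dist x (y : X) := by positivity
      linarith
    · have h3 : (n : ℝ) * δ ≤ n * dist x y := by
        gcongr; exact not_lt.1 hy
      have := hφM n y
      linarith

/-- Positive parts decrease, starting from the finite integral for `g 0`, and negative parts
increase, so the two monotone convergence theorems apply separately. -/
theorem tendsto_circleMean {u : ℂ → EReal} {a : ℂ} {r : ℝ} (hr : 0 ≤ r) {g : ℕ → ℂ → ℝ}
    (hg : ∀ n, Continuous (g n)) (hanti : ∀ x, Antitone fun n => g n x)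
    (hlim : ∀ z ∈ Metric.sphere a r, Tendsto (fun n => (g n z : EReal)) atTop (𝓝 (u z))) :
    Tendsto (fun n => circleMean (fun z => (g n z : EReal)) a r) atTop (𝓝 (circleMean u a r)) := by
  have hpi : (0 : ℝ) < 2 * Real.pi := Real.two_pi_pos
  have hlim' : ∀ θ, Tendsto (fun n => (g n (circleMap a r θ) : EReal)) atTop
      (𝓝 (u (circleMap a r θ))) := fun θ => hlim _ (circleMap_mem_sphere a hr θ)
  have hc : ∀ n, Continuous fun θ : ℝ => ((g n (circleMap a r θ) : ℝ) : EReal) := fun n =>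
    continuous_coe_real_ereal.comp ((hg n).comp (continuous_circleMap a r))
  have hneg : Continuous (fun x : EReal => -x) := continuous_neg
  have hfin : ∫⁻ θ in Set.Ioc 0 (2 * Real.pi), ((g 0 (circleMap a r θ) : ℝ) : EReal).toENNReal
      ≠ ⊤ := by
    have hi : Integrable (fun θ => g 0 (circleMap a r θ))
        (volume.restrict (Set.Ioc 0 (2 * Real.pi))) :=
      (((hg 0).comp (continuous_circleMap a r)).intervalIntegrable 0 (2 * Real.pi)).1
    have e1 : ∀ x : ℝ, (x : EReal).toENNReal = ENNReal.ofReal x := fun x => by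
      rw [EReal.toENNReal_of_ne_top (EReal.coe_ne_top x), EReal.toReal_coe]
    simp only [e1]
    exact (hi.lintegral_lt_top).ne
  have h1 : Tendsto (fun n => ∫⁻ θ in Set.Ioc 0 (2 * Real.pi),
      ((g n (circleMap a r θ) : ℝ) : EReal).toENNReal) atTop
      (𝓝 (∫⁻ θ in Set.Ioc 0 (2 * Real.pi), (u (circleMap a r θ)).toENNReal)) := by
    refine lintegral_tendsto_of_tendsto_of_antitone (fun n =>
      (EReal.continuous_toENNReal.comp (hc n)).measurable.aemeasurable) ?_ hfin ?_
    · exact Eventually.of_forall fun θ m n hmn =>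
        EReal.toENNReal_le_toENNReal (EReal.coe_le_coe_iff.2 (hanti _ hmn))
    · exact Eventually.of_forall fun θ =>
        (EReal.continuous_toENNReal.tendsto _).comp (hlim' θ)
  have h2 : Tendsto (fun n => ∫⁻ θ in Set.Ioc 0 (2 * Real.pi),
      (-((g n (circleMap a r θ) : ℝ) : EReal)).toENNReal) atTop
      (𝓝 (∫⁻ θ in Set.Ioc 0 (2 * Real.pi), (-u (circleMap a r θ)).toENNReal)) := by
    refine lintegral_tendsto_of_tendsto_of_monotone (fun n =>
      (EReal.continuous_toENNReal.comp (hneg.comp (hc n))).measurable.aemeasurable) ?_ ?_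
    · exact Eventually.of_forall fun θ m n hmn =>
        EReal.toENNReal_le_toENNReal (EReal.neg_le_neg_iff.2
          (EReal.coe_le_coe_iff.2 (hanti _ hmn)))
    · exact Eventually.of_forall fun θ =>
        (EReal.continuous_toENNReal.tendsto _).comp ((hneg.tendsto _).comp (hlim' θ))
  have hpos : ENNReal.ofReal (2 * Real.pi) ≠ 0 := (ENNReal.ofReal_pos.2 hpi).ne'
  have hlt : ∫⁻ θ in Set.Ioc 0 (2 * Real.pi), (u (circleMap a r θ)).toENNReal ≠ ⊤ := by
    refine ne_top_of_le_ne_top hfin (lintegral_mono fun θ => EReal.toENNReal_le_toENNReal ?_)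
    exact le_of_tendsto' (hlim' θ) fun n => EReal.coe_le_coe_iff.2 (hanti _ (Nat.zero_le n))
  have d1 := (continuous_coe_ennreal_ereal.tendsto _).comp
    (ENNReal.Tendsto.div_const h1 (Or.inr hpos))
  have d2 := (hneg.tendsto _).comp ((continuous_coe_ennreal_ereal.tendsto _).comp
    (ENNReal.Tendsto.div_const h2 (Or.inr hpos)))
  -- The limit of the positive parts is finite, so the difference cannot be of the form ∞ - ∞.
  have hca := EReal.continuousAt_add (p := (((∫⁻ θ in Set.Ioc 0 (2 * Real.pi),
      (u (circleMap a r θ)).toENNReal) / ENNReal.ofReal (2 * Real.pi) : ℝ≥0∞),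
    -((((∫⁻ θ in Set.Ioc 0 (2 * Real.pi), (-u (circleMap a r θ)).toENNReal) /
      ENNReal.ofReal (2 * Real.pi) : ℝ≥0∞)) : EReal)))
    (Or.inl (by
      rw [Ne, EReal.coe_ennreal_eq_top_iff]; exact ENNReal.div_ne_top hlt hpos))
    (Or.inl (EReal.coe_ennreal_ne_bot _))
  have := hca.tendsto.comp (d1.prodMk_nhds d2)
  simpa only [circleMean, sub_eq_add_neg, Function.comp_def] using this

/-! ### Harmonic majorants on circles -/

theorem circleAverage_re {f : ℂ → ℂ} {a : ℂ} {r : ℝ} (hf : CircleIntegrable f a r) :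
    Real.circleAverage (fun z => (f z).re) a r = (Real.circleAverage f a r).re := by
  rw [Real.circleAverage_def, Real.circleAverage_def]
  have := Complex.reCLM.intervalIntegral_comp_comm hf
  simp only [Complex.reCLM_apply] at this
  rw [this, Complex.smul_re]

theorem circleAverage_re_of_diffContOnCl {f : ℂ → ℂ} {a : ℂ} {r : ℝ} (hr : 0 < r)
    (hf : DiffContOnCl ℂ f (Metric.ball a r)) :
    Real.circleAverage (fun z => (f z).re) a r = (f a).re := by
  have hc : ContinuousOn f (Metric.sphere a r) :=
    hf.continuousOn_ball.mono Metric.sphere_subset_closedBall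
  rw [circleAverage_re (hc.circleIntegrable hr.le),
    DiffContOnCl.circleAverage (by rwa [abs_of_pos hr])]

/-- Trigonometric polynomials are dense. On the unit circle each has the form P + conj Q with P, Q
polynomials, and its real part is that of the entire function P + Q. -/
theorem exists_entire_re_near {g : C(AddCircle (2 * Real.pi), ℝ)} {ε : ℝ} (hε : 0 < ε) :
    ∃ H : ℂ → ℂ, Differentiable ℂ H ∧
      ∀ θ : AddCircle (2 * Real.pi), |(H (AddCircle.toCircle θ)).re - g θ| < ε := by
  have : Fact (0 < 2 * Real.pi) := ⟨Real.two_pi_pos⟩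
  let S : Submodule ℂ C(AddCircle (2 * Real.pi), ℂ) :=
    { carrier := {F | ∃ P Q : ℂ → ℂ, Differentiable ℂ P ∧ Differentiable ℂ Q ∧
        ∀ θ, F θ = P (AddCircle.toCircle θ) + starRingEnd ℂ (Q (AddCircle.toCircle θ))}
      zero_mem' := ⟨0, 0, differentiable_const _, differentiable_const _, by simp⟩
      add_mem' := by
        rintro F G ⟨P, Q, hP, hQ, h⟩ ⟨P', Q', hP', hQ', h'⟩
        refine ⟨P + P', Q + Q', hP.add hP', hQ.add hQ', fun θ => ?_⟩
        simp only [ContinuousMap.add_apply, h, h', Pi.add_apply, map_add]; ring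
      smul_mem' := by
        rintro c F ⟨P, Q, hP, hQ, h⟩
        refine ⟨fun z => c * P z, fun z => starRingEnd ℂ c * Q z, hP.const_mul _, hQ.const_mul _,
          fun θ => ?_⟩
        simp only [ContinuousMap.smul_apply, h, smul_eq_mul, map_mul, Complex.conj_conj]; ring }
  have hS : Submodule.span ℂ (Set.range (@fourier (2 * Real.pi))) ≤ S := by
    rw [Submodule.span_le]
    rintro _ ⟨n, rfl⟩
    obtain ⟨m, rfl | rfl⟩ := n.eq_nat_or_neg
    · refine ⟨fun z => z ^ m, 0, differentiable_id.pow _, differentiable_const _, fun θ => ?_⟩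
      simp [fourier_apply, AddCircle.toCircle_nsmul]
    · refine ⟨0, fun z => z ^ m, differentiable_const _, differentiable_id.pow _, fun θ => ?_⟩
      simp [fourier_apply, AddCircle.toCircle_nsmul, AddCircle.toCircle_neg,
        ← Circle.coe_inv_eq_conj]
  have hmem : (⟨fun θ => (g θ : ℂ), by fun_prop⟩ : C(AddCircle (2 * Real.pi), ℂ)) ∈
      (Submodule.span ℂ (Set.range (@fourier (2 * Real.pi)))).topologicalClosure := by
    rw [span_fourier_closure_eq_top]; trivial
  rw [← SetLike.mem_coe, Submodule.topologicalClosure_coe, Metric.mem_closure_iff] at hmem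
  obtain ⟨F, hF, hdist⟩ := hmem ε hε
  obtain ⟨P, Q, hP, hQ, h⟩ := hS hF
  refine ⟨fun z => P z + Q z, hP.add hQ, fun θ => ?_⟩
  have h1 : dist ((g θ : ℂ)) (F θ) < ε :=
    lt_of_le_of_lt (ContinuousMap.dist_apply_le_dist (f := ⟨fun θ => (g θ : ℂ), by fun_prop⟩) θ)
      hdist
  rw [dist_comm, dist_eq_norm] at h1
  have h2 := (Complex.abs_re_le_norm _).trans_lt h1
  rw [h] at h2
  simpa using h2

/-- A function `u` that is upper semicontinuous on a circle lies below the real part of an entire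
function whose value at the centre is as close to the circle mean of `u` as desired. -/
theorem exists_entire_majorant {u : ℂ → EReal} {a : ℂ} {r : ℝ} (hr : 0 < r)
    (hu : UpperSemicontinuousOn u (Metric.sphere a r)) (htop : ∀ z ∈ Metric.sphere a r, u z ≠ ⊤)
    {c : EReal} (hc : circleMean u a r < c) :
    ∃ H : ℂ → ℂ, Differentiable ℂ H ∧ (∀ z ∈ Metric.sphere a r, u z ≤ ((H z).re : ℝ)) ∧
      (((H a).re : ℝ) : EReal) < c := by
  have : Fact (0 < 2 * Real.pi) := ⟨Real.two_pi_pos⟩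
  obtain ⟨g, hgc, hganti, hgle, hglim⟩ := exists_antitone_continuous_tendsto
    (isCompact_sphere a r) (NormedSpace.sphere_nonempty.2 hr.le) hu htop
  obtain ⟨n, hn⟩ := ((tendsto_circleMean hr.le hgc hganti hglim).eventually_lt_const hc).exists
  rw [circleMean_coe ((hgc n).continuousOn.circleIntegrable hr.le)] at hn
  obtain ⟨c', hc1, hc2⟩ := EReal.lt_iff_exists_real_btwn.1 hn
  rw [EReal.coe_lt_coe_iff] at hc1
  -- After adding ε the real part lies between g_n and g_n + 2ε on the circle, so the value at the
  -- centre is at most the mean of g_n plus 2ε, which is c'.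
  set ε := (c' - Real.circleAverage (g n) a r) / 2 with hε
  have hε0 : 0 < ε := by rw [hε]; linarith
  have hcirc : Continuous (AddCircle.toCircle : AddCircle (2 * Real.pi) → Circle) :=
    AddCircle.continuous_toCircle
  obtain ⟨H, hH, hHg⟩ := exists_entire_re_near (g := ⟨fun θ => g n (a + r * AddCircle.toCircle θ), by
    refine (hgc n).comp ?_; fun_prop⟩) hε0
  have hK : ∀ z ∈ Metric.sphere a r, |(H ((z - a) / r)).re - g n z| < ε := by
    intro z hz
    have hr' : (r : ℂ) ≠ 0 := by exact_mod_cast hr.ne'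
    have hnorm : ‖(z - a) / r‖ = 1 := by
      rw [norm_div, Complex.norm_real, Real.norm_of_nonneg hr.le, ← dist_eq_norm, hz,
        div_self hr.ne']
    obtain ⟨x, hx⟩ := Circle.exp_surjective ⟨(z - a) / r, mem_sphere_zero_iff_norm.2 hnorm⟩
    have hw := hHg (x : AddCircle (2 * Real.pi))
    have e : ((AddCircle.toCircle (x : AddCircle (2 * Real.pi)) : Circle) : ℂ) = (z - a) / r := by
      rw [AddCircle.toCircle_apply_mk, div_self Real.two_pi_pos.ne', one_mul, hx]
    simp only [ContinuousMap.coe_mk] at hw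
    rw [e, mul_div_cancel₀ _ hr'] at hw
    simpa using hw
  have hdiff : Differentiable ℂ fun z => H ((z - a) / r) + ε := by
    refine (hH.comp ((differentiable_id.sub_const a).div_const _)).add_const _
  refine ⟨fun z => H ((z - a) / r) + ε, hdiff, fun z hz => ?_, ?_⟩
  · refine (hgle n z hz).trans (EReal.coe_le_coe_iff.2 ?_)
    have := (abs_lt.1 (hK z hz)).1
    simp only [Complex.add_re, Complex.ofReal_re]; linarith
  · refine lt_of_le_of_lt (EReal.coe_le_coe_iff.2 ?_) hc2
    have hre := circleAverage_re_of_diffContOnCl (a := a) hr hdiff.differentiableOn.diffContOnCl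
    rw [← hre]
    have hm : Real.circleAverage (fun z => (H ((z - a) / r) + ε : ℂ).re) a r ≤
        Real.circleAverage (fun z => g n z + 2 * ε) a r := by
      refine Real.circleAverage_mono ?_ ?_ fun z hz => ?_
      · exact (Complex.continuous_re.comp hdiff.continuous).continuousOn.circleIntegrable hr.le
      · exact ((hgc n).add_const _).continuousOn.circleIntegrable hr.le
      · rw [abs_of_pos hr] at hz
        have := (abs_lt.1 (hK z hz)).2
        simp only [Complex.add_re, Complex.ofReal_re]; linarith
    refine hm.trans ?_
    rw [Real.circleAverage_fun_add ((hgc n).continuousOn.circleIntegrable hr.le)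
      (circleIntegrable_const _ _ _), Real.circleAverage_const]
    rw [hε]; linarith

end

/-! ### Subharmonicity along holomorphic curves, and its local nature. -/

section

/-! ### The local submean property and composition with holomorphic curves -/

/-- The submean inequality on all sufficiently small circles in complex lines. -/
def HasLocalSubmeanOn {E : Type*} [NormedAddCommGroup E] [NormedSpace ℂ E]
    (u : E → EReal) (W : Set E) : Prop :=
  ∀ a ∈ W, ∀ b : E, ∀ᶠ ρ in 𝓝[>] (0 : ℝ), u a ≤ circleMean (fun z : ℂ => u (a + z • b)) 0 ρ

/-- A strict bound along a compact piece of the curve persists under small translations, by upper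
semicontinuity and compactness. -/
theorem exists_tube {E : Type*} [NormedAddCommGroup E] {u : E → EReal} {W : Set E}
    (hW : IsOpen W) (husc : UpperSemicontinuousOn u W) {φ : ℂ → E} {V : Set ℂ} (hV : IsOpen V)
    (hφ : ContinuousOn φ V) (hmaps : Set.MapsTo φ V W) {K : Set ℂ} (hK : IsCompact K)
    (hKV : K ⊆ V) {h : ℂ → ℝ} (hh : Continuous h) (hlt : ∀ z ∈ K, u (φ z) < h z) :
    ∀ᶠ e in 𝓝 (0 : E), ∀ z ∈ K, φ z + e ∈ W ∧ u (φ z + e) < h z := by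
  refine hK.eventually_forall_of_forall_eventually fun z hz => ?_
  obtain ⟨t, ht1, ht2⟩ := EReal.lt_iff_exists_real_btwn.1 (hlt z hz)
  have hcont : Tendsto (fun y : E × ℂ => φ y.2 + y.1) (𝓝 (0, z)) (𝓝 (φ z)) := by
    have h1 : Tendsto (fun y : E × ℂ => φ y.2) (𝓝 (0, z)) (𝓝 (φ z)) :=
      (hφ.continuousAt (hV.mem_nhds (hKV hz))).tendsto.comp (continuous_snd.tendsto _)
    have h2 : Tendsto (fun y : E × ℂ => y.1) (𝓝 ((0 : E), z)) (𝓝 0) := continuous_fst.tendsto _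
    simpa using h1.add h2
  have hWn : W ∈ 𝓝 (φ z) := hW.mem_nhds (hmaps (hKV hz))
  have h3 : ∀ᶠ p in 𝓝 (φ z), u p < t := by
    have := husc _ (hmaps (hKV hz)) _ ht1
    rwa [nhdsWithin_eq_nhds.2 hWn] at this
  have h4 : ∀ᶠ y in 𝓝 ((0 : E), z), t < h y.2 :=
    ((hh.comp continuous_snd).tendsto (0, z)).eventually_const_lt (EReal.coe_lt_coe_iff.1 ht2)
  filter_upwards [hcont hWn, hcont h3, h4] with y hy1 hy2 hy3
  exact ⟨hy1, lt_trans hy2 (EReal.coe_lt_coe_iff.2 hy3)⟩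

/-- A maximum principle for a curve that need not be a line. Were the conclusion false, u(φ z + e) -
Re H(z) + ε|z - a|² - K‖e‖² would have an interior maximum over a tube of translates. At the maximum
the submean inequality is used only on the tangent line: a point of the tangent line is a point of
the curve translated by e₀ minus the Taylor remainder R. The penalty for R is o(|l|²), while ε|z -
a|² gains ερ² on the circle |l| = ρ, which is a contradiction. -/
theorem le_re_of_le_sphere {E : Type*} [NormedAddCommGroup E] [InnerProductSpace ℂ E]
    [ProperSpace E] {u : E → EReal} {W : Set E} (hW : IsOpen W)
    (husc : UpperSemicontinuousOn u W) (htop : ∀ p ∈ W, u p ≠ ⊤) (hsub : HasLocalSubmeanOn u W)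
    {φ : ℂ → E} {V : Set ℂ} (hV : IsOpen V) (hφ : DifferentiableOn ℂ φ V)
    (hmaps : Set.MapsTo φ V W) {a : ℂ} {r : ℝ} (hr : 0 < r) (hball : Metric.closedBall a r ⊆ V)
    {H : ℂ → ℂ} (hH : Differentiable ℂ H)
    (hle : ∀ z ∈ Metric.sphere a r, u (φ z) ≤ ((H z).re : ℝ)) :
    u (φ a) ≤ ((H a).re : ℝ) := by
  by_contra! hcon
  obtain ⟨t, ht1, ht2⟩ := EReal.lt_iff_exists_real_btwn.1 hcon
  rw [EReal.coe_lt_coe_iff] at ht1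
  set δ := t - (H a).re with hδ
  have hδ0 : 0 < δ := sub_pos.2 ht1
  -- On the boundary circle the term ε|z - a|² is then δ/2, too small to lift the function above δ.
  set ε := δ / (2 * r ^ 2) with hε
  have hε0 : 0 < ε := by positivity
  have hεr : ε * r ^ 2 = δ / 2 := by rw [hε]; field_simp
  have hHre : Continuous fun z => (H z).re := Complex.continuous_re.comp hH.continuous
  -- a tube around the closed disc
  obtain ⟨η, hη0, hηW, hηS⟩ : ∃ η > 0, (∀ z ∈ Metric.closedBall a r, ∀ e : E, ‖e‖ ≤ η →
      φ z + e ∈ W) ∧ ∀ z ∈ Metric.sphere a r, ∀ e : E, ‖e‖ ≤ η →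
      u (φ z + e) < (((H z).re + δ / 2 : ℝ) : EReal) := by
    -- With the function ⊥ only the membership in `W` is extracted, here over the whole closed disc.
    have h1 := exists_tube (u := fun _ => (⊥ : EReal)) hW
      (continuousOn_const.upperSemicontinuousOn) hV hφ.continuousOn hmaps
      (isCompact_closedBall a r) hball (h := fun _ => 0) continuous_const
      (fun z _ => EReal.bot_lt_coe _)
    have h2 := exists_tube hW husc hV hφ.continuousOn hmaps (isCompact_sphere a r)
      (Metric.sphere_subset_closedBall.trans hball) (h := fun z => (H z).re + δ / 2)
      (hHre.add continuous_const) (fun z hz => (hle z hz).trans_lt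
        (EReal.coe_lt_coe_iff.2 (by linarith)))
    obtain ⟨η, hη, hη'⟩ := Metric.eventually_nhds_iff_ball.1 (h1.and h2)
    refine ⟨η / 2, by positivity, fun z hz e he => ((hη' e ?_).1 z hz).1,
      fun z hz e he => ((hη' e ?_).2 z hz).2⟩ <;>
    · rw [mem_ball_zero_iff]; linarith
  set C : Set (E × ℂ) := Metric.closedBall 0 η ×ˢ Metric.closedBall a r with hC
  have hCc : IsCompact C := (isCompact_closedBall _ _).prod (isCompact_closedBall _ _)
  have hCne : ((0 : E), a) ∈ C := ⟨Metric.mem_closedBall_self hη0.le,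
    Metric.mem_closedBall_self hr.le⟩
  have hCW : ∀ y ∈ C, φ y.2 + y.1 ∈ W := fun y hy =>
    hηW _ hy.2 _ (mem_closedBall_zero_iff.1 hy.1)
  have hCu : UpperSemicontinuousOn (fun y : E × ℂ => u (φ y.2 + y.1)) C := by
    refine husc.comp (f := u) (g := fun y : E × ℂ => φ y.2 + y.1) ?_ hCW
    refine ContinuousOn.add ?_ continuousOn_fst
    exact hφ.continuousOn.comp continuousOn_snd fun y hy => hball hy.2
  -- the penalized function attains its maximum on the tube
  have hΓ : ∀ K : ℝ, ∃ y ∈ C, ∀ y' ∈ C,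
      u (φ y'.2 + y'.1) + ((-(H y'.2).re + ε * ‖y'.2 - a‖ ^ 2 - K * ‖y'.1‖ ^ 2 : ℝ) : EReal) ≤
      u (φ y.2 + y.1) + ((-(H y.2).re + ε * ‖y.2 - a‖ ^ 2 - K * ‖y.1‖ ^ 2 : ℝ) : EReal) := by
    intro K
    have hk : Continuous fun y : E × ℂ =>
        ((-(H y.2).re + ε * ‖y.2 - a‖ ^ 2 - K * ‖y.1‖ ^ 2 : ℝ) : EReal) := by
      refine continuous_coe_real_ereal.comp ?_
      have := hHre.comp (continuous_snd (X := E) (Y := ℂ))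
      simp only [Function.comp_def] at this
      fun_prop
    have := hCu.add' hk.continuousOn.upperSemicontinuousOn fun y hy =>
      EReal.continuousAt_add (Or.inr (EReal.coe_ne_bot _)) (Or.inr (EReal.coe_ne_top _))
    obtain ⟨y, hy, hmax⟩ := this.exists_isMaxOn ⟨_, hCne⟩ hCc
    exact ⟨y, hy, fun y' hy' => hmax hy'⟩
  obtain ⟨y₁, hy₁, hM⟩ := hΓ 0
  obtain ⟨M, hMM⟩ : ∃ M : ℝ, ∀ y ∈ C,
      u (φ y.2 + y.1) + ((-(H y.2).re + ε * ‖y.2 - a‖ ^ 2 : ℝ) : EReal) ≤ M := by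
    have : u (φ y₁.2 + y₁.1) ≠ ⊤ := htop _ (hCW _ hy₁)
    refine ⟨(u (φ y₁.2 + y₁.1)).toReal + (-(H y₁.2).re + ε * ‖y₁.2 - a‖ ^ 2), fun y hy => ?_⟩
    have h1 := hM y hy
    simp only [zero_mul, sub_zero] at h1
    refine h1.trans ?_
    rw [EReal.coe_add]
    exact add_le_add (EReal.le_coe_toReal this) le_rfl
  -- This penalty makes the function nonpositive where ‖e‖ = η, while at the maximum it exceeds δ.
  set K := |M| / η ^ 2 with hK
  have hK0 : 0 ≤ K := by positivity
  have hKη : M ≤ K * η ^ 2 := by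
    rw [hK, div_mul_cancel₀ _ (by positivity)]; exact le_abs_self M
  obtain ⟨⟨e₀, z₀⟩, ⟨he₀, hz₀⟩, hmax⟩ := hΓ K
  simp only at he₀ hz₀ hmax
  rw [mem_closedBall_zero_iff] at he₀
  set κ := -(H z₀).re + ε * ‖z₀ - a‖ ^ 2 - K * ‖e₀‖ ^ 2 with hκ
  have hp₀W : φ z₀ + e₀ ∈ W := hηW _ hz₀ _ he₀
  have hbig : (δ : EReal) < u (φ z₀ + e₀) + (κ : EReal) := by
    have h1 := hmax _ hCne
    simp only [add_zero, sub_self, norm_zero, ne_eq, OfNat.ofNat_ne_zero, not_false_eq_true,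
      zero_pow, mul_zero, sub_zero] at h1
    refine lt_of_lt_of_le ?_ h1
    rw [hδ, sub_eq_add_neg, EReal.coe_add]
    exact EReal.add_lt_add_of_lt_of_le ht2 le_rfl (EReal.coe_ne_bot _) (EReal.coe_ne_top _)
  obtain ⟨s, hs⟩ : ∃ s : ℝ, u (φ z₀ + e₀) = s := by
    have h1 : u (φ z₀ + e₀) ≠ ⊥ := by
      intro h; rw [h, EReal.bot_add] at hbig; exact absurd hbig not_lt_bot
    exact ⟨_, (EReal.coe_toReal (htop _ hp₀W) h1).symm⟩
  rw [hs, ← EReal.coe_add, EReal.coe_lt_coe_iff] at hbig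
  have hz₀r : ‖z₀ - a‖ ≤ r := by rw [← dist_eq_norm]; exact hz₀
  -- the maximum is attained in the interior
  have hz₀lt : ‖z₀ - a‖ < r := by
    refine lt_of_le_of_ne hz₀r fun h => ?_
    have h1 := hηS z₀ (by rw [mem_sphere_iff_norm]; exact h) e₀ he₀
    rw [hs, EReal.coe_lt_coe_iff] at h1
    have : 0 ≤ K * ‖e₀‖ ^ 2 := by positivity
    rw [hκ, h, hεr] at hbig
    linarith
  have he₀lt : ‖e₀‖ < η := by
    refine lt_of_le_of_ne he₀ fun h => ?_
    have h1 := hMM (e₀, z₀) ⟨by rwa [mem_closedBall_zero_iff], hz₀⟩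
    simp only at h1
    rw [hs, ← EReal.coe_add, EReal.coe_le_coe_iff] at h1
    rw [hκ, h] at hbig
    linarith
  -- averaging over a small circle in the direction of the curve
  have hz₀V : z₀ ∈ V := hball hz₀
  set τ := deriv φ z₀ with hτ
  have hder : HasDerivAt φ τ z₀ := ((hφ.differentiableAt (hV.mem_nhds hz₀V))).hasDerivAt
  set R : ℂ → E := fun l => φ (z₀ + l) - φ z₀ - l • τ with hR
  have hRo : R =o[𝓝 0] fun l => l := hasDerivAt_iff_isLittleO_nhds_zero.1 hder
  -- With ‖R l‖ ≤ c‖l‖ the loss K‖R l‖² is at most half of the gain ε‖l‖².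
  obtain ⟨c, hc0, hcK⟩ : ∃ c > 0, K * c ^ 2 ≤ ε / 2 := by
    refine ⟨min 1 (ε / (2 * (K + 1))), by positivity, ?_⟩
    have h1 : min 1 (ε / (2 * (K + 1))) ≤ 1 := min_le_left _ _
    have h2 : min 1 (ε / (2 * (K + 1))) ≤ ε / (2 * (K + 1)) := min_le_right _ _
    have h0 : 0 < min 1 (ε / (2 * (K + 1))) := by positivity
    have h3 : min 1 (ε / (2 * (K + 1))) ^ 2 ≤ ε / (2 * (K + 1)) := by nlinarith
    calc K * min 1 (ε / (2 * (K + 1))) ^ 2 ≤ (K + 1) * (ε / (2 * (K + 1))) := by gcongr; linarith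
      _ = ε / 2 := by field_simp
  have hR0 : Tendsto (fun l => e₀ - R l) (𝓝 0) (𝓝 e₀) := by
    have := hRo.trans_tendsto tendsto_id
    simpa using (tendsto_const_nhds (x := e₀)).sub this
  have hev : ∀ᶠ l in 𝓝 (0 : ℂ), ‖z₀ + l - a‖ < r ∧ ‖e₀ - R l‖ < η ∧ ‖R l‖ ≤ c * ‖l‖ := by
    refine Eventually.and ?_ (Eventually.and ?_ (hRo.def hc0))
    · have : Continuous fun l : ℂ => ‖z₀ + l - a‖ := by fun_prop
      refine (this.tendsto 0).eventually_lt_const ?_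
      simpa using hz₀lt
    · exact hR0.norm.eventually_lt_const he₀lt
  obtain ⟨ρ₀, hρ₀, hρball⟩ := Metric.eventually_nhds_iff_ball.1 hev
  obtain ⟨ρ, hρsub, hρ0, hρlt⟩ := ((hsub _ hp₀W τ).and (Ioo_mem_nhdsGT hρ₀)).exists
  -- All first-order terms of the maximality inequality are collected as the real part of a function
  -- holomorphic in l and zero at 0. The inner product is linear in its second argument, so its term
  -- is holomorphic too.
  set Ψ : ℂ → ℂ := fun l => H (z₀ + l) - H z₀ - 2 * ε * (starRingEnd ℂ (z₀ - a) * l)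
    - 2 * K * inner ℂ e₀ (R l) with hΨ
  have hcb : ∀ l ∈ Metric.closedBall (0 : ℂ) ρ, l ∈ Metric.ball (0 : ℂ) ρ₀ := fun l hl =>
    Metric.closedBall_subset_ball hρlt hl
  have hRd : DifferentiableOn ℂ R (Metric.closedBall 0 ρ) := by
    have h1 : DifferentiableOn ℂ (fun l => φ (z₀ + l)) (Metric.closedBall 0 ρ) := by
      refine hφ.comp (f := fun l => z₀ + l) (by fun_prop) fun l hl => hball ?_
      rw [Metric.mem_closedBall, dist_eq_norm]
      exact (hρball l (hcb l hl)).1.le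
    exact (h1.sub_const _).sub (by fun_prop)
  have hΨd : DifferentiableOn ℂ Ψ (Metric.closedBall 0 ρ) := by
    have h1 : DifferentiableOn ℂ (fun l => inner ℂ e₀ (R l)) (Metric.closedBall 0 ρ) :=
      (innerSL ℂ e₀).differentiable.comp_differentiableOn hRd
    have h2 : Differentiable ℂ fun l => H (z₀ + l) := hH.comp (by fun_prop)
    exact (((h2.sub_const _).sub (by fun_prop)).differentiableOn).sub (h1.const_mul _)
  have hΨc : DiffContOnCl ℂ Ψ (Metric.ball 0 ρ) :=
    DifferentiableOn.diffContOnCl (by rwa [closure_ball _ hρ0.ne'])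
  have hav := circleAverage_re_of_diffContOnCl hρ0 hΨc
  have hΨ0 : Ψ 0 = 0 := by simp [hΨ, hR]
  rw [hΨ0, Complex.zero_re] at hav
  have hpt : ∀ l ∈ Metric.sphere (0 : ℂ) ρ, u (φ z₀ + e₀ + l • τ) ≤
      (((s - (ε - K * c ^ 2) * ρ ^ 2) + (Ψ l).re : ℝ) : EReal) := by
    intro l hl
    have hlρ : ‖l‖ = ρ := mem_sphere_zero_iff_norm.1 hl
    obtain ⟨h1, h2, h3⟩ := hρball l (hcb l (Metric.sphere_subset_closedBall hl))
    have h4 := hmax (e₀ - R l, z₀ + l) ⟨by rw [mem_closedBall_zero_iff]; exact h2.le, by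
      rw [Metric.mem_closedBall, dist_eq_norm]; exact h1.le⟩
    have e1 : φ (z₀ + l) + (e₀ - R l) = φ z₀ + e₀ + l • τ := by simp only [hR]; abel
    simp only [e1] at h4
    rw [hs, ← EReal.coe_add] at h4
    have h5 : u (φ z₀ + e₀ + l • τ) ≤ ((s + κ - (-(H (z₀ + l)).re + ε * ‖z₀ + l - a‖ ^ 2
        - K * ‖e₀ - R l‖ ^ 2) : ℝ) : EReal) := by
      rw [EReal.coe_sub]
      exact EReal.le_sub_iff_add_le (Or.inl (EReal.coe_ne_bot _)) (Or.inl (EReal.coe_ne_top _)) |>.2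
        h4
    refine h5.trans (EReal.coe_le_coe_iff.2 ?_)
    have n1 : ‖z₀ + l - a‖ ^ 2 = ‖z₀ - a‖ ^ 2 + 2 * (starRingEnd ℂ (z₀ - a) * l).re + ρ ^ 2 := by
      rw [← hlρ, Complex.sq_norm, Complex.sq_norm, Complex.sq_norm]
      simp only [Complex.normSq_apply, Complex.mul_re, Complex.conj_re, Complex.conj_im,
        Complex.sub_re, Complex.sub_im, Complex.add_re, Complex.add_im]
      ring
    have n2 : ‖e₀ - R l‖ ^ 2 = ‖e₀‖ ^ 2 - 2 * (inner ℂ e₀ (R l) : ℂ).re + ‖R l‖ ^ 2 := by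
      exact norm_sub_sq (𝕜 := ℂ) e₀ (R l)
    have n3 : ‖R l‖ ^ 2 ≤ c ^ 2 * ρ ^ 2 := by
      rw [← mul_pow, ← hlρ]; gcongr
    have n4 : K * ‖R l‖ ^ 2 ≤ K * (c ^ 2 * ρ ^ 2) := by gcongr
    have n5 : (Ψ l).re = (H (z₀ + l)).re - (H z₀).re - 2 * ε * (starRingEnd ℂ (z₀ - a) * l).re
        - 2 * K * (inner ℂ e₀ (R l) : ℂ).re := by
      simp only [hΨ, Complex.sub_re]
      have q : ∀ (x : ℝ) (w : ℂ), (2 * (x : ℂ) * w).re = 2 * x * w.re := fun x w => by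
        rw [show (2 * (x : ℂ) * w) = ((2 * x : ℝ) : ℂ) * w by push_cast; ring,
          Complex.re_ofReal_mul]
      rw [q, q]
    rw [n1, n2, n5, hκ]
    linarith
  have hfin := hρsub.trans (circleMean_mono hρ0.le hpt)
  have hΨi : CircleIntegrable (fun l => (Ψ l).re) 0 ρ :=
    (Complex.continuous_re.comp_continuousOn
      (hΨd.continuousOn.mono Metric.sphere_subset_closedBall)).circleIntegrable hρ0.le
  rw [circleMean_coe (g := fun l => (s - (ε - K * c ^ 2) * ρ ^ 2) + (Ψ l).re)
      ((circleIntegrable_const _ _ _).add hΨi),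
    Real.circleAverage_fun_add (circleIntegrable_const _ _ _) hΨi, Real.circleAverage_const, hav,
    hs, EReal.coe_le_coe_iff] at hfin
  have : 0 < (ε - K * c ^ 2) * ρ ^ 2 := mul_pos (by linarith) (by positivity)
  linarith

/-- Any number above the circle mean exceeds the central value of Re H for some entire H with real
part above u ∘ φ on the circle, and the maximum principle bounds u(φ a) by that central value. -/
theorem isSubharmonicOn_comp_of_inner {E : Type*} [NormedAddCommGroup E] [InnerProductSpace ℂ E]
    [ProperSpace E] {u : E → EReal} {W : Set E} (hW : IsOpen W)
    (husc : UpperSemicontinuousOn u W) (htop : ∀ p ∈ W, u p ≠ ⊤) (hsub : HasLocalSubmeanOn u W)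
    {φ : ℂ → E} {V : Set ℂ} (hV : IsOpen V) (hφ : DifferentiableOn ℂ φ V)
    (hmaps : Set.MapsTo φ V W) : IsSubharmonicOn (u ∘ φ) V where
  usc := husc.comp hφ.continuousOn hmaps
  ne_top z hz := htop _ (hmaps hz)
  submean a r hr hball := by
    refine le_of_forall_gt fun c hc => ?_
    have hS : Metric.sphere a r ⊆ V := Metric.sphere_subset_closedBall.trans hball
    obtain ⟨H, hH, hle, hlt⟩ := exists_entire_majorant hr
      ((husc.comp hφ.continuousOn hmaps).mono hS) (fun z hz => htop _ (hmaps (hS hz))) hc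
    exact (le_re_of_le_sphere hW husc htop hsub hV hφ hmaps hr hball hH hle).trans_lt hlt

/-- A function satisfying the local submean inequality on complex lines is subharmonic along every
holomorphic curve. -/
theorem isSubharmonicOn_comp {E : Type*} [NormedAddCommGroup E] [NormedSpace ℂ E]
    [FiniteDimensional ℂ E] {u : E → EReal} {W : Set E} (hW : IsOpen W)
    (husc : UpperSemicontinuousOn u W) (htop : ∀ p ∈ W, u p ≠ ⊤) (hsub : HasLocalSubmeanOn u W)
    {φ : ℂ → E} {V : Set ℂ} (hV : IsOpen V) (hφ : DifferentiableOn ℂ φ V)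
    (hmaps : Set.MapsTo φ V W) : IsSubharmonicOn (u ∘ φ) V := by
  -- The local submean property only involves complex lines, so it is transported by a linear
  -- isomorphism to a space with an inner product.
  let T : E ≃L[ℂ] EuclideanSpace ℂ (Fin (Module.finrank ℂ E)) :=
    ContinuousLinearEquiv.ofFinrankEq (by simp)
  have h := isSubharmonicOn_comp_of_inner (u := u ∘ T.symm) (W := T.symm ⁻¹' W) (φ := T ∘ φ)
    (V := V) (hW.preimage T.symm.continuous)
    (husc.comp T.symm.continuous.continuousOn (Set.mapsTo_preimage _ _))
    (fun p hp => htop _ hp) (fun a ha b => by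
      filter_upwards [hsub _ ha (T.symm b)] with ρ hρ
      simpa using hρ) hV (T.differentiable.comp_differentiableOn hφ)
    (fun z hz => by simpa using hmaps hz)
  have e : (u ∘ T.symm) ∘ (T ∘ φ) = u ∘ φ := by ext z; simp
  rwa [e] at h

theorem hasLocalSubmeanOn_of_center {u : ℂ → EReal} {U : Set ℂ} (htop : ∀ z ∈ U, u z ≠ ⊤)
    (h : ∀ a ∈ U, ∀ᶠ ρ in 𝓝[>] (0 : ℝ), u a ≤ circleMean u a ρ) : HasLocalSubmeanOn u U := by
  intro a ha b
  by_cases hb : b = 0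
  · simp only [hb, smul_zero, add_zero]
    exact Eventually.of_forall fun ρ => le_circleMean_const (htop a ha) _ _
  · have hb' : 0 < ‖b‖ := norm_pos_iff.2 hb
    have ht : Tendsto (fun ρ : ℝ => ρ * ‖b‖) (𝓝[>] 0) (𝓝[>] 0) := by
      refine tendsto_nhdsWithin_iff.2 ⟨?_, ?_⟩
      · have : Tendsto (fun ρ : ℝ => ρ * ‖b‖) (𝓝 0) (𝓝 (0 * ‖b‖)) :=
          tendsto_id.mul_const _
        rw [zero_mul] at this
        exact this.mono_left nhdsWithin_le_nhds
      · filter_upwards [self_mem_nhdsWithin] with ρ hρ using mul_pos hρ hb'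
    filter_upwards [ht.eventually (h a ha)] with ρ hρ
    simp only [smul_eq_mul]
    rwa [circleMean_comp_mul]

/-- Subharmonicity is a local property. -/
theorem isSubharmonicOn_of_local {u : ℂ → EReal} {U : Set ℂ} (hU : IsOpen U)
    (husc : UpperSemicontinuousOn u U) (htop : ∀ z ∈ U, u z ≠ ⊤)
    (h : ∀ a ∈ U, ∀ᶠ ρ in 𝓝[>] (0 : ℝ), u a ≤ circleMean u a ρ) : IsSubharmonicOn u U :=
  -- Applied to the identity curve, the maximum principle upgrades small circles to all discs.
  isSubharmonicOn_comp (φ := id) hU husc htop (hasLocalSubmeanOn_of_center htop h) hU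
    differentiableOn_id (Set.mapsTo_id U)

theorem IsSubharmonicOn.eventually_le_circleMean {u : ℂ → EReal} {U : Set ℂ}
    (hu : IsSubharmonicOn u U) (hU : IsOpen U) {a : ℂ} (ha : a ∈ U) :
    ∀ᶠ ρ in 𝓝[>] (0 : ℝ), u a ≤ circleMean u a ρ := by
  obtain ⟨δ, hδ, hb⟩ := Metric.isOpen_iff.1 hU a ha
  filter_upwards [Ioo_mem_nhdsGT hδ] with ρ hρ
  exact hu.submean a ρ hρ.1 ((Metric.closedBall_subset_ball hρ.2).trans hb)

theorem IsSubharmonicOn.comp_holomorphic {u : ℂ → EReal} {U V : Set ℂ} (hu : IsSubharmonicOn u U)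
    (hU : IsOpen U) (hV : IsOpen V) {φ : ℂ → ℂ} (hφ : DifferentiableOn ℂ φ V)
    (hmaps : Set.MapsTo φ V U) : IsSubharmonicOn (u ∘ φ) V :=
  isSubharmonicOn_comp hU hu.usc hu.ne_top
    (hasLocalSubmeanOn_of_center hu.ne_top fun _ ha => hu.eventually_le_circleMean hU ha) hV hφ
    hmaps

theorem IsSubharmonicOn.sup {u v : ℂ → EReal} {U : Set ℂ} (hu : IsSubharmonicOn u U)
    (hv : IsSubharmonicOn v U) : IsSubharmonicOn (fun z => max (u z) (v z)) U where
  usc := hu.usc.sup hv.usc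
  ne_top z hz := (max_lt (hu.ne_top z hz).lt_top (hv.ne_top z hz).lt_top).ne
  submean a r hr hball := max_le
    ((hu.submean a r hr hball).trans (circleMean_mono hr.le fun _ _ => le_max_left _ _))
    ((hv.submean a r hr hball).trans (circleMean_mono hr.le fun _ _ => le_max_right _ _))

theorem IsSubharmonicOn.congr {u v : ℂ → EReal} {U : Set ℂ} (hu : IsSubharmonicOn u U)
    (h : Set.EqOn u v U) : IsSubharmonicOn v U where
  usc z hz c hc := by
    change v z < c at hc
    rw [← h hz] at hc
    filter_upwards [hu.usc z hz c hc, self_mem_nhdsWithin] with w hw hwU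
    rwa [← h hwU]
  ne_top z hz := by rw [← h hz]; exact hu.ne_top z hz
  submean a r hr hball := by
    rw [← h (hball (Metric.mem_closedBall_self hr.le))]
    exact (hu.submean a r hr hball).trans (circleMean_mono hr.le fun z hz =>
      (h (hball (Metric.sphere_subset_closedBall hz))).le)

/-- Gluing: a function that is subharmonic on each of two open sets covering `U` is subharmonic on
`U`. -/
theorem isSubharmonicOn_union {u : ℂ → EReal} {U V : Set ℂ} (hU : IsOpen U) (hV : IsOpen V)
    (hu : IsSubharmonicOn u U) (hv : IsSubharmonicOn u V) : IsSubharmonicOn u (U ∪ V) := by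
  refine isSubharmonicOn_of_local (hU.union hV) ?_ ?_ ?_
  · rintro z (hz | hz) c hc
    · have := hu.usc z hz c hc
      rw [nhdsWithin_eq_nhds.2 (hU.mem_nhds hz)] at this
      exact this.filter_mono nhdsWithin_le_nhds
    · have := hv.usc z hz c hc
      rw [nhdsWithin_eq_nhds.2 (hV.mem_nhds hz)] at this
      exact this.filter_mono nhdsWithin_le_nhds
  · rintro z (hz | hz)
    exacts [hu.ne_top z hz, hv.ne_top z hz]
  · rintro z (hz | hz)
    exacts [hu.eventually_le_circleMean hU hz, hv.eventually_le_circleMean hV hz]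

end

/-! ### Coordinates on the slices and slicewise holomorphy. -/

section

/-! ### The slices of the quaternions -/

theorem mem_imagUnits_iff {I : ℍ[ℝ]} :
    I ∈ imagUnits ↔ I.re = 0 ∧ I.imI ^ 2 + I.imJ ^ 2 + I.imK ^ 2 = 1 := by
  constructor
  · intro h
    have h : I * I = -1 := h
    have h0 := congrArg QuaternionAlgebra.re h
    have h1 := congrArg QuaternionAlgebra.imI h
    have h2 := congrArg QuaternionAlgebra.imJ h
    have h3 := congrArg QuaternionAlgebra.imK h
    simp only [Quaternion.re_mul, Quaternion.imI_mul, Quaternion.imJ_mul, Quaternion.imK_mul,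
      Quaternion.re_neg, Quaternion.imI_neg, Quaternion.imJ_neg, Quaternion.imK_neg,
      Quaternion.re_one, Quaternion.imI_one, Quaternion.imJ_one, Quaternion.imK_one] at h0 h1 h2 h3
    have h1' : I.re * I.imI = 0 := by linarith
    have h2' : I.re * I.imJ = 0 := by linarith
    have h3' : I.re * I.imK = 0 := by linarith
    have hre : I.re = 0 := by
      by_contra hne
      have e1 := (mul_eq_zero.1 h1').resolve_left hne
      have e2 := (mul_eq_zero.1 h2').resolve_left hne
      have e3 := (mul_eq_zero.1 h3').resolve_left hne
      rw [e1, e2, e3] at h0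
      nlinarith [mul_self_nonneg I.re]
    refine ⟨hre, ?_⟩
    rw [hre] at h0
    linarith
  · rintro ⟨h0, h1⟩
    change I * I = -1
    ext <;> simp [h0] <;> nlinarith

theorem norm_of_mem_imagUnits {I : ℍ[ℝ]} (hI : I ∈ imagUnits) : ‖I‖ = 1 := by
  have h := congrArg norm (show I * I = -1 from hI)
  rw [norm_mul, norm_neg, norm_one] at h
  nlinarith [norm_nonneg I]

theorem neg_mem_imagUnits {I : ℍ[ℝ]} (hI : I ∈ imagUnits) : -I ∈ imagUnits := by
  change -I * -I = -1
  rw [neg_mul_neg]; exact hI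

theorem imagUnits_nonempty : imagUnits.Nonempty :=
  ⟨(⟨0, 1, 0, 0⟩ : ℍ[ℝ]), mem_imagUnits_iff.2 ⟨rfl, by norm_num⟩⟩

theorem slice_add (I : ℍ[ℝ]) (z w : ℂ) : slice I (z + w) = slice I z + slice I w := by
  simp only [slice, Complex.add_re, Complex.add_im, Quaternion.coe_add, add_mul]; abel

theorem slice_sub (I : ℍ[ℝ]) (z w : ℂ) : slice I (z - w) = slice I z - slice I w := by
  simp only [slice, Complex.sub_re, Complex.sub_im, Quaternion.coe_sub, sub_mul]; abel

theorem slice_mul {I : ℍ[ℝ]} (hI : I ∈ imagUnits) (z w : ℂ) :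
    slice I (z * w) = slice I z * slice I w := by
  have hI' : I * I = -1 := hI
  have e : ∀ z, slice I z = Complex.liftAux I hI' z := fun z => by
    rw [Complex.liftAux_apply, slice, Quaternion.coe_mul_eq_smul, Quaternion.algebraMap_def]
  rw [e, e, e, map_mul]

theorem slice_ofReal (I : ℍ[ℝ]) (x : ℝ) : slice I (x : ℂ) = (x : ℍ[ℝ]) := by
  simp [slice]

theorem slice_neg_left (I : ℍ[ℝ]) (z : ℂ) : slice (-I) z = slice I (starRingEnd ℂ z) := by
  simp [slice]

theorem slice_conj (I : ℍ[ℝ]) (z : ℂ) : slice I (starRingEnd ℂ z) = slice (-I) z :=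
  (slice_neg_left I z).symm

theorem re_slice {I : ℍ[ℝ]} (hI : I ∈ imagUnits) (z : ℂ) : (slice I z).re = z.re := by
  simp [slice, (mem_imagUnits_iff.1 hI).1]

theorem imI_slice (I : ℍ[ℝ]) (z : ℂ) : (slice I z).imI = z.im * I.imI := by simp [slice]

theorem imJ_slice (I : ℍ[ℝ]) (z : ℂ) : (slice I z).imJ = z.im * I.imJ := by simp [slice]

theorem imK_slice (I : ℍ[ℝ]) (z : ℂ) : (slice I z).imK = z.im * I.imK := by simp [slice]

theorem norm_sq_quaternion (q : ℍ[ℝ]) :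
    ‖q‖ ^ 2 = q.re ^ 2 + q.imI ^ 2 + q.imJ ^ 2 + q.imK ^ 2 := by
  rw [sq ‖q‖, ← Quaternion.normSq_eq_norm_mul_self, Quaternion.normSq_def']

theorem norm_slice {I : ℍ[ℝ]} (hI : I ∈ imagUnits) (z : ℂ) : ‖slice I z‖ = ‖z‖ := by
  rw [← sq_eq_sq₀ (norm_nonneg _) (norm_nonneg _), norm_sq_quaternion, re_slice hI, imI_slice,
    imJ_slice, imK_slice, Complex.sq_norm, Complex.normSq_apply]
  linear_combination z.im ^ 2 * (mem_imagUnits_iff.1 hI).2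

theorem norm_slice_sub {I : ℍ[ℝ]} (hI : I ∈ imagUnits) (z w : ℂ) :
    ‖slice I z - slice I w‖ = ‖z - w‖ := by rw [← slice_sub, norm_slice hI]

theorem continuous_slice_uncurry : Continuous fun p : ℍ[ℝ] × ℂ => slice p.1 p.2 := by
  unfold slice
  have h1 : Continuous fun p : ℍ[ℝ] × ℂ => ((p.2.re : ℝ) : ℍ[ℝ]) :=
    Quaternion.continuous_coe.comp (Complex.continuous_re.comp continuous_snd)
  have h2 : Continuous fun p : ℍ[ℝ] × ℂ => ((p.2.im : ℝ) : ℍ[ℝ]) :=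
    Quaternion.continuous_coe.comp (Complex.continuous_im.comp continuous_snd)
  exact h1.add (h2.mul continuous_fst)

theorem continuous_slice (I : ℍ[ℝ]) : Continuous (slice I) :=
  continuous_slice_uncurry.comp (Continuous.prodMk_right I)

/-- The coordinate of the slice `L_I`, extended to a real-linear map on the quaternions. -/
def sliceCoord (I q : ℍ[ℝ]) : ℂ := ⟨q.re, -(I * q).re⟩

theorem sliceCoord_slice {I : ℍ[ℝ]} (hI : I ∈ imagUnits) (z : ℂ) : sliceCoord I (slice I z) = z := by
  have h := mem_imagUnits_iff.1 hI
  refine Complex.ext (re_slice hI z) ?_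
  simp only [sliceCoord, Quaternion.re_mul, imI_slice, imJ_slice, imK_slice, h.1]
  linear_combination z.im * h.2

theorem continuous_sliceCoord (I : ℍ[ℝ]) : Continuous (sliceCoord I) := by
  have h1 : Continuous fun q : ℍ[ℝ] => (I * q).re :=
    Quaternion.continuous_re.comp (continuous_const.mul continuous_id)
  have : sliceCoord I = fun q => (q.re : ℂ) + (-(I * q).re : ℝ) * Complex.I := by
    ext q
    apply Complex.ext <;> simp [sliceCoord]
  rw [this]
  exact (Complex.continuous_ofReal.comp Quaternion.continuous_re).add
    ((Complex.continuous_ofReal.comp h1.neg).mul continuous_const)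

theorem slice_sliceCoord {I q : ℍ[ℝ]} (hI : I ∈ imagUnits) (hq : q ∈ slicePlane I) :
    slice I (sliceCoord I q) = q := by
  obtain ⟨z, rfl⟩ := hq
  rw [sliceCoord_slice hI]

theorem mem_slicePlane_iff {I q : ℍ[ℝ]} (hI : I ∈ imagUnits) :
    q ∈ slicePlane I ↔ slice I (sliceCoord I q) = q :=
  ⟨slice_sliceCoord hI, fun h => ⟨_, h⟩⟩

theorem isClosed_slicePlane {I : ℍ[ℝ]} (hI : I ∈ imagUnits) : IsClosed (slicePlane I) := by
  have : slicePlane I = {q | slice I (sliceCoord I q) = q} := by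
    ext q; exact mem_slicePlane_iff hI
  rw [this]
  exact isClosed_eq ((continuous_slice I).comp (continuous_sliceCoord I)) continuous_id

theorem slice_injective {I : ℍ[ℝ]} (hI : I ∈ imagUnits) : Function.Injective (slice I) :=
  Function.LeftInverse.injective (sliceCoord_slice hI)

/-- The complex number `x + iy`, `y ≥ 0`, with `q = x + yJ` for some `J ∈ 𝕊`. -/
def upperCoord (q : ℍ[ℝ]) : ℂ := ⟨q.re, ‖q.im‖⟩

theorem continuous_upperCoord : Continuous upperCoord := by
  have : upperCoord = fun q => (q.re : ℂ) + (‖q.im‖ : ℝ) * Complex.I := by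
    ext q
    apply Complex.ext <;> simp [upperCoord]
  rw [this]
  exact (Complex.continuous_ofReal.comp Quaternion.continuous_re).add
    ((Complex.continuous_ofReal.comp Quaternion.continuous_im.norm).mul continuous_const)

theorem exists_slice_upperCoord (q : ℍ[ℝ]) : ∃ J ∈ imagUnits, slice J (upperCoord q) = q := by
  by_cases h : q.im = 0
  · obtain ⟨J, hJ⟩ := imagUnits_nonempty
    refine ⟨J, hJ, ?_⟩
    conv_rhs => rw [← Quaternion.re_add_im q, h]
    simp [slice, upperCoord, h]
  · have hn : ‖q.im‖ ≠ 0 := norm_ne_zero_iff.2 h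
    refine ⟨‖q.im‖⁻¹ • q.im, mem_imagUnits_iff.2 ⟨by simp, ?_⟩, ?_⟩
    · have h2 := norm_sq_quaternion q.im
      simp only [Quaternion.re_im, Quaternion.imI_im, Quaternion.imJ_im, Quaternion.imK_im] at h2
      simp only [Quaternion.imI_smul, Quaternion.imJ_smul, Quaternion.imK_smul,
        Quaternion.imI_im, Quaternion.imJ_im, Quaternion.imK_im, smul_eq_mul]
      field_simp
      linarith
    · conv_rhs => rw [← Quaternion.re_add_im q]
      simp [slice, upperCoord, Quaternion.coe_mul_eq_smul, smul_smul, hn]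

theorem upperCoord_slice {J : ℍ[ℝ]} (hJ : J ∈ imagUnits) (z : ℂ) :
    upperCoord (slice J z) = ⟨z.re, |z.im|⟩ := by
  refine Complex.ext (re_slice hJ z) ?_
  simp only [upperCoord]
  rw [← sq_eq_sq₀ (norm_nonneg _) (abs_nonneg _), norm_sq_quaternion, sq_abs]
  simp only [Quaternion.re_im, Quaternion.imI_im, Quaternion.imJ_im, Quaternion.imK_im, imI_slice,
    imJ_slice, imK_slice]
  linear_combination z.im ^ 2 * (mem_imagUnits_iff.1 hJ).2

theorem upperCoord_slice_of_nonneg {J : ℍ[ℝ]} (hJ : J ∈ imagUnits) {z : ℂ} (hz : 0 ≤ z.im) :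
    upperCoord (slice J z) = z := by
  rw [upperCoord_slice hJ, abs_of_nonneg hz]

theorem upperCoord_slice_of_nonpos {J : ℍ[ℝ]} (hJ : J ∈ imagUnits) {z : ℂ} (hz : z.im ≤ 0) :
    upperCoord (slice J z) = starRingEnd ℂ z := by
  rw [upperCoord_slice hJ, abs_of_nonpos hz]; rfl

/-- The reverse triangle inequality for the imaginary parts. It converts estimates in the half-plane
coordinate into estimates in |p - q|. -/
theorem norm_upperCoord_sub_le (p q : ℍ[ℝ]) : ‖upperCoord p - upperCoord q‖ ≤ ‖p - q‖ := by
  have h1 : |‖p.im‖ - ‖q.im‖| ≤ ‖(p - q).im‖ := by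
    rw [Quaternion.im_sub]; exact abs_norm_sub_norm_le _ _
  have h2 := sq_le_sq' (by linarith [abs_nonneg (‖p.im‖ - ‖q.im‖), norm_nonneg (p - q).im]) h1
  rw [sq_abs] at h2
  rw [← sq_le_sq₀ (norm_nonneg _) (norm_nonneg _), Complex.sq_norm, Complex.normSq_apply,
    norm_sq_quaternion (p - q)]
  rw [norm_sq_quaternion (p - q).im] at h2
  simp only [Quaternion.re_im, Quaternion.imI_im, Quaternion.imJ_im, Quaternion.imK_im] at h2
  simp only [upperCoord, Complex.sub_re, Complex.sub_im, Quaternion.re_sub] at h2 ⊢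
  linarith

theorem norm_upperCoord (q : ℍ[ℝ]) : ‖upperCoord q‖ = ‖q‖ := by
  obtain ⟨J, hJ, h⟩ := exists_slice_upperCoord q
  conv_rhs => rw [← h, norm_slice hJ]

/-! ### Holomorphic functions on slices -/

/-- The quaternions as a complex normed space, with `x + iy` acting as left multiplication by
`x + yI`. -/
abbrev sliceNormedSpace (I : ℍ[ℝ]) (hI : I ∈ imagUnits) : NormedSpace ℂ ℍ[ℝ] where
  smul z q := slice I z * q
  one_smul q := by
    change slice I 1 * q = q
    simp [slice]
  mul_smul z w q := by
    change slice I (z * w) * q = slice I z * (slice I w * q)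
    rw [slice_mul hI, mul_assoc]
  smul_zero z := mul_zero _
  smul_add z p q := mul_add _ _ _
  add_smul z w q := by
    change slice I (z + w) * q = slice I z * q + slice I w * q
    rw [slice_add, add_mul]
  zero_smul q := by
    change slice I 0 * q = 0
    simp [slice]
  norm_smul_le z q := by
    change ‖slice I z * q‖ ≤ _
    rw [norm_mul, norm_slice hI]

theorem finiteDimensional_sliceNormedSpace (I : ℍ[ℝ]) (hI : I ∈ imagUnits) :
    letI := sliceNormedSpace I hI
    FiniteDimensional ℂ ℍ[ℝ] := by
  let _ := sliceNormedSpace I hI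
  have : IsScalarTower ℝ ℂ ℍ[ℝ] := ⟨fun r z q => by
    change slice I (r • z) * q = r • (slice I z * q)
    rw [← smul_mul_assoc, ← Quaternion.coe_mul_eq_smul, Complex.real_smul, slice_mul hI,
      slice_ofReal]⟩
  exact Module.Finite.of_restrictScalars_finite ℝ ℂ ℍ[ℝ]

/-- The real-linear map `w ↦ (Re w) c + (Im w) d`. -/
def planeMap (c d : ℍ[ℝ]) : ℂ →L[ℝ] ℍ[ℝ] :=
  Complex.reCLM.smulRight c + Complex.imCLM.smulRight d

theorem planeMap_apply (c d : ℍ[ℝ]) (w : ℂ) : planeMap c d w = w.re • c + w.im • d := rfl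

theorem slice_mul_eq (I c : ℍ[ℝ]) (w : ℂ) : slice I w * c = planeMap c (I * c) w := by
  rw [planeMap_apply, slice, add_mul, mul_assoc, Quaternion.coe_mul_eq_smul,
    Quaternion.coe_mul_eq_smul]

/-- Holomorphy with respect to left multiplication by `I`. -/
def IsSliceHolomorphicOn (I : ℍ[ℝ]) (F : ℂ → ℍ[ℝ]) (D : Set ℂ) : Prop :=
  ∀ z ∈ D, ∃ c, HasFDerivAt F (planeMap c (I * c)) z

theorem IsSliceHolomorphicOn.differentiableOn {I : ℍ[ℝ]} {F : ℂ → ℍ[ℝ]} {D : Set ℂ}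
    (hF : IsSliceHolomorphicOn I F D) (hI : I ∈ imagUnits) :
    letI := sliceNormedSpace I hI
    DifferentiableOn ℂ F D := by
  let _ := sliceNormedSpace I hI
  intro z hz
  obtain ⟨c, hc⟩ := hF z hz
  have h : HasDerivAt F c z := by
    rw [hasDerivAt_iff_isLittleO]
    rw [hasFDerivAt_iff_isLittleO] at hc
    refine hc.congr_left fun w => ?_
    rw [← slice_mul_eq]; rfl
  exact h.differentiableAt.differentiableWithinAt

theorem IsSliceRegularOn.isSliceHolomorphicOn {f : ℍ[ℝ] → ℍ[ℝ]} {Ω : Set ℍ[ℝ]}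
    (hf : IsSliceRegularOn f Ω) (hΩ : IsOpen Ω) {I : ℍ[ℝ]} (hI : I ∈ imagUnits) :
    IsSliceHolomorphicOn I (f ∘ slice I) (slice I ⁻¹' Ω) := by
  intro z hz
  obtain ⟨h1, h2⟩ := hf I hI
  have hd : HasFDerivAt (f ∘ slice I) (fderiv ℝ (f ∘ slice I) z) z :=
    ((h1.differentiableOn one_ne_zero).differentiableAt
      ((hΩ.preimage (continuous_slice I)).mem_nhds hz)).hasFDerivAt
  refine ⟨fderiv ℝ (f ∘ slice I) z 1, hd.congr_fderiv ?_⟩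
  have h3 := (mul_eq_zero.1 (h2 z hz)).resolve_left (one_div_ne_zero
    (Quaternion.coe_injective.ne (two_ne_zero (α := ℝ))))
  have h4 : fderiv ℝ (f ∘ slice I) z Complex.I = I * fderiv ℝ (f ∘ slice I) z 1 := by
    have h5 := congrArg (fun q => I * q) h3
    simp only [mul_add, mul_zero, ← mul_assoc, show I * I = -1 from hI, neg_mul, one_mul] at h5
    exact (add_neg_eq_zero.1 h5).symm
  ext w : 1
  rw [planeMap_apply, ← h4, ← map_smul, ← map_smul, ← map_add]
  congr 1
  apply Complex.ext <;> simp

/-- For the complex structure of left multiplication by `I` both functions are analytic, so the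
usual identity theorem applies. -/
theorem eqOn_of_isSliceHolomorphicOn {I : ℍ[ℝ]} (hI : I ∈ imagUnits) {F G : ℂ → ℍ[ℝ]} {D : Set ℂ}
    (hD : IsOpen D) (hDc : IsPreconnected D) (hF : IsSliceHolomorphicOn I F D)
    (hG : IsSliceHolomorphicOn I G D) {z₀ : ℂ} (hz₀ : z₀ ∈ D)
    (h : ∃ᶠ z in 𝓝[≠] z₀, F z = G z) : Set.EqOn F G D := by
  let _ := sliceNormedSpace I hI
  exact AnalyticOnNhd.eqOn_of_preconnected_of_frequently_eq
    ((hF.differentiableOn hI).analyticOnNhd hD) ((hG.differentiableOn hI).analyticOnNhd hD) hDc hz₀ h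

theorem frequently_nhdsNE_of_real {p : ℂ → Prop} {D : Set ℂ} (hD : IsOpen D) {x₀ : ℝ}
    (hx₀ : (x₀ : ℂ) ∈ D) (h : ∀ x : ℝ, (x : ℂ) ∈ D → p x) : ∃ᶠ z in 𝓝[≠] (x₀ : ℂ), p z := by
  have ht : Tendsto (fun x : ℝ => (x : ℂ)) (𝓝[≠] x₀) (𝓝[≠] (x₀ : ℂ)) := by
    refine tendsto_nhdsWithin_iff.2 ⟨(Complex.continuous_ofReal.tendsto x₀).mono_left
      nhdsWithin_le_nhds, ?_⟩
    filter_upwards [self_mem_nhdsWithin] with x hx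
    exact fun h => hx (Complex.ofReal_injective h)
  refine ht.frequently (Eventually.frequently ?_)
  have : ∀ᶠ x : ℝ in 𝓝[≠] x₀, (x : ℂ) ∈ D :=
    (Complex.continuous_ofReal.tendsto x₀).mono_left nhdsWithin_le_nhds (hD.mem_nhds hx₀)
  filter_upwards [this] with x hx using h x hx

end

/-! ### Stem functions and local behaviour of regular functions. -/

section

/-! ### Symmetric slice domains and their planar models -/

/-- The set of `x + iy` with `x + yJ ∈ Ω` for some `J ∈ 𝕊`. -/
def planarDomain (Ω : Set ℍ[ℝ]) : Set ℂ := {z | ∃ J ∈ imagUnits, slice J z ∈ Ω}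

theorem conj_mem_planarDomain {Ω : Set ℍ[ℝ]} {z : ℂ} (hz : z ∈ planarDomain Ω) :
    starRingEnd ℂ z ∈ planarDomain Ω := by
  obtain ⟨J, hJ, h⟩ := hz
  refine ⟨-J, neg_mem_imagUnits hJ, ?_⟩
  rwa [slice_neg_left, Complex.conj_conj]

theorem upperCoord_mem_planarDomain {Ω : Set ℍ[ℝ]} {q : ℍ[ℝ]} (hq : q ∈ Ω) :
    upperCoord q ∈ planarDomain Ω := by
  obtain ⟨J, hJ, h⟩ := exists_slice_upperCoord q
  exact ⟨J, hJ, by rwa [h]⟩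

namespace IsSymmetricSliceDomain

variable {Ω : Set ℍ[ℝ]}

theorem slice_mem_iff (hΩ : IsSymmetricSliceDomain Ω) {J : ℍ[ℝ]} (hJ : J ∈ imagUnits) {z : ℂ} :
    slice J z ∈ Ω ↔ z ∈ planarDomain Ω :=
  ⟨fun h => ⟨J, hJ, h⟩, fun ⟨I, hI, h⟩ => hΩ.symmetric _ _ I hI J hJ h⟩

theorem preimage_slice (hΩ : IsSymmetricSliceDomain Ω) {J : ℍ[ℝ]} (hJ : J ∈ imagUnits) :
    slice J ⁻¹' Ω = planarDomain Ω :=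
  Set.ext fun _ => hΩ.slice_mem_iff hJ

theorem isOpen_planarDomain (hΩ : IsSymmetricSliceDomain Ω) : IsOpen (planarDomain Ω) := by
  obtain ⟨J, hJ⟩ := imagUnits_nonempty
  rw [← hΩ.preimage_slice hJ]
  exact hΩ.isOpen.preimage (continuous_slice J)

theorem isPreconnected_planarDomain (hΩ : IsSymmetricSliceDomain Ω) :
    IsPreconnected (planarDomain Ω) := by
  obtain ⟨J, hJ⟩ := imagUnits_nonempty
  have h := (hΩ.slice_connected J hJ).isPreconnected.image (sliceCoord J)
    (continuous_sliceCoord J).continuousOn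
  convert h using 1
  ext z
  rw [← hΩ.slice_mem_iff hJ]
  refine ⟨fun hz => ⟨slice J z, ⟨hz, z, rfl⟩, sliceCoord_slice hJ z⟩, ?_⟩
  rintro ⟨_, ⟨hq, w, rfl⟩, rfl⟩
  rwa [sliceCoord_slice hJ]

theorem ofReal_mem_iff (hΩ : IsSymmetricSliceDomain Ω) {x : ℝ} :
    (x : ℂ) ∈ planarDomain Ω ↔ (x : ℍ[ℝ]) ∈ Ω := by
  obtain ⟨J, hJ⟩ := imagUnits_nonempty
  rw [← hΩ.slice_mem_iff hJ, slice_ofReal]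

theorem exists_ofReal_mem (hΩ : IsSymmetricSliceDomain Ω) : ∃ x : ℝ, (x : ℂ) ∈ planarDomain Ω := by
  obtain ⟨x, hx⟩ := hΩ.meets_real
  exact ⟨x, hΩ.ofReal_mem_iff.2 hx⟩

end IsSymmetricSliceDomain

/-! ### The representation formula -/

/-- `a + ib` is a holomorphic stem function on `Ω` inducing `f`: `f (x + yJ) = a + J b`, and the
pair `(a, b)` satisfies the Cauchy-Riemann equations. -/
structure IsStem (f : ℍ[ℝ] → ℍ[ℝ]) (Ω : Set ℍ[ℝ]) (a b : ℂ → ℍ[ℝ]) : Prop where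
  eq : ∀ z ∈ planarDomain Ω, ∀ J ∈ imagUnits, f (slice J z) = a z + J * b z
  deriv : ∀ z ∈ planarDomain Ω, ∃ c d, HasFDerivAt a (planeMap c (-d)) z ∧
    HasFDerivAt b (planeMap d c) z

theorem isSliceHolomorphicOn_const (I w : ℍ[ℝ]) (D : Set ℂ) :
    IsSliceHolomorphicOn I (fun _ => w) D := fun z _ => ⟨0, by
  have : planeMap 0 (I * 0) = 0 := by ext w : 1; simp [planeMap_apply]
  rw [this]; exact hasFDerivAt_const w z⟩

variable {Ω : Set ℍ[ℝ]} {f : ℍ[ℝ] → ℍ[ℝ]}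

theorem IsSliceRegularOn.isSliceHolomorphicOn_planarDomain (hf : IsSliceRegularOn f Ω)
    (hΩ : IsSymmetricSliceDomain Ω) {I : ℍ[ℝ]} (hI : I ∈ imagUnits) :
    IsSliceHolomorphicOn I (f ∘ slice I) (planarDomain Ω) := by
  rw [← hΩ.preimage_slice hI]
  exact hf.isSliceHolomorphicOn hΩ.isOpen hI

/-- The pair (a, b) is read off from f at z and its conjugate on a single slice L_I. For any J both
f on L_J and a + J b are holomorphic for left multiplication by J and agree on the real points,
hence everywhere by the identity theorem. -/
theorem IsSliceRegularOn.exists_isStem (hf : IsSliceRegularOn f Ω)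
    (hΩ : IsSymmetricSliceDomain Ω) : ∃ a b, IsStem f Ω a b := by
  obtain ⟨I, hI⟩ := imagUnits_nonempty
  have hI2 : I * I = -1 := hI
  set a : ℂ → ℍ[ℝ] := fun z =>
    (1 / 2 : ℝ) • (f (slice I z) + f (slice I (starRingEnd ℂ z))) with ha
  set b : ℂ → ℍ[ℝ] := fun z =>
    (-(1 / 2) : ℝ) • (I * (f (slice I z) - f (slice I (starRingEnd ℂ z)))) with hb
  have hder : ∀ z ∈ planarDomain Ω, ∃ c d, HasFDerivAt a (planeMap c (-d)) z ∧
      HasFDerivAt b (planeMap d c) z := by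
    intro z hz
    obtain ⟨c, hc⟩ := hf.isSliceHolomorphicOn_planarDomain hΩ hI z hz
    obtain ⟨c', hc'⟩ := hf.isSliceHolomorphicOn_planarDomain hΩ hI _ (conj_mem_planarDomain hz)
    have hconj : HasFDerivAt (fun z => f (slice I (starRingEnd ℂ z)))
        ((planeMap c' (I * c')).comp (Complex.conjCLE : ℂ →L[ℝ] ℂ)) z :=
      HasFDerivAt.comp (g := f ∘ slice I) z hc' Complex.conjCLE.hasFDerivAt
    have hc : HasFDerivAt (fun z => f (slice I z)) (planeMap c (I * c)) z := hc
    refine ⟨(1 / 2 : ℝ) • (c + c'), (-(1 / 2) : ℝ) • (I * (c - c')), ?_, ?_⟩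
    · refine ((hc.add hconj).const_smul (1 / 2 : ℝ)).congr_fderiv ?_
      ext w : 1
      simp only [planeMap_apply, smul_apply, add_apply,
        ContinuousLinearMap.comp_apply, ContinuousLinearEquiv.coe_coe, Complex.conjCLE_apply,
        Complex.conj_re, Complex.conj_im, mul_sub]
      module
    · have h2 := ((hc.sub hconj).const_mul I).const_smul (-(1 / 2) : ℝ)
      refine h2.congr_fderiv ?_
      ext w : 1
      simp only [planeMap_apply, smul_apply, sub_apply,
        ContinuousLinearMap.comp_apply, ContinuousLinearEquiv.coe_coe, Complex.conjCLE_apply,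
        Complex.conj_re, Complex.conj_im, mul_sub, mul_add, mul_smul_comm, smul_eq_mul,
        ← mul_assoc, hI2, neg_mul, one_mul]
      module
  refine ⟨a, b, fun z hz J hJ => ?_, hder⟩
  have hJ2 : J * J = -1 := hJ
  obtain ⟨x₀, hx₀⟩ := hΩ.exists_ofReal_mem
  have hG : IsSliceHolomorphicOn J (fun z => a z + J * b z) (planarDomain Ω) := by
    intro z hz
    obtain ⟨c, d, h1, h2⟩ := hder z hz
    refine ⟨c + J * d, (h1.add (h2.const_mul J)).congr_fderiv ?_⟩
    ext w : 1
    simp only [planeMap_apply, add_apply, smul_apply,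
      mul_add, mul_smul_comm, smul_eq_mul, ← mul_assoc, hJ2, neg_mul, one_mul]
    module
  refine eqOn_of_isSliceHolomorphicOn hJ hΩ.isOpen_planarDomain hΩ.isPreconnected_planarDomain
    (hf.isSliceHolomorphicOn_planarDomain hΩ hJ) hG hx₀
    (frequently_nhdsNE_of_real hΩ.isOpen_planarDomain hx₀ fun x _ => ?_) hz
  simp only [Function.comp_apply, slice_ofReal, ha, hb, Complex.conj_ofReal, sub_self, mul_zero,
    smul_zero, add_zero]
  module

namespace IsStem

variable {a b : ℂ → ℍ[ℝ]}

/-- The pairs (z, J) and (conj z, -J) represent the same quaternion, which makes a even and b odd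
under conjugation. -/
theorem conj (h : IsStem f Ω a b) {z : ℂ}
    (hz : z ∈ planarDomain Ω) : a (starRingEnd ℂ z) = a z ∧ b (starRingEnd ℂ z) = -b z := by
  obtain ⟨J, hJ⟩ := imagUnits_nonempty
  have h1 := h.eq _ (conj_mem_planarDomain hz) J hJ
  have h2 := h.eq _ (conj_mem_planarDomain hz) (-J) (neg_mem_imagUnits hJ)
  rw [slice_conj, h.eq z hz _ (neg_mem_imagUnits hJ)] at h1
  rw [slice_conj, neg_neg, h.eq z hz _ hJ] at h2
  have h3 : (2 : ℝ) • a (starRingEnd ℂ z) = (2 : ℝ) • a z := by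
    rw [two_smul, two_smul]
    calc a (starRingEnd ℂ z) + a (starRingEnd ℂ z)
        = (a (starRingEnd ℂ z) + J * b (starRingEnd ℂ z)) +
          (a (starRingEnd ℂ z) + -J * b (starRingEnd ℂ z)) := by rw [neg_mul]; abel
      _ = (a z + -J * b z) + (a z + J * b z) := by rw [← h1, ← h2]
      _ = a z + a z := by rw [neg_mul]; abel
  have h3 := smul_right_injective _ (two_ne_zero (α := ℝ)) h3
  refine ⟨h3, ?_⟩
  rw [h3] at h1
  have h4 : J * b (starRingEnd ℂ z) = J * -b z := by
    rw [mul_neg, ← neg_mul]; exact (add_left_cancel h1).symm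
  refine mul_left_cancel₀ (fun hJ0 => ?_) h4
  have := norm_of_mem_imagUnits hJ
  rw [hJ0, norm_zero] at this
  exact zero_ne_one this

theorem im_eq_zero (h : IsStem f Ω a b) {z : ℂ}
    (hz : z ∈ planarDomain Ω) (hz0 : z.im = 0) : b z = 0 := by
  have h1 := (h.conj hz).2
  rw [Complex.conj_eq_iff_im.2 hz0] at h1
  have h2 : b z + b z = 0 := by
    nth_rewrite 1 [h1]
    exact neg_add_cancel _
  rw [← two_smul ℝ] at h2
  exact (smul_eq_zero.1 h2).resolve_left two_ne_zero

theorem continuousAt (h : IsStem f Ω a b) {z : ℂ} (hz : z ∈ planarDomain Ω) :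
    ContinuousAt a z ∧ ContinuousAt b z := by
  obtain ⟨c, d, h1, h2⟩ := h.deriv z hz
  exact ⟨h1.continuousAt, h2.continuousAt⟩

end IsStem

theorem norm_sub_mul_le {I J : ℍ[ℝ]} (hJ : J ∈ imagUnits) (z w : ℂ) :
    ‖J - I‖ * |w.im| ≤ 2 * (‖z - w‖ + ‖slice J z - slice I w‖) := by
  have h1 : slice J w - slice I w = w.im • (J - I) := by
    simp only [slice, smul_sub, Quaternion.coe_mul_eq_smul]; abel
  have h2 : ‖slice J w - slice I w‖ = ‖J - I‖ * |w.im| := by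
    rw [h1, norm_smul, mul_comm, Real.norm_eq_abs]
  have h3 : ‖slice J w - slice I w‖ ≤ ‖slice J w - slice J z‖ + ‖slice J z - slice I w‖ :=
    norm_sub_le_norm_sub_add_norm_sub _ _ _
  rw [norm_slice_sub hJ w z, norm_sub_rev w z] at h3
  rw [← h2]
  linarith [norm_nonneg (z - w), norm_nonneg (slice J z - slice I w)]

/-- Apart from the increments of a and b, the difference contains (J - I) b(z₀). Off the real axis
‖J - I‖ is controlled by |q - q₀| / |Im z₀|; on the real axis b(z₀) = 0. -/
theorem IsSliceRegularOn.isBigO_sub (hf : IsSliceRegularOn f Ω) (hΩ : IsSymmetricSliceDomain Ω)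
    {q₀ : ℍ[ℝ]} (hq₀ : q₀ ∈ Ω) : (fun q => f q - f q₀) =O[𝓝 q₀] fun q => q - q₀ := by
  obtain ⟨a, b, hab⟩ := hf.exists_isStem hΩ
  obtain ⟨I, hI, hIq⟩ := exists_slice_upperCoord q₀
  set z₀ := upperCoord q₀ with hz₀
  have hz₀D : z₀ ∈ planarDomain Ω := upperCoord_mem_planarDomain hq₀
  obtain ⟨c, d, ha, hb⟩ := hab.deriv z₀ hz₀D
  have ht : Tendsto upperCoord (𝓝 q₀) (𝓝 z₀) := continuous_upperCoord.tendsto q₀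
  obtain ⟨A, hA⟩ := (ha.isBigO_sub.comp_tendsto ht).bound
  obtain ⟨B, hB⟩ := (hb.isBigO_sub.comp_tendsto ht).bound
  set B' := if z₀.im = 0 then 0 else 4 * ‖b z₀‖ / |z₀.im| with hB'
  refine Asymptotics.IsBigO.of_bound (|A| + |B| + B') ?_
  filter_upwards [hA, hB, hΩ.isOpen.mem_nhds hq₀] with q hqA hqB hqΩ
  obtain ⟨J, hJ, hJq⟩ := exists_slice_upperCoord q
  have hle : ‖upperCoord q - z₀‖ ≤ ‖q - q₀‖ := norm_upperCoord_sub_le q q₀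
  have e1 : f q = a (upperCoord q) + J * b (upperCoord q) := by
    conv_lhs => rw [← hJq]
    exact hab.eq _ (upperCoord_mem_planarDomain hqΩ) J hJ
  have e2 : f q₀ = a z₀ + I * b z₀ := by
    conv_lhs => rw [← hIq]
    exact hab.eq _ hz₀D I hI
  have e3 : f q - f q₀ = (a (upperCoord q) - a z₀) + J * (b (upperCoord q) - b z₀) +
      (J - I) * b z₀ := by rw [e1, e2]; noncomm_ring
  have k1 : ‖a (upperCoord q) - a z₀‖ ≤ |A| * ‖q - q₀‖ := by
    refine hqA.trans ((mul_le_mul_of_nonneg_right (le_abs_self A) (norm_nonneg _)).trans ?_)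
    exact mul_le_mul_of_nonneg_left hle (abs_nonneg A)
  have k2 : ‖b (upperCoord q) - b z₀‖ ≤ |B| * ‖q - q₀‖ := by
    refine hqB.trans ((mul_le_mul_of_nonneg_right (le_abs_self B) (norm_nonneg _)).trans ?_)
    exact mul_le_mul_of_nonneg_left hle (abs_nonneg B)
  have k3 : ‖J - I‖ * ‖b z₀‖ ≤ B' * ‖q - q₀‖ := by
    rw [hB']
    split_ifs with h0
    · rw [hab.im_eq_zero hz₀D h0, norm_zero, mul_zero, zero_mul]
    · have h1 := norm_sub_mul_le (I := I) hJ (upperCoord q) z₀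
      rw [hJq, hIq] at h1
      have h2 : 0 < |z₀.im| := abs_pos.2 h0
      have h3 : ‖J - I‖ * |z₀.im| ≤ 4 * ‖q - q₀‖ := by linarith
      have h4 : ‖J - I‖ ≤ 4 * ‖q - q₀‖ / |z₀.im| := by rwa [le_div_iff₀ h2]
      calc ‖J - I‖ * ‖b z₀‖ ≤ 4 * ‖q - q₀‖ / |z₀.im| * ‖b z₀‖ := by gcongr
        _ = 4 * ‖b z₀‖ / |z₀.im| * ‖q - q₀‖ := by ring
  rw [e3]
  calc _ ≤ ‖a (upperCoord q) - a z₀‖ + ‖J * (b (upperCoord q) - b z₀)‖ + ‖(J - I) * b z₀‖ :=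
        norm_add₃_le
    _ ≤ |A| * ‖q - q₀‖ + |B| * ‖q - q₀‖ + B' * ‖q - q₀‖ := by
        rw [norm_mul, norm_mul, norm_of_mem_imagUnits hJ, one_mul]
        gcongr
    _ = _ := by ring

theorem IsSliceRegularOn.continuousAt (hf : IsSliceRegularOn f Ω) (hΩ : IsSymmetricSliceDomain Ω)
    {q₀ : ℍ[ℝ]} (hq₀ : q₀ ∈ Ω) : ContinuousAt f q₀ := by
  have h := (hf.isBigO_sub hΩ hq₀).trans_tendsto
    ((continuous_id.sub continuous_const).tendsto' q₀ 0 (by simp))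
  have h2 := h.add_const (f q₀)
  simpa [ContinuousAt] using h2

theorem IsSliceRegularOn.eq_of_forall_real (hf : IsSliceRegularOn f Ω)
    (hΩ : IsSymmetricSliceDomain Ω) {w : ℍ[ℝ]}
    (h : ∀ x : ℝ, (x : ℂ) ∈ planarDomain Ω → f x = w) : ∀ q ∈ Ω, f q = w := by
  intro q hq
  obtain ⟨J, hJ, hJq⟩ := exists_slice_upperCoord q
  obtain ⟨x₀, hx₀⟩ := hΩ.exists_ofReal_mem
  have := eqOn_of_isSliceHolomorphicOn hJ hΩ.isOpen_planarDomain hΩ.isPreconnected_planarDomain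
    (hf.isSliceHolomorphicOn_planarDomain hΩ hJ) (isSliceHolomorphicOn_const J w _) hx₀
    (frequently_nhdsNE_of_real hΩ.isOpen_planarDomain hx₀ fun x hx => by
      simp only [Function.comp_apply, slice_ofReal]; exact h x hx) (upperCoord_mem_planarDomain hq)
  simpa [hJq] using this

theorem IsSliceRegularOn.eventually_slice_ne (hf : IsSliceRegularOn f Ω)
    (hΩ : IsSymmetricSliceDomain Ω) (hnc : ∃ p ∈ Ω, ∃ q ∈ Ω, f p ≠ f q) {I : ℍ[ℝ]}
    (hI : I ∈ imagUnits) {z₀ : ℂ} (hz₀ : z₀ ∈ planarDomain Ω) (w : ℍ[ℝ]) :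
    ∀ᶠ z in 𝓝[≠] z₀, f (slice I z) ≠ w := by
  by_contra hcon
  have heq := eqOn_of_isSliceHolomorphicOn hI hΩ.isOpen_planarDomain
    hΩ.isPreconnected_planarDomain (hf.isSliceHolomorphicOn_planarDomain hΩ hI)
    (isSliceHolomorphicOn_const I w _) hz₀ ((Filter.not_eventually.1 hcon).mono fun z hz => not_not.1 hz)
  have hc := hf.eq_of_forall_real hΩ (w := w) fun x hx => by
    have := heq hx
    simpa [slice_ofReal] using this
  obtain ⟨p, hp, q, hq, hpq⟩ := hnc
  exact hpq ((hc p hp).trans (hc q hq).symm)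

end

/-! ### The open mapping property on axially symmetric sets. -/

section

/-! ### The symmetrized norm and openness on axially symmetric sets -/

/-- The value `|u|² - |v|² + 2i⟨u, v⟩` of the complexified norm form at `u + iv`. -/
def stemNorm (u v : ℍ[ℝ]) : ℂ :=
  ((u.re : ℂ) + Complex.I * v.re) ^ 2 + ((u.imI : ℂ) + Complex.I * v.imI) ^ 2 +
    ((u.imJ : ℂ) + Complex.I * v.imJ) ^ 2 + ((u.imK : ℂ) + Complex.I * v.imK) ^ 2

theorem stemNorm_re (u v : ℍ[ℝ]) : (stemNorm u v).re = ‖u‖ ^ 2 - ‖v‖ ^ 2 := by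
  rw [norm_sq_quaternion, norm_sq_quaternion]
  simp only [stemNorm, sq, Complex.add_re, Complex.mul_re, Complex.add_im, Complex.mul_im,
    Complex.ofReal_re, Complex.ofReal_im, Complex.I_re, Complex.I_im]
  ring

theorem stemNorm_im (u v : ℍ[ℝ]) : (stemNorm u v).im = 2 * (u * star v).re := by
  simp only [stemNorm, sq, Complex.add_re, Complex.mul_re, Complex.add_im, Complex.mul_im,
    Complex.ofReal_re, Complex.ofReal_im, Complex.I_re, Complex.I_im, Quaternion.re_mul,
    Quaternion.re_star, Quaternion.imI_star, Quaternion.imJ_star, Quaternion.imK_star]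
  ring

theorem stemNorm_neg_mul {J : ℍ[ℝ]} (hJ : J ∈ imagUnits) (v : ℍ[ℝ]) :
    stemNorm (-(J * v)) v = 0 := by
  apply Complex.ext
  · rw [stemNorm_re, norm_neg, norm_mul, norm_of_mem_imagUnits hJ, one_mul, sub_self]; rfl
  · rw [stemNorm_im, neg_mul, mul_assoc, Quaternion.self_mul_star, Quaternion.re_neg,
      Quaternion.mul_coe_eq_smul, Quaternion.re_smul, (mem_imagUnits_iff.1 hJ).1]
    simp

/-- Vanishing means that u and v are orthogonal with equal norms; for v ≠ 0 the quaternion -u v⁻¹ is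
then an imaginary unit. -/
theorem exists_of_stemNorm_eq_zero {u v : ℍ[ℝ]} (h : stemNorm u v = 0) :
    ∃ J ∈ imagUnits, u + J * v = 0 := by
  have h1 := stemNorm_re u v
  have h2 := stemNorm_im u v
  rw [h, Complex.zero_re] at h1
  rw [h, Complex.zero_im] at h2
  by_cases hv : v = 0
  · obtain ⟨J, hJ⟩ := imagUnits_nonempty
    refine ⟨J, hJ, ?_⟩
    rw [hv, norm_zero] at h1
    have : u = 0 := norm_eq_zero.1 (by nlinarith)
    rw [this, hv]; simp
  · have hv' : ‖v‖ ≠ 0 := norm_ne_zero_iff.2 hv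
    have hmul : (-(u * v⁻¹)) * v = -u := by rw [neg_mul, inv_mul_cancel_right₀ hv]
    refine ⟨-(u * v⁻¹), mem_imagUnits_iff.2 ?_, by rw [hmul]; simp⟩
    have hre : (-(u * v⁻¹)).re = 0 := by
      have h3 : (-(u * v⁻¹)) * (v * star v) = -(u * star v) := by rw [← mul_assoc, hmul, neg_mul]
      rw [Quaternion.self_mul_star, Quaternion.mul_coe_eq_smul] at h3
      have h4 := congrArg QuaternionAlgebra.re h3
      rw [Quaternion.re_smul, Quaternion.re_neg (u * star v), smul_eq_mul] at h4
      have h5 : Quaternion.normSq v ≠ 0 := Quaternion.normSq_ne_zero.2 hv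
      have h6 : Quaternion.normSq v * (-(u * v⁻¹)).re = 0 := by rw [h4]; linarith
      exact (mul_eq_zero.1 h6).resolve_left h5
    refine ⟨hre, ?_⟩
    have h7 := norm_sq_quaternion (-(u * v⁻¹))
    rw [hre, norm_neg, norm_mul, norm_inv, mul_pow, inv_pow] at h7
    have h8 : ‖u‖ ^ 2 = ‖v‖ ^ 2 := by linarith
    rw [h8, mul_inv_cancel₀ (pow_ne_zero 2 hv')] at h7
    linarith

theorem continuous_stemNorm : Continuous fun p : ℍ[ℝ] × ℍ[ℝ] => stemNorm p.1 p.2 := by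
  unfold stemNorm
  have h : ∀ g : ℍ[ℝ] → ℝ, Continuous g → Continuous fun p : ℍ[ℝ] × ℍ[ℝ] =>
      ((g p.1 : ℂ) + Complex.I * g p.2) ^ 2 := fun g hg => by fun_prop
  exact (((h _ Quaternion.continuous_re).add (h _ Quaternion.continuous_imI)).add
    (h _ Quaternion.continuous_imJ)).add (h _ Quaternion.continuous_imK)

attribute [local irreducible] stemNorm in
theorem tendsto_stemNorm {X : Type*} {l : Filter X} {u v : X → ℍ[ℝ]} {u₀ v₀ : ℍ[ℝ]}
    (hu : Tendsto u l (𝓝 u₀)) (hv : Tendsto v l (𝓝 v₀)) :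
    Tendsto (fun x => stemNorm (u x) (v x)) l (𝓝 (stemNorm u₀ v₀)) := by
  have h := continuous_stemNorm.tendsto (u₀, v₀)
  exact h.comp (hu.prodMk_nhds hv)

variable {Ω : Set ℍ[ℝ]} {f : ℍ[ℝ] → ℍ[ℝ]} {a b : ℂ → ℍ[ℝ]}

/-- The Cauchy-Riemann equations for (a, b) hold in each real coordinate, so each coordinate of a +
ib is holomorphic. -/
theorem IsStem.differentiableOn_coord (h : IsStem f Ω a b) (ℓ : ℍ[ℝ] →L[ℝ] ℝ) :
    DifferentiableOn ℂ (fun z => (ℓ (a z) : ℂ) + Complex.I * ℓ (b z)) (planarDomain Ω) := by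
  intro z hz
  obtain ⟨c, d, ha, hb⟩ := h.deriv z hz
  refine DifferentiableAt.differentiableWithinAt (𝕜 := ℂ)
    (HasDerivAt.differentiableAt (f' := (ℓ c : ℂ) + Complex.I * ℓ d) ?_)
  have h1 := (Complex.ofRealCLM.hasFDerivAt.comp z (ℓ.hasFDerivAt.comp z ha)).add
    ((Complex.ofRealCLM.hasFDerivAt.comp z (ℓ.hasFDerivAt.comp z hb)).const_mul Complex.I)
  rw [hasDerivAt_iff_isLittleO]
  rw [hasFDerivAt_iff_isLittleO] at h1
  refine h1.congr_left fun w => ?_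
  simp only [Pi.add_apply, Function.comp_apply, Complex.ofRealCLM_apply, add_apply,
    ContinuousLinearMap.comp_apply, smul_apply, planeMap_apply, map_add, map_smul, map_neg,
    smul_eq_mul, Complex.ofReal_mul, Complex.ofReal_neg]
  have hw : (w - z : ℂ) = ((w - z).re : ℂ) + ((w - z).im : ℂ) * Complex.I :=
    (Complex.re_add_im _).symm
  generalize (w - z).re = x at *
  generalize (w - z).im = y at *
  rw [hw]
  linear_combination (y : ℂ) * (ℓ d : ℂ) * Complex.I_sq

theorem exists_coordCLM : ∃ ℓ : Fin 4 → (ℍ[ℝ] →L[ℝ] ℝ), (∀ q, ℓ 0 q = q.re) ∧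
    (∀ q, ℓ 1 q = q.imI) ∧ (∀ q, ℓ 2 q = q.imJ) ∧ ∀ q, ℓ 3 q = q.imK :=
  ⟨![LinearMap.toContinuousLinearMap
      { toFun := fun q : ℍ[ℝ] => q.re, map_add' := fun _ _ => rfl, map_smul' := fun _ _ => rfl },
    LinearMap.toContinuousLinearMap
      { toFun := fun q : ℍ[ℝ] => q.imI, map_add' := fun _ _ => rfl, map_smul' := fun _ _ => rfl },
    LinearMap.toContinuousLinearMap
      { toFun := fun q : ℍ[ℝ] => q.imJ, map_add' := fun _ _ => rfl, map_smul' := fun _ _ => rfl },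
    LinearMap.toContinuousLinearMap
      { toFun := fun q : ℍ[ℝ] => q.imK, map_add' := fun _ _ => rfl, map_smul' := fun _ _ => rfl }],
    fun _ => rfl, fun _ => rfl, fun _ => rfl, fun _ => rfl⟩

theorem IsStem.differentiableOn_stemNorm (h : IsStem f Ω a b) (w : ℍ[ℝ]) :
    DifferentiableOn ℂ (fun z => stemNorm (a z - w) (b z)) (planarDomain Ω) := by
  obtain ⟨ℓ, h0, h1, h2, h3⟩ := exists_coordCLM
  have key : ∀ k, DifferentiableOn ℂ
      (fun z => ((ℓ k (a z - w) : ℂ) + Complex.I * ℓ k (b z)) ^ 2) (planarDomain Ω) := by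
    intro k
    refine DifferentiableOn.pow (DifferentiableOn.congr
      ((h.differentiableOn_coord (ℓ k)).sub_const (ℓ k w : ℂ)) fun z _ => ?_) 2
    rw [map_sub, Complex.ofReal_sub]; ring
  have := (((key 0).add (key 1)).add (key 2)).add (key 3)
  refine this.congr fun z _ => ?_
  simp only [stemNorm, h0, h1, h2, h3, Pi.add_apply]

theorem norm_le_add₃ {E : Type*} [SeminormedAddCommGroup E] (x y t : E) :
    ‖x‖ ≤ ‖y - t‖ + ‖t‖ + ‖y - x‖ :=
  calc ‖x‖ = ‖(y - t) + t - (y - x)‖ := by congr 1; abel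
    _ ≤ _ := (norm_sub_le _ _).trans (by gcongr; exact norm_add_le _ _)

/-- A nonconstant regular function maps axially symmetric neighbourhoods of a sphere to
neighbourhoods of the image of each point of the sphere. -/
theorem IsSliceRegularOn.eventually_exists_eq (hf : IsSliceRegularOn f Ω)
    (hΩ : IsSymmetricSliceDomain Ω) (hnc : ∃ p ∈ Ω, ∃ q ∈ Ω, f p ≠ f q) {K : ℍ[ℝ]}
    (hK : K ∈ imagUnits) {z₁ : ℂ} (hz₁ : z₁ ∈ planarDomain Ω) {Z : Set ℂ} (hZ : Z ∈ 𝓝 z₁) :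
    ∀ᶠ w in 𝓝 (f (slice K z₁)), ∃ z ∈ Z ∩ planarDomain Ω, ∃ J ∈ imagUnits, f (slice J z) = w := by
  obtain ⟨a, b, hab⟩ := hf.exists_isStem hΩ
  set w₁ := f (slice K z₁) with hw₁
  set N : ℍ[ℝ] → ℂ → ℂ := fun w z => stemNorm (a z - w) (b z) with hN
  have hNa : ∀ w, AnalyticOnNhd ℂ (N w) (planarDomain Ω) := fun w =>
    (hab.differentiableOn_stemNorm w).analyticOnNhd hΩ.isOpen_planarDomain
  have hN0 : N w₁ z₁ = 0 := by
    have : a z₁ - w₁ = -(K * b z₁) := by rw [hw₁, hab.eq z₁ hz₁ K hK]; abel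
    simp only [hN, this, stemNorm_neg_mul hK]
  -- If N_{w₁} vanished identically then, b being zero at real points, a would equal w₁ there and f
  -- would be constant.
  have hne : ∀ᶠ z in 𝓝[≠] z₁, N w₁ z ≠ 0 := by
    refine ((hNa w₁ z₁ hz₁).eventually_eq_zero_or_eventually_ne_zero).resolve_left fun h0 => ?_
    have hzero := (hNa w₁).eqOn_zero_of_preconnected_of_eventuallyEq_zero
      hΩ.isPreconnected_planarDomain hz₁ h0
    have hc := hf.eq_of_forall_real hΩ (w := w₁) fun x hx => by
      have h1 : N w₁ x = 0 := hzero hx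
      have hb0 : b x = 0 := hab.im_eq_zero hx (Complex.ofReal_im x)
      have h2 := stemNorm_re (a x - w₁) (b x)
      simp only [hN] at h1
      rw [h1, hb0, norm_zero, Complex.zero_re] at h2
      have h3 : a x - w₁ = 0 := norm_eq_zero.1 (by nlinarith)
      have h4 := hab.eq x hx K hK
      rw [slice_ofReal, hb0, mul_zero, add_zero] at h4
      rw [h4]; exact sub_eq_zero.1 h3
    obtain ⟨p, hp, q, hq, hpq⟩ := hnc
    exact hpq ((hc p hp).trans (hc q hq).symm)
  obtain ⟨r, hr, hrb⟩ : ∃ r > 0, Metric.closedBall z₁ r ⊆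
      (Z ∩ planarDomain Ω) ∩ {z | z ≠ z₁ → N w₁ z ≠ 0} := by
    refine Metric.nhds_basis_closedBall.mem_iff.1 (Filter.inter_mem
      (Filter.inter_mem hZ (hΩ.isOpen_planarDomain.mem_nhds hz₁)) ?_)
    exact eventually_nhdsWithin_iff.1 hne
  have hbD : Metric.closedBall z₁ r ⊆ planarDomain Ω := fun z hz => (hrb hz).1.2
  have hSD : Metric.sphere z₁ r ⊆ planarDomain Ω := Metric.sphere_subset_closedBall.trans hbD
  obtain ⟨ζ, hζ, hmin⟩ := (isCompact_sphere z₁ r).exists_isMinOn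
    (NormedSpace.sphere_nonempty.2 hr.le)
    (((hNa w₁).continuousOn.mono hSD).norm)
  set ε := ‖N w₁ ζ‖ with hε
  have hε0 : 0 < ε := norm_pos_iff.2 ((hrb (Metric.sphere_subset_closedBall hζ)).2
    (Metric.ne_of_mem_sphere hζ hr.ne'))
  have hclose : ∀ᶠ w in 𝓝 w₁, ∀ z ∈ Metric.closedBall z₁ r, ‖N w z - N w₁ z‖ < ε / 4 := by
    refine (isCompact_closedBall z₁ r).eventually_forall_of_forall_eventually fun z hz => ?_
    obtain ⟨ca, cb⟩ := hab.continuousAt (hbD hz)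
    have ca' : Tendsto (fun y : ℍ[ℝ] × ℂ => a y.2) (𝓝 (w₁, z)) (𝓝 (a z)) :=
      ca.tendsto.comp (continuous_snd.tendsto (w₁, z))
    have cb' : Tendsto (fun y : ℍ[ℝ] × ℂ => b y.2) (𝓝 (w₁, z)) (𝓝 (b z)) :=
      cb.tendsto.comp (continuous_snd.tendsto (w₁, z))
    have c1 : Tendsto (fun y : ℍ[ℝ] × ℂ => N y.1 y.2) (𝓝 (w₁, z)) (𝓝 (N w₁ z)) :=
      tendsto_stemNorm (ca'.sub (continuous_fst.tendsto (w₁, z))) cb'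
    have c2 : Tendsto (fun y : ℍ[ℝ] × ℂ => N w₁ y.2) (𝓝 (w₁, z)) (𝓝 (N w₁ z)) :=
      tendsto_stemNorm (ca'.sub tendsto_const_nhds) cb'
    have c3 := (c1.sub c2).norm
    rw [sub_self, norm_zero] at c3
    exact c3.eventually_lt_const (by positivity)
  filter_upwards [hclose] with w hw
  have hz₁b : z₁ ∈ Metric.closedBall z₁ r := Metric.mem_closedBall_self hr.le
  have hcen : ‖N w z₁‖ < ε / 4 := by simpa [hN0] using hw z₁ hz₁b
  have hsph : ∀ z ∈ Metric.sphere z₁ r, ε / 2 ≤ ‖N w z - N w z₁‖ := by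
    intro z hz
    have h1 : ε ≤ ‖N w₁ z‖ := hmin hz
    have h2 := hw z (Metric.sphere_subset_closedBall hz)
    have h3 := norm_le_add₃ (N w₁ z) (N w z) (N w z₁)
    linarith
  have hdiff : DiffContOnCl ℂ (N w) (Metric.ball z₁ r) := by
    refine DifferentiableOn.diffContOnCl ?_
    rw [closure_ball _ hr.ne']
    exact (hab.differentiableOn_stemNorm w).mono hbD
  have hfreq : ∃ᶠ z in 𝓝 z₁, N w z ≠ N w z₁ := by
    intro h0
    have h1 : N w =ᶠ[𝓝 z₁] fun _ => N w z₁ := h0.mono fun z hz => not_not.1 hz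
    have h2 := (hNa w).eqOn_of_preconnected_of_eventuallyEq analyticOnNhd_const
      hΩ.isPreconnected_planarDomain hz₁ h1 (hSD hζ)
    have h3 := hsph ζ hζ
    rw [h2, sub_self, norm_zero] at h3
    linarith
  -- A Hurwitz-type argument: for w near w₁ the function N_w stays away from N_w(z₁) on the circle,
  -- while 0 is close to N_w(z₁), so the quantitative open mapping theorem gives a zero inside.
  obtain ⟨z, hz, hz0⟩ := hdiff.ball_subset_image_closedBall hr hsph hfreq
    (show (0 : ℂ) ∈ Metric.ball (N w z₁) (ε / 2 / 2) by
      rw [mem_ball_iff_norm, zero_sub, norm_neg]; linarith)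
  obtain ⟨J, hJ, hJ0⟩ := exists_of_stemNorm_eq_zero hz0
  refine ⟨z, (hrb hz).1, J, hJ, ?_⟩
  rw [hab.eq z (hbD hz) J hJ]
  have : a z - w + J * b z = a z + J * b z - w := by abel
  rw [this] at hJ0
  exact sub_eq_zero.1 hJ0

theorem IsSliceRegularOn.isOpen_image (hf : IsSliceRegularOn f Ω) (hΩ : IsSymmetricSliceDomain Ω)
    (hnc : ∃ p ∈ Ω, ∃ q ∈ Ω, f p ≠ f q) : IsOpen (f '' Ω) := by
  rw [isOpen_iff_mem_nhds]
  rintro _ ⟨q, hq, rfl⟩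
  obtain ⟨K, hK, hKq⟩ := exists_slice_upperCoord q
  have h := hf.eventually_exists_eq hΩ hnc hK (upperCoord_mem_planarDomain hq) univ_mem
  rw [hKq] at h
  filter_upwards [h] with w hw
  obtain ⟨z, ⟨-, hz⟩, J, hJ, rfl⟩ := hw
  exact ⟨_, (hΩ.slice_mem_iff hJ).2 hz, rfl⟩

end

/-! ### Logarithmic poles, symmetry of the supremum and its regularization. -/

section

/-! ### Logarithmic poles -/

/-- `u - log |q - q₀|` is bounded near `q₀`. -/
def HasLogPole (u : ℍ[ℝ] → EReal) (q₀ : ℍ[ℝ]) : Prop :=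
  ∃ C : ℝ, ∀ᶠ q in 𝓝[≠] q₀, ((Real.log ‖q - q₀‖ - C : ℝ) : EReal) ≤ u q ∧
    u q ≤ ((Real.log ‖q - q₀‖ + C : ℝ) : EReal)

theorem nhdsWithin_diff_singleton {X : Type*} [TopologicalSpace X] {Ω : Set X} (hΩ : IsOpen Ω)
    {q₀ : X} (hq₀ : q₀ ∈ Ω) : 𝓝[Ω \ {q₀}] q₀ = 𝓝[≠] q₀ := by
  rw [Set.sdiff_eq, nhdsWithin_inter_of_mem (mem_nhdsWithin_of_mem_nhds (hΩ.mem_nhds hq₀))]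

/-- Infinite values of `u` give the absolute value ⊤, so a finite limsup excludes them near the
limit and leaves a two-sided real bound. -/
theorem limsup_abs_sub_lt_top_iff {X : Type*} {l : Filter X} {u : X → EReal} {g : X → ℝ} :
    limsup (fun q => (u q - (g q : EReal)).abs) l < ⊤ ↔
      ∃ C : ℝ, ∀ᶠ q in l, ((g q - C : ℝ) : EReal) ≤ u q ∧ u q ≤ ((g q + C : ℝ) : EReal) := by
  constructor
  · intro h
    obtain ⟨B, hB1, hB2⟩ := ENNReal.lt_iff_exists_nnreal_btwn.1 h
    refine ⟨B, ?_⟩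
    filter_upwards [eventually_lt_of_limsup_lt hB1] with q hq
    generalize u q = x at hq
    induction x with
    | bot => rw [EReal.bot_sub, EReal.abs_bot] at hq; exact absurd hq not_top_lt
    | top => rw [EReal.top_sub_coe, EReal.abs_top] at hq; exact absurd hq not_top_lt
    | coe x =>
      rw [← EReal.coe_sub, EReal.abs_def, ENNReal.ofReal_lt_coe_iff (abs_nonneg _), abs_lt] at hq
      rw [EReal.coe_le_coe_iff, EReal.coe_le_coe_iff]
      constructor <;> linarith [hq.1, hq.2]
  · rintro ⟨C, hC⟩
    refine lt_of_le_of_lt (limsup_le_of_le (by isBoundedDefault) ?_)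
      (ENNReal.ofReal_lt_top (r := C))
    filter_upwards [hC] with q hq
    obtain ⟨h1, h2⟩ := hq
    generalize u q = x at h1 h2
    induction x with
    | bot => exact absurd h1 (not_le.2 (EReal.bot_lt_coe _))
    | top => exact absurd h2 (not_le.2 (EReal.coe_lt_top _))
    | coe x =>
      rw [EReal.coe_le_coe_iff] at h1 h2
      rw [← EReal.coe_sub, EReal.abs_def]
      exact ENNReal.ofReal_le_ofReal (abs_le.2 ⟨by linarith, by linarith⟩)

theorem mem_wshPole_iff {Ω : Set ℍ[ℝ]} (hΩ : IsOpen Ω) {q₀ : ℍ[ℝ]} (hq₀ : q₀ ∈ Ω)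
    {u : ℍ[ℝ] → EReal} :
    u ∈ wshPole Ω q₀ ↔ u ∈ wsh Ω ∧ (∀ q ∈ Ω, u q < 0) ∧ HasLogPole u q₀ := by
  change _ ∧ _ ∧ _ ↔ _
  rw [nhdsWithin_diff_singleton hΩ hq₀, limsup_abs_sub_lt_top_iff]
  rfl

/-! ### Axial symmetry of the upper envelope -/

theorem im_eq_zero_or_of_mem_slicePlane {J K : ℍ[ℝ]} (hJ : J ∈ imagUnits) (hK : K ∈ imagUnits)
    {z : ℂ} (h : slice K z ∈ slicePlane J) : z.im = 0 ∨ K = J ∨ K = -J := by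
  obtain ⟨w, hw⟩ := h
  by_cases hz : z.im = 0
  · exact Or.inl hz
  right
  have hre : w.re = z.re := by rw [← re_slice hJ, ← re_slice hK, hw]
  have hn : ‖w‖ ^ 2 = ‖z‖ ^ 2 := by rw [← norm_slice hJ, hw, norm_slice hK]
  rw [Complex.sq_norm, Complex.sq_norm, Complex.normSq_apply, Complex.normSq_apply, hre] at hn
  have him : w.im • J = z.im • K := by
    simp only [slice, hre, Quaternion.coe_mul_eq_smul] at hw
    exact add_left_cancel hw
  have hcase : w.im = z.im ∨ w.im = -z.im := sq_eq_sq_iff_eq_or_eq_neg.1 (by linarith)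
  rcases hcase with h | h
  · left
    rw [h] at him
    exact (smul_right_injective _ hz him).symm
  · right
    rw [h, neg_smul, ← smul_neg] at him
    exact (smul_right_injective _ hz him).symm

variable {Ω : Set ℍ[ℝ]} {q₀ : ℍ[ℝ]}

open Classical in
/-- The function equal to the larger of `u` and the copy of `u` on `L_J` on the slice `L_J'`, and to
`u` elsewhere. -/
def maxOnSlice (J J' : ℍ[ℝ]) (u : ℍ[ℝ] → EReal) (q : ℍ[ℝ]) : EReal :=
  if q ∈ slicePlane J' then max (u q) (u (slice J (sliceCoord J' q))) else u q

theorem le_maxOnSlice (J J' : ℍ[ℝ]) (u : ℍ[ℝ] → EReal) (q : ℍ[ℝ]) : u q ≤ maxOnSlice J J' u q := by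
  unfold maxOnSlice
  split_ifs
  exacts [le_max_left _ _, le_rfl]

theorem slice_sliceCoord_mem (hΩ : IsSymmetricSliceDomain Ω) {J J' : ℍ[ℝ]} (hJ : J ∈ imagUnits)
    (hJ' : J' ∈ imagUnits) {q : ℍ[ℝ]} (hq : q ∈ Ω) (hqJ : q ∈ slicePlane J') :
    slice J (sliceCoord J' q) ∈ Ω := by
  rw [hΩ.slice_mem_iff hJ, ← hΩ.slice_mem_iff hJ', slice_sliceCoord hJ' hqJ]
  exact hq

/-- Only the slice ±J' is affected, and there the new function is a maximum of two subharmonic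
functions. Other slices meet L_J' in real points, where the copied value is the original one.
Raising values on a closed set preserves upper semicontinuity. -/
theorem maxOnSlice_mem_wsh (hΩ : IsSymmetricSliceDomain Ω) {J J' : ℍ[ℝ]} (hJ : J ∈ imagUnits)
    (hJ' : J' ∈ imagUnits) {u : ℍ[ℝ] → EReal} (hu : u ∈ wsh Ω) : maxOnSlice J J' u ∈ wsh Ω := by
  obtain ⟨⟨husc, htop, p, hp, hpb⟩, hsub⟩ := hu
  refine ⟨⟨?_, ?_, p, hp, ?_⟩, ?_⟩
  · intro q hq c hc
    change maxOnSlice J J' u q < c at hc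
    rw [nhdsWithin_eq_nhds.2 (hΩ.isOpen.mem_nhds hq)]
    have husc' : ∀ p ∈ Ω, u p < c → ∀ᶠ p' in 𝓝 p, u p' < c := fun p hp h => by
      have := husc p hp c h
      rwa [nhdsWithin_eq_nhds.2 (hΩ.isOpen.mem_nhds hp)] at this
    have h1 := husc' q hq ((le_maxOnSlice J J' u q).trans_lt hc)
    by_cases hqJ : q ∈ slicePlane J'
    · simp only [maxOnSlice, if_pos hqJ, max_lt_iff] at hc
      have h2 := (((continuous_slice J).comp (continuous_sliceCoord J')).tendsto q).eventually
        (husc' _ (slice_sliceCoord_mem hΩ hJ hJ' hq hqJ) hc.2)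
      filter_upwards [h1, h2] with p hp1 hp2
      unfold maxOnSlice
      split_ifs
      exacts [max_lt hp1 hp2, hp1]
    · filter_upwards [h1, (isClosed_slicePlane hJ').isOpen_compl.mem_nhds hqJ] with p hp1 hp2
      rwa [maxOnSlice, if_neg hp2]
  · intro q hq
    unfold maxOnSlice
    split_ifs with h
    exacts [(max_lt (htop q hq).lt_top
      (htop _ (slice_sliceCoord_mem hΩ hJ hJ' hq h)).lt_top).ne, htop q hq]
  · exact ((bot_lt_iff_ne_bot.2 hpb).trans_le (le_maxOnSlice J J' u p)).ne'
  · intro K hK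
    rw [hΩ.preimage_slice hK]
    have hsub' : ∀ K ∈ imagUnits, IsSubharmonicOn (u ∘ slice K) (planarDomain Ω) := fun K hK => by
      rw [← hΩ.preimage_slice hK]; exact hsub K hK
    by_cases h1 : K = J'
    · subst h1
      refine ((hsub' K hK).sup (hsub' J hJ)).congr fun z _ => ?_
      have : slice K z ∈ slicePlane K := ⟨z, rfl⟩
      simp only [Function.comp_apply, maxOnSlice, if_pos this, sliceCoord_slice hK]
    by_cases h2 : K = -J'
    · subst h2
      refine ((hsub' _ hK).sup (hsub' _ (neg_mem_imagUnits hJ))).congr fun z _ => ?_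
      have : slice (-J') z ∈ slicePlane J' := ⟨_, slice_conj J' z⟩
      simp only [Function.comp_apply, maxOnSlice, if_pos this]
      rw [slice_neg_left J', sliceCoord_slice hJ', slice_neg_left J]
    · refine (hsub' K hK).congr fun z _ => ?_
      simp only [Function.comp_apply, maxOnSlice]
      split_ifs with h
      · have him : z.im = 0 :=
          ((im_eq_zero_or_of_mem_slicePlane hJ' hK h).resolve_right (by tauto))
        have hz : z = (z.re : ℂ) := Complex.ext rfl (by simpa using him)
        rw [hz, slice_ofReal, ← slice_ofReal J', sliceCoord_slice hJ', slice_ofReal, slice_ofReal,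
          max_self]
      · rfl

/-- If q₀ lies off L_J', nothing changes near q₀. If q₀ is real, copying from L_J to L_J' is an
isometry fixing q₀ and respects the pole. For a nonreal q₀ in L_J' the copied values could destroy
the pole, whence the alternative in `h`. -/
theorem maxOnSlice_mem_wshPole (hΩ : IsSymmetricSliceDomain Ω) (hq₀ : q₀ ∈ Ω) {J J' : ℍ[ℝ]}
    (hJ : J ∈ imagUnits) (hJ' : J' ∈ imagUnits) (h : q₀ ∉ slicePlane J' ∨ q₀ = (q₀.re : ℍ[ℝ]))
    {u : ℍ[ℝ] → EReal} (hu : u ∈ wshPole Ω q₀) : maxOnSlice J J' u ∈ wshPole Ω q₀ := by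
  rw [mem_wshPole_iff hΩ.isOpen hq₀] at hu ⊢
  obtain ⟨hwsh, hneg, C, hC⟩ := hu
  refine ⟨maxOnSlice_mem_wsh hΩ hJ hJ' hwsh, fun q hq => ?_, C, ?_⟩
  · unfold maxOnSlice
    split_ifs with h
    exacts [max_lt (hneg q hq) (hneg _ (slice_sliceCoord_mem hΩ hJ hJ' hq h)), hneg q hq]
  · rcases h with h | h
    · filter_upwards [hC, nhdsWithin_le_nhds
        ((isClosed_slicePlane hJ').isOpen_compl.mem_nhds h)] with q hq1 hq2
      rwa [maxOnSlice, if_neg hq2]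
    · have e0 : ∀ K, slice K (q₀.re : ℂ) = q₀ := fun K => by rw [slice_ofReal, ← h]
      have e1 : slice J (sliceCoord J' q₀) = q₀ := by
        rw [← e0 J', sliceCoord_slice hJ', e0, e0]
      have hC' := eventually_nhdsWithin_iff.1 hC
      have ht : Tendsto (fun q => slice J (sliceCoord J' q)) (𝓝 q₀) (𝓝 q₀) :=
        ((continuous_slice J).comp (continuous_sliceCoord J')).tendsto' q₀ q₀ e1
      filter_upwards [hC, nhdsWithin_le_nhds (ht.eventually hC'), self_mem_nhdsWithin]
        with q hq1 hq2 hq3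
      refine ⟨hq1.1.trans (le_maxOnSlice J J' u q), ?_⟩
      unfold maxOnSlice
      split_ifs with hqJ
      · refine max_le hq1.2 ?_
        have e2 : ‖slice J (sliceCoord J' q) - q₀‖ = ‖q - q₀‖ := by
          conv_lhs => rw [← e0 J, norm_slice_sub hJ]
          conv_rhs => rw [← e0 J', ← slice_sliceCoord hJ' hqJ, norm_slice_sub hJ']
        have h3 := (hq2 (by
          intro heq
          rw [Set.mem_singleton_iff] at heq
          rw [heq, sub_self, norm_zero] at e2
          exact hq3 (sub_eq_zero.1 (norm_eq_zero.1 e2.symm)))).2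
        rwa [e2] at h3
      · exact hq1.2

theorem supFamily_slice_le (hΩ : IsSymmetricSliceDomain Ω) (hq₀ : q₀ ∈ Ω) {J J' : ℍ[ℝ]}
    (hJ : J ∈ imagUnits) (hJ' : J' ∈ imagUnits) (h : q₀ ∉ slicePlane J' ∨ q₀ = (q₀.re : ℍ[ℝ]))
    (z : ℂ) :
    supFamily (wshPole Ω q₀) (slice J z) ≤ supFamily (wshPole Ω q₀) (slice J' z) := by
  refine iSup₂_le fun u hu => ?_
  refine le_trans ?_ (le_iSup₂ (f := fun v (_ : v ∈ wshPole Ω q₀) => v (slice J' z))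
    (maxOnSlice J J' u) (maxOnSlice_mem_wshPole hΩ hq₀ hJ hJ' h hu))
  have hm : slice J' z ∈ slicePlane J' := ⟨z, rfl⟩
  simp only [maxOnSlice, if_pos hm, sliceCoord_slice hJ']
  exact le_max_right _ _

/-- Conjugate `K` by 1 + t e for small t ≠ 0, where e does not commute with `K`. -/
theorem exists_imagUnit_near {K : ℍ[ℝ]} (hK : K ∈ imagUnits) {N : Set ℍ[ℝ]} (hN : N ∈ 𝓝 K) :
    ∃ K' ∈ imagUnits, K' ∈ N ∧ K' ≠ K ∧ K' ≠ -K := by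
  have hK0 : K ≠ 0 := by
    rintro rfl
    have := norm_of_mem_imagUnits hK
    rw [norm_zero] at this
    exact zero_ne_one this
  have hKK : K ≠ -K := fun h => hK0 (by
    have h2 : (2 : ℝ) • K = 0 := by rw [two_smul]; nth_rewrite 1 [h]; exact neg_add_cancel K
    exact (smul_eq_zero.1 h2).resolve_left two_ne_zero)
  obtain ⟨e, he⟩ : ∃ e : ℍ[ℝ], e * K ≠ K * e := by
    by_contra! hcon
    obtain ⟨i, i0, i1, i2, i3⟩ : ∃ i : ℍ[ℝ], i.re = 0 ∧ i.imI = 1 ∧ i.imJ = 0 ∧ i.imK = 0 :=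
      ⟨(⟨0, 1, 0, 0⟩ : ℍ[ℝ]), rfl, rfl, rfl, rfl⟩
    obtain ⟨j, j0, j1, j2, j3⟩ : ∃ j : ℍ[ℝ], j.re = 0 ∧ j.imI = 0 ∧ j.imJ = 1 ∧ j.imK = 0 :=
      ⟨(⟨0, 0, 1, 0⟩ : ℍ[ℝ]), rfl, rfl, rfl, rfl⟩
    have a1 := congrArg QuaternionAlgebra.imJ (hcon i)
    have a2 := congrArg QuaternionAlgebra.imK (hcon i)
    have a3 := congrArg QuaternionAlgebra.imK (hcon j)
    simp only [Quaternion.imJ_mul, Quaternion.imK_mul, i0, i1, i2, i3, j0, j1, j2, j3]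
      at a1 a2 a3
    have b1 : K.imK = 0 := by linarith
    have b2 : K.imJ = 0 := by linarith
    have b3 : K.imI = 0 := by linarith
    have := (mem_imagUnits_iff.1 hK).2
    rw [b1, b2, b3] at this
    norm_num at this
  set P : ℝ → ℍ[ℝ] := fun t => 1 + t • e with hP
  have hPc : Continuous P := by fun_prop
  have hP0 : P 0 = 1 := by simp [hP]
  have hinv : ContinuousAt (fun t => (P t)⁻¹) 0 :=
    hPc.continuousAt.inv₀ (by rw [hP0]; exact one_ne_zero)
  have ht : Tendsto (fun t => P t * K * (P t)⁻¹) (𝓝 0) (𝓝 K) := by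
    have h1 : ContinuousAt (fun t => P t * K * (P t)⁻¹) 0 :=
      (hPc.continuousAt.mul continuousAt_const).mul hinv
    have h2 : P 0 * K * (P 0)⁻¹ = K := by rw [hP0]; simp
    rw [ContinuousAt, h2] at h1
    exact h1
  have hne : ∀ᶠ t in 𝓝 (0 : ℝ), P t ≠ 0 :=
    hPc.continuousAt.eventually_ne (by rw [hP0]; exact one_ne_zero)
  have hev : ∀ᶠ t in 𝓝[≠] (0 : ℝ), (P t * K * (P t)⁻¹ ∈ N ∧ P t * K * (P t)⁻¹ ≠ -K) ∧ P t ≠ 0 :=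
    nhdsWithin_le_nhds (((ht.eventually hN).and (ht.eventually_ne hKK)).and hne)
  obtain ⟨t, ⟨⟨ht1, ht2⟩, ht3⟩, ht0⟩ := (hev.and self_mem_nhdsWithin).exists
  refine ⟨P t * K * (P t)⁻¹, ?_, ht1, fun h => he ?_, ht2⟩
  · change P t * K * (P t)⁻¹ * (P t * K * (P t)⁻¹) = -1
    have : P t * K * (P t)⁻¹ * (P t * K * (P t)⁻¹) = P t * (K * ((P t)⁻¹ * P t) * K) * (P t)⁻¹ := by
      simp only [mul_assoc]
    rw [this, inv_mul_cancel₀ ht3, mul_one, show K * K = -1 from hK, mul_neg, mul_one, neg_mul,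
      mul_inv_cancel₀ ht3]
  · have h1 : P t * K = K * P t := by
      rw [mul_inv_eq_iff_eq_mul₀ ht3] at h; exact h
    simp only [hP, add_mul, mul_add, one_mul, mul_one, smul_mul_assoc, mul_smul_comm] at h1
    exact smul_right_injective _ ht0 (add_left_cancel h1)

theorem exists_imagUnit_near_of_not_mem (q₀ : ℍ[ℝ]) {K : ℍ[ℝ]} (hK : K ∈ imagUnits) {N : Set ℍ[ℝ]}
    (hN : N ∈ 𝓝 K) :
    ∃ K' ∈ imagUnits, K' ∈ N ∧ (q₀ ∉ slicePlane K' ∨ q₀ = (q₀.re : ℍ[ℝ])) := by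
  by_cases hq : q₀ ∈ slicePlane K
  · obtain ⟨K', hK', hN', h1, h2⟩ := exists_imagUnit_near hK hN
    refine ⟨K', hK', hN', ?_⟩
    by_contra! hcon
    obtain ⟨z, hz⟩ := hq
    rw [← hz] at hcon
    rcases im_eq_zero_or_of_mem_slicePlane hK' hK hcon.1 with h | h | h
    · refine hcon.2 ?_
      rw [re_slice hK, ← slice_ofReal K]
      congr 1
      exact Complex.ext rfl (by simpa using h)
    · exact h1 h.symm
    · exact h2 (by rw [h, neg_neg])
  · exact ⟨K, hK, mem_of_mem_nhds hN, Or.inl hq⟩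

/-- Comparison of the regularized envelopes under a nonconstant regular map. -/
theorem uscReg_supFamily_le {f : ℍ[ℝ] → ℍ[ℝ]} (hf : IsSliceRegularOn f Ω)
    (hΩ : IsSymmetricSliceDomain Ω) (hnc : ∃ p ∈ Ω, ∃ q ∈ Ω, f p ≠ f q) (hq₀ : q₀ ∈ Ω)
    {S : Set (ℍ[ℝ] → EReal)}
    (hle : ∀ q ∈ Ω, supFamily S (f q) ≤ supFamily (wshPole Ω q₀) q) {q : ℍ[ℝ]} (hq : q ∈ Ω) :
    uscReg (f '' Ω) (supFamily S) (f q) ≤ uscReg Ω (supFamily (wshPole Ω q₀)) q := by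
  refine le_of_forall_gt fun c hc => ?_
  obtain ⟨c', hc1, hc2⟩ := exists_between hc
  obtain ⟨K, hK, hKq⟩ := exists_slice_upperCoord q
  set z₁ := upperCoord q with hz₁
  have hz₁D : z₁ ∈ planarDomain Ω := upperCoord_mem_planarDomain hq
  have hev : ∀ᶠ p in 𝓝 q, supFamily (wshPole Ω q₀) p < c' := by
    have := eventually_lt_of_limsup_lt hc1
    rwa [nhdsWithin_eq_nhds.2 (hΩ.isOpen.mem_nhds hq)] at this
  rw [← hKq] at hev
  have hev2 : ∀ᶠ y in 𝓝 (K, z₁), supFamily (wshPole Ω q₀) (slice y.1 y.2) < c' :=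
    (continuous_slice_uncurry.tendsto (K, z₁)).eventually hev
  rw [nhds_prod_eq] at hev2
  -- The bound near q splits into a neighbourhood of the unit K and one of z₁. A unit K' near K that
  -- is admissible for `supFamily_slice_le` then dominates every J at once.
  obtain ⟨pa, hpa, pb, hpb, hab⟩ := eventually_prod_iff.1 hev2
  obtain ⟨K', hK', hK'N, hK'q⟩ := exists_imagUnit_near_of_not_mem q₀ hK hpa
  have hopen := hf.eventually_exists_eq hΩ hnc hK hz₁D hpb
  rw [hKq] at hopen
  refine lt_of_le_of_lt (limsup_le_of_le (by isBoundedDefault) ?_) hc2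
  filter_upwards [nhdsWithin_le_nhds hopen] with w hw
  obtain ⟨z, ⟨hzZ, hzD⟩, J, hJ, rfl⟩ := hw
  exact (hle _ ((hΩ.slice_mem_iff hJ).2 hzD)).trans
    ((supFamily_slice_le hΩ hq₀ hJ hK' hK'q z).trans (hab hK'N hzZ).le)

end

/-! ### Gluing a logarithm into a function on the slices. -/

section

/-! ### Local models of a logarithmic pole -/

variable {Ω : Set ℍ[ℝ]} {q₀ : ℍ[ℝ]}

theorem IsSubharmonicOn.mono {u : ℂ → EReal} {U V : Set ℂ} (hu : IsSubharmonicOn u U)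
    (h : V ⊆ U) : IsSubharmonicOn u V where
  usc := hu.usc.mono h
  ne_top z hz := hu.ne_top z (h hz)
  submean a r hr hball := hu.submean a r hr (hball.trans h)

/-- The function `log (c |q - q₀|)`, equal to `-∞` at `q₀`. -/
def poleLog (c : ℝ) (q₀ q : ℍ[ℝ]) : EReal := ENNReal.log (ENNReal.ofReal (c * ‖q - q₀‖))

theorem continuous_poleLog (c : ℝ) (q₀ : ℍ[ℝ]) : Continuous (poleLog c q₀) :=
  ENNReal.continuous_log.comp (ENNReal.continuous_ofReal.comp (by fun_prop))

theorem poleLog_ne_top (c : ℝ) (q₀ q : ℍ[ℝ]) : poleLog c q₀ q ≠ ⊤ := by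
  rw [poleLog, Ne, ENNReal.log_eq_top_iff]
  exact ENNReal.ofReal_ne_top

theorem poleLog_of_ne {c : ℝ} (hc : 0 < c) {q₀ q : ℍ[ℝ]} (h : q ≠ q₀) :
    poleLog c q₀ q = ((Real.log c + Real.log ‖q - q₀‖ : ℝ) : EReal) := by
  have h1 : 0 < ‖q - q₀‖ := norm_pos_iff.2 (sub_ne_zero.2 h)
  rw [poleLog, ENNReal.log_ofReal_of_pos (by positivity), Real.log_mul hc.ne' h1.ne']

/-- Pythagoras: slice J (sliceCoord J q) is the orthogonal projection of q to L_J. -/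
theorem norm_slice_sub_sq {J : ℍ[ℝ]} (hJ : J ∈ imagUnits) (q : ℍ[ℝ]) (z : ℂ) :
    ‖slice J z - q‖ ^ 2 = ‖z - sliceCoord J q‖ ^ 2 + ‖slice J (sliceCoord J q) - q‖ ^ 2 := by
  have hJ' := mem_imagUnits_iff.1 hJ
  rw [norm_sq_quaternion, norm_sq_quaternion, Complex.sq_norm, Complex.normSq_apply]
  simp only [Quaternion.re_sub, Quaternion.imI_sub, Quaternion.imJ_sub, Quaternion.imK_sub,
    re_slice hJ, imI_slice, imJ_slice, imK_slice, Complex.sub_re, Complex.sub_im]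
  simp only [sliceCoord, Quaternion.re_mul, hJ'.1]
  set m := J.imI * q.imI + J.imJ * q.imJ + J.imK * q.imK
  have hm : -(0 * q.re - J.imI * q.imI - J.imJ * q.imJ - J.imK * q.imK) = m := by ring
  rw [hm]
  linear_combination (z.im ^ 2 - m ^ 2) * hJ'.2

/-- At z₁ with slice J z₁ ≠ q₀ there is a harmonic minorant touching from below: by Cauchy-Schwarz
the affine function A satisfies |A(z)| ≤ |slice J z - q₀| s, with equality at z₁, and log|A| is
harmonic near z₁. -/
theorem isSubharmonicOn_poleLog {c : ℝ} (hc : 0 < c) {J : ℍ[ℝ]} (hJ : J ∈ imagUnits)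
    (q₀ : ℍ[ℝ]) {U : Set ℂ} (hU : IsOpen U) : IsSubharmonicOn (poleLog c q₀ ∘ slice J) U := by
  refine isSubharmonicOn_of_local hU
    ((continuous_poleLog c q₀).comp (continuous_slice J)).continuousOn.upperSemicontinuousOn
    (fun z _ => poleLog_ne_top _ _ _) fun z₁ _ => ?_
  by_cases h0 : slice J z₁ = q₀
  · refine Eventually.of_forall fun ρ => ?_
    have : (poleLog c q₀ ∘ slice J) z₁ = ⊥ := by simp [poleLog, h0]
    rw [this]; exact bot_le
  set ζ := sliceCoord J q₀ with hζ
  set p := ‖slice J ζ - q₀‖ with hp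
  set s := ‖slice J z₁ - q₀‖ with hs
  have hs0 : 0 < s := norm_pos_iff.2 (sub_ne_zero.2 h0)
  have hs2 : s ^ 2 = ‖z₁ - ζ‖ ^ 2 + p ^ 2 := norm_slice_sub_sq hJ q₀ z₁
  set A : ℂ → ℂ := fun z => (z - ζ) * starRingEnd ℂ (z₁ - ζ) + ((p ^ 2 : ℝ) : ℂ) with hA
  have hAd : Differentiable ℂ A := by simp only [hA]; fun_prop
  have hA1 : ‖A z₁‖ = s ^ 2 := by
    have : A z₁ = ((s ^ 2 : ℝ) : ℂ) := by
      simp only [hA]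
      rw [Complex.mul_conj, ← Complex.ofReal_add, hs2, Complex.sq_norm]
    rw [this, Complex.norm_real, Real.norm_of_nonneg (by positivity)]
  have hAle : ∀ z, ‖A z‖ ≤ ‖slice J z - q₀‖ * s := by
    intro z
    have h1 : ‖A z‖ ≤ ‖z - ζ‖ * ‖z₁ - ζ‖ + p ^ 2 := by
      refine (norm_add_le _ _).trans ?_
      rw [norm_mul, RCLike.norm_conj, Complex.norm_real, Real.norm_of_nonneg (by positivity)]
    have h2 := norm_slice_sub_sq hJ q₀ z
    refine h1.trans (abs_le_of_sq_le_sq' ?_ (by positivity)).2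
    rw [mul_pow, h2, hs2]
    nlinarith [mul_nonneg (sq_nonneg p) (sq_nonneg (‖z - ζ‖ - ‖z₁ - ζ‖))]
  have hA0 : A z₁ ≠ 0 := norm_pos_iff.1 (by rw [hA1]; positivity)
  obtain ⟨ρ₀, hρ₀, hball⟩ := Metric.eventually_nhds_iff_ball.1
    (hAd.continuous.continuousAt.eventually_ne hA0)
  filter_upwards [Ioo_mem_nhdsGT hρ₀] with ρ hρ
  have hcb : ∀ z ∈ Metric.closedBall z₁ ρ, A z ≠ 0 := fun z hz =>
    hball z (Metric.closedBall_subset_ball hρ.2 hz)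
  have hlogc : ContinuousOn (fun z => Real.log ‖A z‖) (Metric.sphere z₁ ρ) :=
    ContinuousOn.log hAd.continuous.norm.continuousOn fun z hz =>
      (norm_pos_iff.2 (hcb z (Metric.sphere_subset_closedBall hz))).ne'
  have hav := AnalyticOnNhd.circleAverage_log_norm_of_ne_zero (R := ρ) (c := z₁) (g := A)
    (fun z _ => hAd.analyticAt z) (by rw [abs_of_pos hρ.1]; exact hcb)
  have hpt : ∀ z ∈ Metric.sphere z₁ ρ,
      (((Real.log c - Real.log s) + Real.log ‖A z‖ : ℝ) : EReal) ≤ (poleLog c q₀ ∘ slice J) z := by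
    intro z hz
    have h1 : 0 < ‖A z‖ := norm_pos_iff.2 (hcb z (Metric.sphere_subset_closedBall hz))
    have h2 : 0 < ‖slice J z - q₀‖ := by
      have := h1.trans_le (hAle z)
      exact pos_of_mul_pos_left this hs0.le
    rw [Function.comp_apply, poleLog_of_ne hc (sub_ne_zero.1 (norm_pos_iff.1 h2)),
      EReal.coe_le_coe_iff]
    have h3 := Real.log_le_log h1 (hAle z)
    rw [Real.log_mul h2.ne' hs0.ne'] at h3
    linarith
  refine le_trans ?_ (circleMean_mono hρ.1.le hpt)
  rw [circleMean_coe (g := fun z => (Real.log c - Real.log s) + Real.log ‖A z‖)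
    ((circleIntegrable_const _ _ _).add (hlogc.circleIntegrable hρ.1.le)),
    Real.circleAverage_fun_add (circleIntegrable_const _ _ _) (hlogc.circleIntegrable hρ.1.le),
    Real.circleAverage_const, hav, hA1, Function.comp_apply, poleLog_of_ne hc h0,
    EReal.coe_le_coe_iff, Real.log_pow]
  simp only [← hs]
  push_cast
  linarith

/-- The larger of `h` and `l` on the closed disc of radius `δ` about `z₀`, and `h` outside. -/
def diskMax (h : ℂ → EReal) (z₀ : ℂ) (δ : ℝ) (l : EReal) (z : ℂ) : EReal :=
  if ‖z - z₀‖ ≤ δ then max (h z) l else h z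

theorem le_diskMax (h : ℂ → EReal) (z₀ : ℂ) (δ : ℝ) (l : EReal) (z : ℂ) :
    h z ≤ diskMax h z₀ δ l z := by
  unfold diskMax
  split_ifs
  exacts [le_max_left _ _, le_rfl]

theorem diskMax_le (h : ℂ → EReal) (z₀ : ℂ) (δ : ℝ) (l : EReal) (z : ℂ) :
    diskMax h z₀ δ l z ≤ max (h z) l := by
  unfold diskMax
  split_ifs
  exacts [le_rfl, le_max_left _ _]

/-- On |z - z₀| < δ the function is max(h, l), and on |z - z₀| > δ/2 it is h; these open sets cover
`U`. -/
theorem isSubharmonicOn_diskMax {U : Set ℂ} (hU : IsOpen U) {h l : ℂ → EReal}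
    (hh : IsSubharmonicOn h U) (hl : IsSubharmonicOn l U) {z₀ : ℂ} {δ : ℝ} (hδ : 0 < δ)
    (hle : ∀ z ∈ U, δ / 2 ≤ ‖z - z₀‖ → ‖z - z₀‖ ≤ δ → l z ≤ h z) :
    IsSubharmonicOn (fun z => diskMax h z₀ δ (l z) z) U := by
  have hc : Continuous fun z : ℂ => ‖z - z₀‖ := by fun_prop
  set U₁ := U ∩ {z | ‖z - z₀‖ < δ} with hU₁
  set U₂ := U ∩ {z | δ / 2 < ‖z - z₀‖} with hU₂
  have hun : U = U₁ ∪ U₂ := by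
    ext z
    simp only [hU₁, hU₂, Set.mem_union, Set.mem_inter_iff, Set.mem_ofPred_eq, ← and_or_left,
      iff_self_and]
    intro _
    by_contra! hcon
    linarith
  have h1 : IsSubharmonicOn (fun z => diskMax h z₀ δ (l z) z) U₁ := by
    refine ((hh.sup hl).mono Set.inter_subset_left).congr fun z hz => ?_
    have hz2 : ‖z - z₀‖ < δ := hz.2
    simp only [diskMax, if_pos hz2.le]
  have h2 : IsSubharmonicOn (fun z => diskMax h z₀ δ (l z) z) U₂ := by
    refine (hh.mono Set.inter_subset_left).congr fun z hz => ?_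
    have hz2 : δ / 2 < ‖z - z₀‖ := hz.2
    simp only [diskMax]
    split_ifs with hz'
    · exact (max_eq_left (hle z hz.1 hz2.le hz')).symm
    · rfl
  rw [hun]
  exact isSubharmonicOn_union (hU.inter (isOpen_lt hc continuous_const))
    (hU.inter (isOpen_lt continuous_const hc)) h1 h2

/-- The function on the quaternions built from a function `h` on the slice `L_I` and a function `l`
on the quaternions: on the half of a slice `L_J` on the side of `I` it is `h`, increased to the
maximum with `l` near `z₀`. -/
def hemisphereMax (I : ℍ[ℝ]) (h : ℂ → EReal) (z₀ : ℂ) (δ : ℝ) (l : ℍ[ℝ] → EReal) (q : ℍ[ℝ]) :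
    EReal :=
  max (if 0 ≤ (sliceCoord I q).im then diskMax h z₀ δ (l q) (upperCoord q) else ⊥)
    (if (sliceCoord I q).im ≤ 0 then diskMax h z₀ δ (l q) (starRingEnd ℂ (upperCoord q)) else ⊥)

theorem eventually_diskMax_lt {h : ℂ → EReal} {D : Set ℂ} (hD : IsOpen D)
    (hh : UpperSemicontinuousOn h D) {z₀ : ℂ} {δ : ℝ} {l : ℍ[ℝ] → EReal} (hl : Continuous l)
    {g : ℍ[ℝ] → ℂ} (hg : Continuous g) {q : ℍ[ℝ]} (hq : g q ∈ D) {c : EReal}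
    (hlt : diskMax h z₀ δ (l q) (g q) < c) : ∀ᶠ p in 𝓝 q, diskMax h z₀ δ (l p) (g p) < c := by
  have h1 : ∀ᶠ p in 𝓝 q, h (g p) < c := by
    have := hh (g q) hq c ((le_diskMax h z₀ δ (l q) (g q)).trans_lt hlt)
    rw [nhdsWithin_eq_nhds.2 (hD.mem_nhds hq)] at this
    exact (hg.tendsto q).eventually this
  by_cases hd : ‖g q - z₀‖ ≤ δ
  · rw [diskMax, if_pos hd, max_lt_iff] at hlt
    filter_upwards [h1, (hl.tendsto q).eventually_lt_const hlt.2] with p hp1 hp2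
    exact (diskMax_le _ _ _ _ _).trans_lt (max_lt hp1 hp2)
  · have h2 : Continuous fun p => ‖g p - z₀‖ := by fun_prop
    filter_upwards [h1, (h2.tendsto q).eventually_const_lt (not_le.1 hd)] with p hp1 hp2
    rwa [diskMax, if_neg (not_le.2 hp2)]

/-- On the interface between the two hemispheres both branches enter the maximum, so limits from
either side are dominated. -/
theorem upperSemicontinuousOn_hemisphereMax (hΩ : IsSymmetricSliceDomain Ω) (I : ℍ[ℝ])
    {h : ℂ → EReal} (hh : UpperSemicontinuousOn h (planarDomain Ω)) (z₀ : ℂ) (δ : ℝ)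
    {l : ℍ[ℝ] → EReal} (hl : Continuous l) :
    UpperSemicontinuousOn (hemisphereMax I h z₀ δ l) Ω := by
  intro q hq c hc
  change hemisphereMax I h z₀ δ l q < c at hc
  rw [hemisphereMax, max_lt_iff] at hc
  have hκ : Continuous fun p => (sliceCoord I p).im :=
    Complex.continuous_im.comp (continuous_sliceCoord I)
  have hz := upperCoord_mem_planarDomain hq
  have hD := hΩ.isOpen_planarDomain
  have hc0 : ⊥ < c := lt_of_le_of_lt bot_le hc.1
  have h1 : ∀ᶠ p in 𝓝 q, (if 0 ≤ (sliceCoord I p).im then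
      diskMax h z₀ δ (l p) (upperCoord p) else ⊥) < c := by
    by_cases hs : 0 ≤ (sliceCoord I q).im
    · rw [if_pos hs] at hc
      filter_upwards [eventually_diskMax_lt hD hh hl continuous_upperCoord hz hc.1] with p hp
      split_ifs
      exacts [hp, hc0]
    · filter_upwards [(hκ.tendsto q).eventually_lt_const (not_le.1 hs)] with p hp
      rwa [if_neg (not_le.2 hp)]
  have h2 : ∀ᶠ p in 𝓝 q, (if (sliceCoord I p).im ≤ 0 then
      diskMax h z₀ δ (l p) (starRingEnd ℂ (upperCoord p)) else ⊥) < c := by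
    by_cases hs : (sliceCoord I q).im ≤ 0
    · rw [if_pos hs] at hc
      filter_upwards [eventually_diskMax_lt hD hh hl
        (Complex.continuous_conj.comp continuous_upperCoord) (conj_mem_planarDomain hz) hc.2] with p hp
      split_ifs
      exacts [hp, hc0]
    · filter_upwards [(hκ.tendsto q).eventually_const_lt (not_le.1 hs)] with p hp
      rwa [if_neg (not_le.2 hp)]
  filter_upwards [nhdsWithin_le_nhds h1, nhdsWithin_le_nhds h2] with p hp1 hp2
  exact max_lt hp1 hp2

theorem im_sliceCoord_slice {I : ℍ[ℝ]} (hI : I ∈ imagUnits) (J : ℍ[ℝ]) (z : ℂ) :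
    (sliceCoord I (slice J z)).im = z.im * (sliceCoord I J).im := by
  simp only [sliceCoord, Quaternion.re_mul, imI_slice, imJ_slice, imK_slice,
    (mem_imagUnits_iff.1 hI).1]
  ring

/-- On L_J the sign of the I-component of J selects the orientation in which h is copied, the same
along the entire slice, so no gluing across the real axis is needed. When J is orthogonal to I both
orientations appear and their maximum is taken. -/
theorem isSubharmonicOn_hemisphereMax (hΩ : IsSymmetricSliceDomain Ω) {I : ℍ[ℝ]}
    (hI : I ∈ imagUnits) {h : ℂ → EReal} (hh : IsSubharmonicOn h (planarDomain Ω))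
    (hh' : IsSubharmonicOn (fun z => h (starRingEnd ℂ z)) (planarDomain Ω)) {z₀ : ℂ} {δ : ℝ}
    (hδ : 0 < δ) {l : ℍ[ℝ] → EReal}
    (hl : ∀ J ∈ imagUnits, IsSubharmonicOn (l ∘ slice J) (planarDomain Ω))
    (hle : ∀ J ∈ imagUnits, ∀ z ∈ planarDomain Ω, δ / 2 ≤ ‖z - z₀‖ → ‖z - z₀‖ ≤ δ →
      l (slice J z) ≤ h z) {J : ℍ[ℝ]} (hJ : J ∈ imagUnits) :
    IsSubharmonicOn (hemisphereMax I h z₀ δ l ∘ slice J) (planarDomain Ω) := by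
  have hD := hΩ.isOpen_planarDomain
  have hnc : ∀ z : ℂ, ‖starRingEnd ℂ z - z₀‖ = ‖z - starRingEnd ℂ z₀‖ := fun z => by
    rw [← RCLike.norm_conj, map_sub, Complex.conj_conj]
  have s1 : IsSubharmonicOn (fun z => diskMax h z₀ δ (l (slice J z)) z) (planarDomain Ω) :=
    isSubharmonicOn_diskMax hD hh (hl J hJ) hδ (hle J hJ)
  have s2 : IsSubharmonicOn (fun z => diskMax h z₀ δ (l (slice J z)) (starRingEnd ℂ z))
      (planarDomain Ω) := by
    refine (isSubharmonicOn_diskMax hD hh' (hl J hJ) (z₀ := starRingEnd ℂ z₀) hδ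
      fun z hz h1 h2 => ?_).congr fun z _ => ?_
    · rw [← hnc] at h1 h2
      have := hle (-J) (neg_mem_imagUnits hJ) _ (conj_mem_planarDomain hz) h1 h2
      rwa [slice_neg_left, Complex.conj_conj] at this
    · simp only [diskMax, hnc, Function.comp_apply]
  have hup : ∀ z : ℂ, 0 ≤ z.im → upperCoord (slice J z) = z := fun z hz =>
    upperCoord_slice_of_nonneg hJ hz
  have hdn : ∀ z : ℂ, z.im ≤ 0 → upperCoord (slice J z) = starRingEnd ℂ z := fun z hz =>
    upperCoord_slice_of_nonpos hJ hz
  rcases lt_trichotomy (sliceCoord I J).im 0 with hκ | hκ | hκ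
  · refine s2.congr fun z _ => ?_
    simp only [Function.comp_apply, hemisphereMax, im_sliceCoord_slice hI]
    rcases lt_trichotomy z.im 0 with hz | hz | hz
    · rw [if_pos (mul_pos_of_neg_of_neg hz hκ).le,
        if_neg (not_le.2 (mul_pos_of_neg_of_neg hz hκ)), hdn z hz.le, max_bot_right]
    · rw [hz, zero_mul, if_pos le_rfl, if_pos le_rfl, hup z hz.ge, Complex.conj_eq_iff_im.2 hz,
        max_self]
    · rw [if_neg (not_le.2 (mul_neg_of_pos_of_neg hz hκ)),
        if_pos (mul_neg_of_pos_of_neg hz hκ).le, hup z hz.le, max_bot_left]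
  · refine (s1.sup s2).congr fun z _ => ?_
    simp only [Function.comp_apply, hemisphereMax, im_sliceCoord_slice hI, hκ, mul_zero, le_refl,
      if_true]
    rcases le_total 0 z.im with hz | hz
    · rw [hup z hz]
    · rw [hdn z hz, Complex.conj_conj, max_comm]
  · refine s1.congr fun z _ => ?_
    simp only [Function.comp_apply, hemisphereMax, im_sliceCoord_slice hI]
    rcases lt_trichotomy z.im 0 with hz | hz | hz
    · rw [if_neg (not_le.2 (mul_neg_of_neg_of_pos hz hκ)),
        if_pos (mul_neg_of_neg_of_pos hz hκ).le, hdn z hz.le, Complex.conj_conj, max_bot_left]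
    · rw [hz, zero_mul, if_pos le_rfl, if_pos le_rfl, hup z hz.ge, Complex.conj_eq_iff_im.2 hz,
        max_self]
    · rw [if_pos (mul_pos hz hκ).le, if_neg (not_le.2 (mul_pos hz hκ)), hup z hz.le,
        max_bot_right]

/-- The submean inequality on circles of radius ρ about q₀ bounds the value by log ρ + C, with ρ
tending to 0. -/
theorem eq_bot_of_hasLogPole (hΩ : IsOpen Ω) {v : ℍ[ℝ] → EReal} (hv : v ∈ wsh Ω) (hq₀ : q₀ ∈ Ω)
    (hpole : HasLogPole v q₀) : v q₀ = ⊥ := by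
  obtain ⟨K, hK, hKq⟩ := exists_slice_upperCoord q₀
  set ζ := upperCoord q₀
  obtain ⟨C, hC⟩ := hpole
  have hζ : ζ ∈ slice K ⁻¹' Ω := by rw [Set.mem_preimage, hKq]; exact hq₀
  have hsub := (hv.2 K hK).eventually_le_circleMean (hΩ.preimage (continuous_slice K)) hζ
  obtain ⟨ρ₀, hρ₀, hball⟩ := Metric.eventually_nhds_iff_ball.1 (eventually_nhdsWithin_iff.1 hC)
  have hle : ∀ᶠ ρ in 𝓝[>] (0 : ℝ), v q₀ ≤ ((Real.log ρ + C : ℝ) : EReal) := by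
    filter_upwards [hsub, Ioo_mem_nhdsGT hρ₀] with ρ h1 h2
    rw [Function.comp_apply, hKq] at h1
    refine h1.trans ((circleMean_mono h2.1.le (v := fun _ => ((Real.log ρ + C : ℝ) : EReal))
      fun z hz => ?_).trans ?_)
    · have h3 : ‖slice K z - q₀‖ = ρ := by
        rw [← hKq, norm_slice_sub hK, ← dist_eq_norm]; exact hz
      have h4 := (hball (slice K z) (by rw [mem_ball_iff_norm, h3]; exact h2.2) (by
        intro h
        rw [Set.mem_singleton_iff] at h
        rw [h, sub_self, norm_zero] at h3
        exact h2.1.ne h3)).2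
      rwa [h3] at h4
    · rw [circleMean_coe (g := fun _ => Real.log ρ + C) (circleIntegrable_const _ _ _),
        Real.circleAverage_const]
  by_contra hne
  obtain ⟨s, -, hs⟩ := EReal.lt_iff_exists_real_btwn.1 (bot_lt_iff_ne_bot.2 hne)
  have hlim : ∀ᶠ ρ in 𝓝[>] (0 : ℝ), Real.log ρ ≤ s - C :=
    Real.tendsto_log_nhdsGT_zero.eventually_le_atBot (s - C)
  obtain ⟨ρ, h1, h2⟩ := (hle.and hlim).exists
  have h3 := hs.trans_le h1
  rw [EReal.coe_lt_coe_iff] at h3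
  linarith

end

/-! ### Restoring the pole of a pulled back competitor. -/

section

/-! ### Majorants with a logarithmic pole -/

variable {Ω : Set ℍ[ℝ]} {q₀ : ℍ[ℝ]} {f : ℍ[ℝ] → ℍ[ℝ]}

theorem poleLog_le {c t : ℝ} {q₀ q : ℍ[ℝ]} (h : c * ‖q - q₀‖ ≤ Real.exp t) :
    poleLog c q₀ q ≤ (t : EReal) := by
  have h1 : ENNReal.log (ENNReal.ofReal (Real.exp t)) = (t : EReal) := by
    rw [ENNReal.log_ofReal_of_pos (Real.exp_pos t), Real.log_exp]
  rw [← h1, poleLog]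
  exact ENNReal.log_monotone (ENNReal.ofReal_le_ofReal h)

theorem hemisphereMax_lt {I : ℍ[ℝ]} {h : ℂ → EReal} {z₀ : ℂ} {δ : ℝ} {l : ℍ[ℝ] → EReal}
    {q : ℍ[ℝ]} {c : EReal} (hc : ⊥ < c)
    (h1 : 0 ≤ (sliceCoord I q).im → diskMax h z₀ δ (l q) (upperCoord q) < c)
    (h2 : (sliceCoord I q).im ≤ 0 → diskMax h z₀ δ (l q) (starRingEnd ℂ (upperCoord q)) < c) :
    hemisphereMax I h z₀ δ l q < c := by
  refine max_lt ?_ ?_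
  · split_ifs with h
    exacts [h1 h, hc]
  · split_ifs with h
    exacts [h2 h, hc]

/-- This upper half of the pole estimate survives the pullback because f(p) - f(q₀) = O(|p - q₀|).
At points p with f(p) = f(q₀) it needs the value ⊥ of `v` at the pole. -/
theorem exists_comp_le_log (hf : IsSliceRegularOn f Ω) (hΩ : IsSymmetricSliceDomain Ω)
    (hq₀ : q₀ ∈ Ω) {v : ℍ[ℝ] → EReal} (hpole : HasLogPole v (f q₀)) (hbot : v (f q₀) = ⊥) :
    ∃ C : ℝ, ∃ η > 0, ∀ p, ‖p - q₀‖ < η → ∀ r, 0 < r → ‖p - q₀‖ ≤ r →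
      v (f p) ≤ ((Real.log r + C : ℝ) : EReal) := by
  obtain ⟨M, hM, hO⟩ := (hf.isBigO_sub hΩ hq₀).exists_pos
  obtain ⟨C, hC⟩ := hpole
  have h1 := (hf.continuousAt hΩ hq₀).eventually (eventually_nhdsWithin_iff.1 hC)
  obtain ⟨η, hη, hball⟩ := Metric.eventually_nhds_iff_ball.1 (h1.and hO.bound)
  refine ⟨Real.log M + C, η, hη, fun p hp r hr hpr => ?_⟩
  obtain ⟨h2, h3⟩ := hball p (mem_ball_iff_norm.2 hp)
  by_cases hpf : f p = f q₀
  · rw [hpf, hbot]; exact bot_le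
  refine (h2 hpf).2.trans (EReal.coe_le_coe_iff.2 ?_)
  have h4 : 0 < ‖f p - f q₀‖ := norm_pos_iff.2 (sub_ne_zero.2 hpf)
  have h5 := Real.log_le_log h4 (h3.trans (mul_le_mul_of_nonneg_left hpr hM.le))
  rw [Real.log_mul hM.ne' hr.ne'] at h5
  linarith

/-- A competitor on `f(Ω)` whose pullback is subharmonic on every slice is dominated, after pulling
back, by a competitor on `Ω`. -/
theorem exists_wshPole_ge (hf : IsSliceRegularOn f Ω) (hΩ : IsSymmetricSliceDomain Ω)
    (hnc : ∃ p ∈ Ω, ∃ q ∈ Ω, f p ≠ f q) (hq₀ : q₀ ∈ Ω) {v : ℍ[ℝ] → EReal}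
    (hv : v ∈ wshPole (f '' Ω) (f q₀))
    (hvf : ∀ I ∈ imagUnits, IsSubharmonicOn (fun z => v (f (slice I z))) (planarDomain Ω)) :
    ∃ u ∈ wshPole Ω q₀, ∀ q ∈ Ω, v (f q) ≤ u q := by
  have hfo := hf.isOpen_image hΩ hnc
  obtain ⟨hwsh, hneg, hpole⟩ := (mem_wshPole_iff hfo (Set.mem_image_of_mem f hq₀)).1 hv
  have hbot := eq_bot_of_hasLogPole hfo hwsh (Set.mem_image_of_mem f hq₀) hpole
  obtain ⟨C₁, η, hη, hup⟩ := exists_comp_le_log hf hΩ hq₀ hpole hbot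
  obtain ⟨I, hI, hIq⟩ := exists_slice_upperCoord q₀
  set z₀ := upperCoord q₀ with hz₀
  have hz₀D : z₀ ∈ planarDomain Ω := upperCoord_mem_planarDomain hq₀
  have hz₀im : 0 ≤ z₀.im := norm_nonneg _
  have hD := hΩ.isOpen_planarDomain
  obtain ⟨C, hC⟩ := hpole
  set h : ℂ → EReal := fun z => v (f (slice I z)) with hh
  have hcont : ∀ z ∈ planarDomain Ω, ContinuousAt (fun z => f (slice I z)) z := fun z hz =>
    (hf.continuousAt hΩ ((hΩ.slice_mem_iff hI).2 hz)).comp (continuous_slice I).continuousAt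
  have hlow : ∀ᶠ z in 𝓝 z₀, z ∈ planarDomain Ω ∧ (z ≠ z₀ → f (slice I z) ≠ f q₀ ∧
      ((Real.log ‖f (slice I z) - f q₀‖ - C : ℝ) : EReal) ≤ h z) := by
    have h1 := hcont z₀ hz₀D
    rw [ContinuousAt, hIq] at h1
    filter_upwards [hD.mem_nhds hz₀D, h1.eventually (eventually_nhdsWithin_iff.1 hC),
      eventually_nhdsWithin_iff.1 (hf.eventually_slice_ne hΩ hnc hI hz₀D (f q₀))] with z a b c
    exact ⟨a, fun hz => ⟨c hz, (b (c hz)).1⟩⟩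
  obtain ⟨ε, hε, hball⟩ := Metric.eventually_nhds_iff_ball.1 hlow
  set δ := ε / 2 with hδdef
  have hδ : 0 < δ := half_pos hε
  have hin : ∀ z, ‖z - z₀‖ ≤ δ → z ∈ Metric.ball z₀ ε := fun z hz =>
    mem_ball_iff_norm.2 (hz.trans_lt (half_lt_self hε))
  have hann : ∀ z ∈ Metric.closedBall z₀ δ \ Metric.ball z₀ (δ / 2),
      ‖z - z₀‖ ≤ δ ∧ z ≠ z₀ := fun z hz => by
    refine ⟨mem_closedBall_iff_norm.1 hz.1, ?_⟩
    rintro rfl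
    exact hz.2 (Metric.mem_ball_self (half_pos hδ))
  -- f does not attain f(q₀) on the compact annulus in L_I, so its distance to f(q₀) has a positive
  -- lower bound m, and h ≥ log m - C there.
  obtain ⟨m, hm, hmle⟩ := ((isCompact_closedBall z₀ δ).diff
    (Metric.isOpen_ball (x := z₀) (ε := δ / 2))).exists_forall_le' (a := (0 : ℝ))
    (f := fun z => ‖f (slice I z) - f q₀‖)
    (fun z hz => (((hcont z (hball z (hin z (hann z hz).1)).1).sub
      continuousAt_const).norm).continuousWithinAt)
    (fun z hz => norm_pos_iff.2 (sub_ne_zero.2 ((hball z (hin z (hann z hz).1)).2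
      (hann z hz).2).1))
  set L := Real.log m - C with hL
  set R := 2 * ‖z₀‖ + δ with hR
  have hRpos : 0 < R := by positivity
  -- R bounds |q - q₀| for the points q over the disc, so log(c|q - q₀|) lies below both log(1/2) <
  -- 0 and the lower bound L of h on the annulus.
  set c := min (1 / 2) (Real.exp L) / R with hc
  have hcpos : 0 < c := div_pos (lt_min one_half_pos (Real.exp_pos L)) hRpos
  have hcR : c * R = min (1 / 2) (Real.exp L) := div_mul_cancel₀ _ hRpos.ne'
  have hbound : ∀ q : ℍ[ℝ], ∀ z : ℂ, ‖q‖ = ‖z‖ → ‖z - z₀‖ ≤ δ →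
      c * ‖q - q₀‖ ≤ min (1 / 2) (Real.exp L) := by
    intro q z hqz hz
    rw [← hcR]
    refine mul_le_mul_of_nonneg_left ?_ hcpos.le
    have e1 := norm_sub_le q q₀
    have e2 : ‖q₀‖ = ‖z₀‖ := (norm_upperCoord q₀).symm
    have e3 := norm_le_norm_add_norm_sub' z z₀
    rw [hR]
    linarith
  have hle : ∀ J ∈ imagUnits, ∀ z ∈ planarDomain Ω, δ / 2 ≤ ‖z - z₀‖ → ‖z - z₀‖ ≤ δ →
      poleLog c q₀ (slice J z) ≤ h z := by
    intro J hJ z _ h1 h2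
    have hzA : z ∈ Metric.closedBall z₀ δ \ Metric.ball z₀ (δ / 2) :=
      ⟨mem_closedBall_iff_norm.2 h2, fun h => absurd (mem_ball_iff_norm.1 h) (not_lt.2 h1)⟩
    refine (poleLog_le (t := L) ((hbound _ z (norm_slice hJ z) h2).trans (min_le_right _ _))).trans
      (le_trans (EReal.coe_le_coe_iff.2 ?_) ((hball z (hin z h2)).2 (hann z hzA).2).2)
    exact sub_le_sub_right (Real.log_le_log hm (hmle z hzA)) C
  have hlneg : ∀ q : ℍ[ℝ], ∀ z : ℂ, ‖q‖ = ‖z‖ → ‖z - z₀‖ ≤ δ → poleLog c q₀ q < 0 := by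
    intro q z hqz hz
    refine (poleLog_le (t := Real.log (1 / 2)) ?_).trans_lt ?_
    · rw [Real.exp_log one_half_pos]
      exact (hbound q z hqz hz).trans (min_le_left _ _)
    · rw [← EReal.coe_zero, EReal.coe_lt_coe_iff]
      exact Real.log_neg one_half_pos one_half_lt_one
  have hh' : IsSubharmonicOn (fun z => h (starRingEnd ℂ z)) (planarDomain Ω) := by
    have := hvf (-I) (neg_mem_imagUnits hI)
    simp only [slice_neg_left] at this
    exact this
  have hhem := fun J (hJ : J ∈ imagUnits) => isSubharmonicOn_hemisphereMax hΩ hI (hvf I hI) hh' hδ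
    (l := poleLog c q₀) (fun J hJ => isSubharmonicOn_poleLog hcpos hJ q₀ hD) hle hJ
  set u : ℍ[ℝ] → EReal := fun q => max (v (f q)) (hemisphereMax I h z₀ δ (poleLog c q₀) q) with hu
  have hunorm : ∀ q : ℍ[ℝ], ‖q‖ = ‖upperCoord q‖ := fun q => (norm_upperCoord q).symm
  have huneg : ∀ q ∈ Ω, u q < 0 := by
    intro q hq
    have hzD := upperCoord_mem_planarDomain hq
    have key : ∀ z ∈ planarDomain Ω, ‖q‖ = ‖z‖ → diskMax h z₀ δ (poleLog c q₀ q) z < 0 := by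
      intro z hz hqz
      have h1 : h z < 0 := hneg _ (Set.mem_image_of_mem f ((hΩ.slice_mem_iff hI).2 hz))
      unfold diskMax
      split_ifs with hd
      exacts [max_lt h1 (hlneg q z hqz hd), h1]
    refine max_lt (hneg _ (Set.mem_image_of_mem f hq)) (hemisphereMax_lt (EReal.bot_lt_zero)
      (fun _ => key _ hzD (hunorm q)) fun _ => key _ (conj_mem_planarDomain hzD) ?_)
    rw [RCLike.norm_conj, hunorm]
  -- The opposite orientation matters near q₀ only if q₀ is real, and then conjugation fixes z₀.
  have hnear : ∀ᶠ q in 𝓝 q₀, ((sliceCoord I q).im ≤ 0 →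
      ‖starRingEnd ℂ (upperCoord q) - z₀‖ ≤ ‖q - q₀‖) := by
    rcases hz₀im.eq_or_lt with h0 | h0
    · refine Eventually.of_forall fun q _ => ?_
      rw [← Complex.conj_eq_iff_im.2 h0.symm, ← map_sub, RCLike.norm_conj]
      exact norm_upperCoord_sub_le q q₀
    · have h1 : Continuous fun q => (sliceCoord I q).im :=
        Complex.continuous_im.comp (continuous_sliceCoord I)
      have h2 : sliceCoord I q₀ = z₀ := by rw [← hIq, sliceCoord_slice hI]
      filter_upwards [(h1.tendsto q₀).eventually_const_lt (by rw [h2]; exact h0)] with q hq hq'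
      exact absurd hq (not_lt.2 hq')
  have hnear2 : ∀ᶠ q in 𝓝 q₀, ‖q - q₀‖ < min η δ := by
    filter_upwards [Metric.ball_mem_nhds q₀ (lt_min hη hδ)] with q hq
    exact mem_ball_iff_norm.1 hq
  set C₂ := max C₁ |Real.log c| + 1 with hC₂
  have hupole : HasLogPole u q₀ := by
    refine ⟨C₂, ?_⟩
    filter_upwards [nhdsWithin_le_nhds hnear, nhdsWithin_le_nhds hnear2, self_mem_nhdsWithin]
      with q hq1 hq2 hq3
    have hr : 0 < ‖q - q₀‖ := norm_pos_iff.2 (sub_ne_zero.2 hq3)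
    have hz := norm_upperCoord_sub_le q q₀
    have hl : poleLog c q₀ q = ((Real.log c + Real.log ‖q - q₀‖ : ℝ) : EReal) :=
      poleLog_of_ne hcpos hq3
    have hle1 : C₁ < C₂ := (le_max_left _ _).trans_lt (lt_add_one _)
    have hle2 : |Real.log c| < C₂ := (le_max_right _ _).trans_lt (lt_add_one _)
    constructor
    · have h1 : ((Real.log ‖q - q₀‖ - C₂ : ℝ) : EReal) ≤ poleLog c q₀ q := by
        rw [hl, EReal.coe_le_coe_iff]
        linarith [neg_abs_le (Real.log c)]
      refine h1.trans (le_trans ?_ (le_max_right _ _))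
      have hd : ∀ z, ‖z - z₀‖ ≤ ‖q - q₀‖ →
          poleLog c q₀ q ≤ diskMax h z₀ δ (poleLog c q₀ q) z := fun z hz => by
        rw [diskMax, if_pos (hz.trans (hq2.le.trans (min_le_right _ _)))]
        exact le_max_right _ _
      rcases le_total 0 (sliceCoord I q).im with hs | hs
      · refine le_trans ?_ (le_max_left _ _)
        rw [if_pos hs]
        exact hd _ hz
      · refine le_trans ?_ (le_max_right _ _)
        rw [if_pos hs]
        exact hd _ (hq1 hs)
    · have key : ∀ z, ‖z - z₀‖ ≤ ‖q - q₀‖ →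
          diskMax h z₀ δ (poleLog c q₀ q) z < ((Real.log ‖q - q₀‖ + C₂ : ℝ) : EReal) := by
        intro z hz'
        have e : ‖slice I z - q₀‖ = ‖z - z₀‖ := by rw [← hIq, norm_slice_sub hI]
        refine (diskMax_le _ _ _ _ _).trans_lt (max_lt
          ((hup (slice I z) ?_ _ hr (e.trans_le hz')).trans_lt ?_) ?_)
        · rw [e]; exact hz'.trans_lt (hq2.trans_le (min_le_left _ _))
        · rw [EReal.coe_lt_coe_iff]; linarith
        · rw [hl, EReal.coe_lt_coe_iff]; linarith [le_abs_self (Real.log c)]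
      refine max_le ((hup q (hq2.trans_le (min_le_left _ _)) _ hr le_rfl).trans ?_)
        (hemisphereMax_lt (EReal.bot_lt_coe _) (fun _ => key _ hz) fun hs => key _ (hq1 hs)).le
      rw [EReal.coe_le_coe_iff]
      linarith
  refine ⟨u, (mem_wshPole_iff hΩ.isOpen hq₀).2 ⟨⟨⟨?_, fun q hq => ?_, ?_⟩, fun J hJ => ?_⟩, huneg,
    hupole⟩, fun q _ => le_max_left _ _⟩
  · refine UpperSemicontinuousOn.sup (UpperSemicontinuousOn.comp hwsh.1.1 (fun q hq =>
      (hf.continuousAt hΩ hq).continuousWithinAt) (Set.mapsTo_image f Ω)) ?_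
    exact upperSemicontinuousOn_hemisphereMax hΩ I (hvf I hI).usc z₀ δ (continuous_poleLog c q₀)
  · exact ((huneg q hq).trans EReal.zero_lt_top).ne
  · obtain ⟨C', hC'⟩ := hupole
    obtain ⟨q, hq1, hq2⟩ := (hC'.and (nhdsWithin_le_nhds (hΩ.isOpen.mem_nhds hq₀))).exists
    exact ⟨q, hq2, ((EReal.bot_lt_coe _).trans_le hq1.1).ne'⟩
  · rw [hΩ.preimage_slice hJ]
    exact (hvf J hJ).sup (hhem J hJ)

end

/-! ### Pullbacks, images of slice preserving maps, and the conclusion. -/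

section

/-! ### Pullbacks under regular maps -/

variable {Ω : Set ℍ[ℝ]} {q₀ : ℍ[ℝ]} {f : ℍ[ℝ] → ℍ[ℝ]}

theorem IsPlurisubharmonicOn.hasLocalSubmeanOn {I : ℍ[ℝ]} (hI : I ∈ imagUnits) {W : Set ℍ[ℝ]}
    (hW : IsOpen W) {v : ℍ[ℝ] → EReal} (htop : ∀ p ∈ W, v p ≠ ⊤)
    (hv : IsPlurisubharmonicOn I v W) :
    letI := sliceNormedSpace I hI
    HasLocalSubmeanOn v W := by
  let _ := sliceNormedSpace I hI
  intro a ha b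
  change ∀ᶠ ρ in 𝓝[>] (0 : ℝ), v a ≤ circleMean (fun z : ℂ => v (a + slice I z * b)) 0 ρ
  by_cases hb : b = 0
  · simp only [hb, mul_zero, add_zero]
    exact Eventually.of_forall fun ρ => le_circleMean_const (htop a ha) _ _
  · have hc : Continuous fun z : ℂ => a + slice I z * b :=
      continuous_const.add ((continuous_slice I).mul continuous_const)
    have h0 : a + slice I 0 * b = a := by simp [slice]
    have h := (hv a b hb).eventually_le_circleMean (hW.preimage hc) (a := 0)
      (by change a + slice I 0 * b ∈ W; rw [h0]; exact ha)
    simpa only [h0] using h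

theorem IsPlurisubharmonicOn.isSubharmonicOn_comp_slice (hf : IsSliceRegularOn f Ω)
    (hΩ : IsSymmetricSliceDomain Ω) {I : ℍ[ℝ]} (hI : I ∈ imagUnits) {W : Set ℍ[ℝ]} (hW : IsOpen W)
    (hmaps : Set.MapsTo f Ω W) {v : ℍ[ℝ] → EReal} (husc : UpperSemicontinuousOn v W)
    (htop : ∀ p ∈ W, v p ≠ ⊤) (hv : IsPlurisubharmonicOn I v W) :
    IsSubharmonicOn (fun z => v (f (slice I z))) (planarDomain Ω) := by
  let _ := sliceNormedSpace I hI
  have := finiteDimensional_sliceNormedSpace I hI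
  exact isSubharmonicOn_comp hW husc htop (hv.hasLocalSubmeanOn hI hW htop) hΩ.isOpen_planarDomain
    ((hf.isSliceHolomorphicOn_planarDomain hΩ hI).differentiableOn hI)
    fun z hz => hmaps ((hΩ.slice_mem_iff hI).2 hz)

theorem sliceCoord_slice_mul {I : ℍ[ℝ]} (hI : I ∈ imagUnits) (z : ℂ) (q : ℍ[ℝ]) :
    sliceCoord I (slice I z * q) = z * sliceCoord I q := by
  have hII : I * I = -1 := hI
  have h : I * (slice I z * q) = z.re • (I * q) - z.im • q := by
    rw [slice, add_mul, mul_add, Quaternion.coe_mul_eq_smul, mul_smul_comm, mul_assoc,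
      Quaternion.coe_mul_eq_smul, mul_smul_comm, ← mul_assoc, hII, neg_one_mul, smul_neg,
      sub_eq_add_neg]
  have h' : slice I z * q = z.re • q + z.im • (I * q) := by
    rw [slice, add_mul, Quaternion.coe_mul_eq_smul, mul_assoc, Quaternion.coe_mul_eq_smul]
  apply Complex.ext
  · simp only [sliceCoord, h', Quaternion.re_add, Quaternion.re_smul, Complex.mul_re, smul_eq_mul]
    ring
  · simp only [sliceCoord, h, Quaternion.re_sub, Quaternion.re_smul, Complex.mul_im, smul_eq_mul]
    ring

theorem sliceCoord_add (I p q : ℍ[ℝ]) :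
    sliceCoord I (p + q) = sliceCoord I p + sliceCoord I q := by
  apply Complex.ext
  · simp [sliceCoord]
  · simp only [sliceCoord, mul_add, Quaternion.re_add, Complex.add_im]
    ring

theorem IsSliceRegularOn.differentiableOn_sliceCoord (hf : IsSliceRegularOn f Ω)
    (hΩ : IsSymmetricSliceDomain Ω) {I : ℍ[ℝ]} (hI : I ∈ imagUnits) :
    DifferentiableOn ℂ (fun z => sliceCoord I (f (slice I z))) (planarDomain Ω) := by
  let _ := sliceNormedSpace I hI
  let T : ℍ[ℝ] →L[ℂ] ℂ :=
    { toFun := sliceCoord I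
      map_add' := sliceCoord_add I
      map_smul' := sliceCoord_slice_mul hI
      cont := continuous_sliceCoord I }
  exact T.differentiable.comp_differentiableOn
    ((hf.isSliceHolomorphicOn_planarDomain hΩ hI).differentiableOn hI)

theorem IsSlicePreservingOn.slice_sliceCoord (hsp : IsSlicePreservingOn f Ω)
    (hΩ : IsSymmetricSliceDomain Ω) {I : ℍ[ℝ]} (hI : I ∈ imagUnits) {z : ℂ}
    (hz : z ∈ planarDomain Ω) : slice I (sliceCoord I (f (slice I z))) = f (slice I z) :=
  SliceGreen.slice_sliceCoord hI (hsp I hI ⟨(hΩ.slice_mem_iff hI).2 hz, z, rfl⟩)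

theorem IsSlicePreservingOn.isSubharmonicOn_comp_slice (hsp : IsSlicePreservingOn f Ω)
    (hf : IsSliceRegularOn f Ω) (hΩ : IsSymmetricSliceDomain Ω) {I : ℍ[ℝ]} (hI : I ∈ imagUnits)
    {W : Set ℍ[ℝ]} (hW : IsOpen W) (hmaps : Set.MapsTo f Ω W) {v : ℍ[ℝ] → EReal}
    (hv : IsSubharmonicOn (v ∘ slice I) (slice I ⁻¹' W)) :
    IsSubharmonicOn (fun z => v (f (slice I z))) (planarDomain Ω) := by
  refine (hv.comp_holomorphic (hW.preimage (continuous_slice I)) hΩ.isOpen_planarDomain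
    (hf.differentiableOn_sliceCoord hΩ hI) fun z hz => ?_).congr fun z hz => ?_
  · rw [Set.mem_preimage, hsp.slice_sliceCoord hΩ hI hz]
    exact hmaps ((hΩ.slice_mem_iff hI).2 hz)
  · simp only [Function.comp_apply]
    rw [hsp.slice_sliceCoord hΩ hI hz]

/-! ### Images of slice preserving maps -/

theorem eq_re_of_forall_mem_slicePlane {q : ℍ[ℝ]} (h : ∀ K ∈ imagUnits, q ∈ slicePlane K) :
    q = (q.re : ℍ[ℝ]) := by
  obtain ⟨K, hK⟩ := imagUnits_nonempty
  obtain ⟨K', hK', -, h1, h2⟩ := exists_imagUnit_near hK univ_mem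
  obtain ⟨z, rfl⟩ := h K hK
  have hz : z.im = 0 := by
    rcases im_eq_zero_or_of_mem_slicePlane hK' hK (h K' hK') with h | h | h
    exacts [h, absurd h.symm h1, absurd (by rw [h, neg_neg]) h2]
  rw [re_slice hK, ← slice_ofReal K]
  congr 1
  exact Complex.ext rfl (by simpa using hz)

theorem smul_mem_slicePlane {K q : ℍ[ℝ]} (r : ℝ) (hq : q ∈ slicePlane K) :
    r • q ∈ slicePlane K := by
  obtain ⟨z, rfl⟩ := hq
  refine ⟨r * z, ?_⟩
  simp [slice, smul_add, ← Quaternion.coe_mul_eq_smul, mul_assoc]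

/-- Since f maps both x + yK and x - yK into L_K, the stem values a and b lie in L_K for every K.
The slices have only ℝ in common, so a and b are real valued. -/
theorem IsSlicePreservingOn.exists_planar (hsp : IsSlicePreservingOn f Ω)
    (hf : IsSliceRegularOn f Ω) (hΩ : IsSymmetricSliceDomain Ω) :
    ∃ φ : ℂ → ℂ, ∀ z ∈ planarDomain Ω, ∀ J ∈ imagUnits, f (slice J z) = slice J (φ z) := by
  obtain ⟨a, b, hab⟩ := hf.exists_isStem hΩ
  have key : ∀ z ∈ planarDomain Ω, ∀ K ∈ imagUnits, a z ∈ slicePlane K ∧ b z ∈ slicePlane K := by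
    intro z hz K hK
    have hK2 : K * K = -1 := hK
    obtain ⟨w₁, h1⟩ := hsp K hK ⟨(hΩ.slice_mem_iff hK).2 hz, z, rfl⟩
    obtain ⟨w₂, h2⟩ := hsp K hK (x := slice (-K) z)
      ⟨(hΩ.slice_mem_iff (neg_mem_imagUnits hK)).2 hz, _, slice_conj K z⟩
    rw [hab.eq z hz K hK] at h1
    rw [hab.eq z hz _ (neg_mem_imagUnits hK), neg_mul] at h2
    have ha : a z = (1 / 2 : ℝ) • slice K (w₁ + w₂) := by
      rw [slice_add, h1, h2]; module
    have hKi : slice K Complex.I = K := by simp [slice]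
    have hb : b z = (-(1 / 2) : ℝ) • slice K (Complex.I * (w₁ - w₂)) := by
      rw [slice_mul hK, slice_sub, h1, h2, hKi, mul_sub, mul_add, mul_add, mul_neg, ← mul_assoc,
        hK2]
      simp only [neg_mul, one_mul]
      module
    rw [ha, hb]
    exact ⟨smul_mem_slicePlane _ ⟨_, rfl⟩, smul_mem_slicePlane _ ⟨_, rfl⟩⟩
  refine ⟨fun z => ⟨(a z).re, (b z).re⟩, fun z hz J hJ => ?_⟩
  rw [hab.eq z hz J hJ, eq_re_of_forall_mem_slicePlane fun K hK => (key z hz K hK).1,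
    eq_re_of_forall_mem_slicePlane fun K hK => (key z hz K hK).2, slice]
  dsimp only
  rw [Quaternion.coe_commutes]

/-- A value on L_I attained on L_K is either real, and then constant on the sphere of the preimage,
or K = ±I. -/
theorem IsSlicePreservingOn.exists_of_mem_slicePlane (hsp : IsSlicePreservingOn f Ω)
    (hf : IsSliceRegularOn f Ω) (hΩ : IsSymmetricSliceDomain Ω) {I : ℍ[ℝ]} (hI : I ∈ imagUnits)
    {q : ℍ[ℝ]} (hq : q ∈ Ω) (hfq : f q ∈ slicePlane I) :
    ∃ z ∈ planarDomain Ω, f (slice I z) = f q := by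
  obtain ⟨φ, hφ⟩ := hsp.exists_planar hf hΩ
  obtain ⟨K, hK, hKq⟩ := exists_slice_upperCoord q
  have hz := upperCoord_mem_planarDomain hq
  rw [← hKq] at hfq ⊢
  set z := upperCoord q
  rw [hφ z hz K hK] at hfq
  rcases im_eq_zero_or_of_mem_slicePlane hI hK hfq with h | rfl | rfl
  · refine ⟨z, hz, ?_⟩
    have : φ z = ((φ z).re : ℂ) := Complex.ext rfl (by simpa using h)
    rw [hφ z hz I hI, hφ z hz K hK, this, slice_ofReal, slice_ofReal]
  · exact ⟨z, hz, rfl⟩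
  · exact ⟨_, conj_mem_planarDomain hz, by rw [slice_conj]⟩

theorem IsSlicePreservingOn.isSymmetricSliceDomain_image (hsp : IsSlicePreservingOn f Ω)
    (hf : IsSliceRegularOn f Ω) (hΩ : IsSymmetricSliceDomain Ω)
    (hnc : ∃ p ∈ Ω, ∃ q ∈ Ω, f p ≠ f q) : IsSymmetricSliceDomain (f '' Ω) := by
  obtain ⟨φ, hφ⟩ := hsp.exists_planar hf hΩ
  have hcont : ContinuousOn f Ω := fun q hq => (hf.continuousAt hΩ hq).continuousWithinAt
  obtain ⟨x, hx⟩ := hΩ.exists_ofReal_mem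
  refine ⟨hf.isOpen_image hΩ hnc, hΩ.isConnected.image f hcont, ⟨(f x).re, x,
    hΩ.ofReal_mem_iff.1 hx, eq_re_of_forall_mem_slicePlane fun K hK => ?_⟩, fun I hI => ?_,
    fun s t I hI J hJ hst => ?_⟩
  · rw [← slice_ofReal K, hφ _ hx K hK]
    exact ⟨_, rfl⟩
  · have heq : f '' Ω ∩ slicePlane I = f '' (Ω ∩ slicePlane I) := by
      refine Set.Subset.antisymm ?_ ?_
      · rintro _ ⟨⟨q, hq, rfl⟩, hfq⟩
        obtain ⟨z, hz, hzq⟩ := hsp.exists_of_mem_slicePlane hf hΩ hI hq hfq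
        exact ⟨slice I z, ⟨(hΩ.slice_mem_iff hI).2 hz, z, rfl⟩, hzq⟩
      · rintro _ ⟨q, hq, rfl⟩
        exact ⟨⟨q, hq.1, rfl⟩, hsp I hI hq⟩
    rw [heq]
    exact (hΩ.slice_connected I hI).image f (hcont.mono Set.inter_subset_left)
  · obtain ⟨q, hq, hfq⟩ := hst
    obtain ⟨z, hz, hzq⟩ := hsp.exists_of_mem_slicePlane hf hΩ hI hq ⟨⟨s, t⟩, hfq.symm⟩
    rw [hφ z hz I hI, hfq] at hzq
    have hzst : φ z = ⟨s, t⟩ := slice_injective hI hzq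
    refine ⟨slice J z, (hΩ.slice_mem_iff hJ).2 hz, ?_⟩
    rw [hφ z hz J hJ, hzst]
    rfl

/-! ### Comparison of Green functions -/

theorem uscReg_image_le (hf : IsSliceRegularOn f Ω) (hΩ : IsSymmetricSliceDomain Ω)
    (hnc : ∃ p ∈ Ω, ∃ q ∈ Ω, f p ≠ f q) (hq₀ : q₀ ∈ Ω) {S : Set (ℍ[ℝ] → EReal)}
    (hS : ∀ v ∈ S, v ∈ wshPole (f '' Ω) (f q₀) ∧
      ∀ I ∈ imagUnits, IsSubharmonicOn (fun z => v (f (slice I z))) (planarDomain Ω))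
    {q : ℍ[ℝ]} (hq : q ∈ Ω) : uscReg (f '' Ω) (supFamily S) (f q) ≤ greenFn Ω q₀ q := by
  refine uscReg_supFamily_le hf hΩ hnc hq₀ (fun q hq => iSup₂_le fun v hv => ?_) hq
  obtain ⟨u, hu, hvu⟩ := exists_wshPole_ge hf hΩ hnc hq₀ (hS v hv).1 (hS v hv).2
  exact (hvu q hq).trans (le_iSup₂ (f := fun w (_ : w ∈ wshPole Ω q₀) => w q) u hu)

theorem strongGreenFn_image_le (hf : IsSliceRegularOn f Ω) (hΩ : IsSymmetricSliceDomain Ω)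
    (hnc : ∃ p ∈ Ω, ∃ q ∈ Ω, f p ≠ f q) (hq₀ : q₀ ∈ Ω) {q : ℍ[ℝ]} (hq : q ∈ Ω) :
    strongGreenFn (f '' Ω) (f q₀) (f q) ≤ greenFn Ω q₀ q :=
  uscReg_image_le hf hΩ hnc hq₀ (fun _ hv => ⟨hv.1, fun I hI =>
    (hv.2.2 I hI).isSubharmonicOn_comp_slice hf hΩ hI (hf.isOpen_image hΩ hnc)
      (Set.mapsTo_image f Ω) hv.2.1.1 hv.2.1.2.1⟩) hq

theorem IsSlicePreservingOn.greenFn_image_le (hsp : IsSlicePreservingOn f Ω)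
    (hf : IsSliceRegularOn f Ω) (hΩ : IsSymmetricSliceDomain Ω)
    (hnc : ∃ p ∈ Ω, ∃ q ∈ Ω, f p ≠ f q) (hq₀ : q₀ ∈ Ω) {q : ℍ[ℝ]} (hq : q ∈ Ω) :
    greenFn (f '' Ω) (f q₀) (f q) ≤ greenFn Ω q₀ q :=
  uscReg_image_le hf hΩ hnc hq₀ (fun _ hv => ⟨hv, fun I hI =>
    hsp.isSubharmonicOn_comp_slice hf hΩ hI (hf.isOpen_image hΩ hnc) (Set.mapsTo_image f Ω)
      (hv.1.2 I hI)⟩) hq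

/-- The inverse preserves slices, because each point of f(Ω) ∩ L_I is the image of a point of Ω ∩
L_I. The comparison is then applied to the inverse on the symmetric slice domain f(Ω). -/
theorem IsSlicePreservingOn.greenFn_le_image (hsp : IsSlicePreservingOn f Ω)
    (hf : IsSliceRegularOn f Ω) (hΩ : IsSymmetricSliceDomain Ω)
    (hnc : ∃ p ∈ Ω, ∃ q ∈ Ω, f p ≠ f q) (hq₀ : q₀ ∈ Ω) {g : ℍ[ℝ] → ℍ[ℝ]}
    (hg : IsSliceRegularOn g (f '' Ω)) (hgf : ∀ q ∈ Ω, g (f q) = q) {q : ℍ[ℝ]} (hq : q ∈ Ω) :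
    greenFn Ω q₀ q ≤ greenFn (f '' Ω) (f q₀) (f q) := by
  have hgsp : IsSlicePreservingOn g (f '' Ω) := by
    rintro I hI _ ⟨⟨p, hp, rfl⟩, hfp⟩
    obtain ⟨z, hz, hzp⟩ := hsp.exists_of_mem_slicePlane hf hΩ hI hp hfp
    rw [← hzp, hgf _ ((hΩ.slice_mem_iff hI).2 hz)]
    exact ⟨z, rfl⟩
  have himg : g '' (f '' Ω) = Ω := by
    rw [Set.image_image]
    exact (Set.image_congr hgf).trans (Set.image_id' Ω)
  obtain ⟨p₁, hp₁, p₂, hp₂, hne⟩ := hnc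
  have h := hgsp.greenFn_image_le hg
    (hsp.isSymmetricSliceDomain_image hf hΩ ⟨p₁, hp₁, p₂, hp₂, hne⟩)
    ⟨f p₁, ⟨p₁, hp₁, rfl⟩, f p₂, ⟨p₂, hp₂, rfl⟩, fun heq => hne (by
      rw [hgf p₁ hp₁, hgf p₂ hp₂] at heq; rw [heq])⟩
    (Set.mem_image_of_mem f hq₀) (Set.mem_image_of_mem f hq)
  rwa [himg, hgf q hq, hgf q₀ hq₀] at h

end

end SliceGreen

end

theorem mainTheorem11 (Ω : Set ℍ[ℝ]) (hΩ : SliceGreen.IsSymmetricSliceDomain Ω)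
    (q₀ : ℍ[ℝ]) (hq₀ : q₀ ∈ Ω) (f : ℍ[ℝ] → ℍ[ℝ]) (hf : SliceGreen.IsSliceRegularOn f Ω)
    (hnc : ∃ a ∈ Ω, ∃ b ∈ Ω, f a ≠ f b) :
    (∀ q ∈ Ω, SliceGreen.strongGreenFn (f '' Ω) (f q₀) (f q) ≤ SliceGreen.greenFn Ω q₀ q) ∧
    (SliceGreen.IsSlicePreservingOn f Ω →
      (∀ q ∈ Ω, SliceGreen.greenFn (f '' Ω) (f q₀) (f q) ≤ SliceGreen.greenFn Ω q₀ q) ∧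
      ((∃ g : ℍ[ℝ] → ℍ[ℝ], SliceGreen.IsSliceRegularOn g (f '' Ω) ∧ ∀ q ∈ Ω, g (f q) = q) →
        ∀ q ∈ Ω, SliceGreen.greenFn (f '' Ω) (f q₀) (f q) = SliceGreen.greenFn Ω q₀ q)) := by
  refine ⟨fun q hq => SliceGreen.strongGreenFn_image_le hf hΩ hnc hq₀ hq, fun hsp =>
    ⟨fun q hq => hsp.greenFn_image_le hf hΩ hnc hq₀ hq, ?_⟩⟩
  rintro ⟨g, hg, hgf⟩ q hq
  exact le_antisymm (hsp.greenFn_image_le hf hΩ hnc hq₀ hq)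
    (hsp.greenFn_le_image hf hΩ hnc hq₀ hg hgf hq)
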